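/- Let $n\ge 0$ be an integer and $\lambda\in\mathbb R$. Put $\mathcal H=L^2(\mathbb R^n\times\mathbb R^n\times\mathbb R)$ (variables $(x,y,r)$, Lebesgue measure) and identify $\mathcal H\otimes\mathcal H$ with the $L^2$-functions of $(x,y,r;x',y',r')$. Write $e(t)=e^{2\pi i t}$, $\bar e(t)=e^{-2\pi it}$, $\beta$ for the usual inner product of $\mathbb R^n$, and $\eta_\lambda(r)=\frac{e^{2\lambda r}-1}{2\lambda}$ ($\eta_0(r)=r$). Let $U_A$ be the operator on $\mathcal H\otimes\mathcal H$ $$U_A\xi(x,y,r,x',y',r')=(e^{-\lambda r'})^n\,\bar e\bigl[\eta_\lambda(r')\beta(e^{-\lambda r'}x,\,y'-e^{-\lambda r'}y)\bigr]\,\xi(e^{-\lambda r'}x,e^{-\lambda r'}y,r+r',x'-e^{-\lambda r'}x,y'-e^{-\lambda r'}y,r'),$$ let $\hat A\subseteq\mathcal B(\mathcal H)$ be the $C^*$-algebra generated by the slices $(\mathrm{id}\otimes\omega)(U_A)$, $\omega\in\mathcal B(\mathcal H)_*$, let $\hat{\mathcal A}$ be the space of Schwartz functions of $(x,y,r)$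 with compact support in $r$, and for $f\in\hat{\mathcal A}$ let $$(\rho_f\zeta)(x,y,r)=\int(e^{\lambda s})^nf(x,y,s)\,\zeta(e^{\lambda s}x,e^{\lambda s}y,r-s)\,ds .$$ Let $\hat A\otimes\hat A\subseteq\mathcal B(\mathcal H\otimes\mathcal H)$ be the minimal tensor product and realize $M(\hat A\otimes\hat A)$ as $\{T\in\mathcal B(\mathcal H\otimes\mathcal H):T(\hat A\otimes\hat A)\subseteq\hat A\otimes\hat A,\ (\hat A\otimes\hat A)T\subseteq\hat A\otimes\hat A\}$. For $f\in\hat{\mathcal A}$ let $\hat\Delta f$ be $$\hat\Delta f(x,y,r;x',y',r')=\int f(x+x',y+y',s)\,e[\eta_\lambda(s)\beta(x,y')]\,e[s(z+z')]\,\bar e[zr+z'r']\,ds\,dz\,dz',$$ understood as an oscillatory integral: for all $x,y,x',y'$ it is the generalized function of $(r,r')$ whose pairing with $\Phi\in C_c^\infty(\mathbb R^2)$ is $$\int f(x+x',y+y',s)\,e[\eta_\lambda(s)\beta(x,y')]\,e[s(z+z')]\Bigl(\int\bar e[zr+z'r']\,\Phi(r,r')\,dr\,dr'\Bigr)ds\,dz\,dz'.$$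 For such a kernel $F$ (a function of $(x,y,x',y')$ and a generalized function of $(r,r')$), a bounded operator $T$ on $\mathcal H\otimes\mathcal H$ is called $(\rho\otimes\rho)_F$ if for every Schwartz function $\xi$ with compact support in $r$ and $r'$, almost everywhere, $$T\xi(x,y,r;x',y',r')=\int(e^{\lambda s})^n(e^{\lambda s'})^nF(x,y,s;x',y',s')\,\xi(e^{\lambda s}x,e^{\lambda s}y,r-s;e^{\lambda s'}x',e^{\lambda s'}y',r'-s')\,ds\,ds',$$ the integral being the pairing of $F(x,y,\cdot\,;x',y',\cdot)$ with the remaining factors. Then the following hold. 1. The formulas for $U_A$ and for $\rho_f$ ($f\in\hat{\mathcal A}$) define bounded operators, $U_A$ is unitary, and for all $a,b\in\mathcal B(\mathcal H)$ there is a bounded operator $a\otimes b$ on $\mathcal H\otimes\mathcal H$ with $(a\otimes b)(\xi\otimes\eta)=a\xi\otimes b\eta$. Moreover $\hat A=\overline{\{(\mathrm{id}\otimes\omega)(U_A):\omega\in\mathcal B(\mathcal H)_*\}}=\overline{\{\rho_f:f\in\hat{\mathcal A}\}}$ (norm closures). 2. For $f\in\hat{\mathcal A}$ and $\Phi\in C_c^\infty(\mathbb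 R^2)$, both the inner and the outer integral in the definition of $\hat\Delta f$ converge absolutely. The operator $(\rho\otimes\rho)_{\hat\Delta f}$ exists, is unique, and $$(\rho\otimes\rho)_{\hat\Delta f}=U_A^*(1\otimes\rho_f)U_A .$$ 3. The formula $\hat\Delta(b)=U_A^*(1\otimes b)U_A$ defines a $^*$-homomorphism $\hat\Delta:\hat A\to M(\hat A\otimes\hat A)$ that is non-degenerate (the closed linear span of $\hat\Delta(\hat A)(\hat A\otimes\hat A)$ is $\hat A\otimes\hat A$) and satisfies $\hat\Delta(\rho_f)=(\rho\otimes\rho)_{\hat\Delta f}$ for all $f\in\hat{\mathcal A}$. It is the only continuous map $\hat A\to\mathcal B(\mathcal H\otimes\mathcal H)$ with this last property. -/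

import Mathlib

open MeasureTheory
open scoped ContDiff SchwartzMap ComplexConjugate

namespace QHeis

/-- The space of `(x, y, r)` variables, with Lebesgue measure. -/
abbrev Pt (n : ℕ) : Type :=
  EuclideanSpace ℝ (Fin n) × EuclideanSpace ℝ (Fin n) × ℝ

/-- The Hilbert space `H` of square integrable functions of `(x, y, r)`. -/
abbrev Hilb (n : ℕ) : Type := Lp ℂ 2 (volume : Measure (Pt n))

/-- The Hilbert space `H ⊗ H`, realized as the square integrable functions of
`(x, y, r; x', y', r')`. -/
abbrev Hilb2 (n : ℕ) : Type := Lp ℂ 2 (volume : Measure (Pt n × Pt n))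

/-- Bounded operators on `H`. -/
abbrev BH (n : ℕ) : Type := Hilb n →L[ℂ] Hilb n

/-- Bounded operators on `H ⊗ H`. -/
abbrev BHH (n : ℕ) : Type := Hilb2 n →L[ℂ] Hilb2 n

/-- `e(t) = exp(2 π i t)`. -/
noncomputable def e (t : ℝ) : ℂ := Complex.exp (2 * Real.pi * Complex.I * t)

/-- `η_λ(r) = (exp(2 λ r) - 1) / (2 λ)`, read as `r` when `λ = 0`. -/
noncomputable def eta (lam r : ℝ) : ℝ :=
  if lam = 0 then r else (Real.exp (2 * lam * r) - 1) / (2 * lam)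

/-- The usual inner product on `ℝⁿ`. -/
noncomputable def beta {n : ℕ} (x y : EuclideanSpace ℝ (Fin n)) : ℝ := inner ℝ x y

/-- The algebra of Schwartz functions of `(x, y, r)` with compact support in `r`. -/
def AhatFun (n : ℕ) : Set 𝓢(Pt n, ℂ) :=
  {f | ∃ R : ℝ, ∀ x y r, R < |r| → f (x, y, r) = 0}

/-- Schwartz functions of `(x, y, r; x', y', r')` with compact support in `r` and `r'`. -/
def Core2 (n : ℕ) : Set 𝓢(Pt n × Pt n, ℂ) :=
  {ξ | ∃ R : ℝ, ∀ x y r x' y' r', (R < |r| ∨ R < |r'|) → ξ ((x, y, r), (x', y', r')) = 0}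

/-! ### Operators given by a formula -/

/-- The bounded operator `T` is given, almost everywhere, by the formula `F`. -/
def IsGivenBy {Y : Type*} [MeasureSpace Y] (F : (Y → ℂ) → (Y → ℂ))
    (T : Lp ℂ 2 (volume : Measure Y) →L[ℂ] Lp ℂ 2 (volume : Measure Y)) : Prop :=
  ∀ ξ : Lp ℂ 2 (volume : Measure Y), T ξ =ᵐ[volume] F ξ

open Classical in
/-- The (necessarily unique) bounded operator given by the formula `F`; it is `0` if there is
no such operator. -/
noncomputable def opGivenBy {Y : Type*} [MeasureSpace Y] (F : (Y → ℂ) → (Y → ℂ)) :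
    Lp ℂ 2 (volume : Measure Y) →L[ℂ] Lp ℂ 2 (volume : Measure Y) :=
  if h : ∃ T, IsGivenBy F T then h.choose else 0

/-- The formula for `ρ_f`. -/
noncomputable def rhoFormula {n : ℕ} (lam : ℝ) (f : Pt n → ℂ) (ζ : Pt n → ℂ) : Pt n → ℂ :=
  fun (x, y, r) => ∫ s : ℝ, (Real.exp (lam * s) : ℂ) ^ n * f (x, y, s) *
    ζ (Real.exp (lam * s) • x, Real.exp (lam * s) • y, r - s)

/-- The operator `ρ_f`. -/
noncomputable def rho {n : ℕ} (lam : ℝ) (f : Pt n → ℂ) : BH n := opGivenBy (rhoFormula lam f)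

/-- The formula for the multiplicative unitary `U_A`. -/
noncomputable def UFormula {n : ℕ} (lam : ℝ) (ξ : Pt n × Pt n → ℂ) : Pt n × Pt n → ℂ :=
  fun ((x, y, r), (x', y', r')) =>
    (Real.exp (-lam * r') : ℂ) ^ n *
    conj (e (eta lam r' * beta (Real.exp (-lam * r') • x) (y' - Real.exp (-lam * r') • y))) *
    ξ ((Real.exp (-lam * r') • x, Real.exp (-lam * r') • y, r + r'),
      (x' - Real.exp (-lam * r') • x, y' - Real.exp (-lam * r') • y, r'))

/-- The multiplicative unitary `U_A`. -/
noncomputable def U (n : ℕ) (lam : ℝ) : BHH n := opGivenBy (UFormula lam)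

/-! ### Tensor products -/

theorem memLp_tensor {n : ℕ} (ξ η : Hilb n) :
    MemLp (fun p : Pt n × Pt n => ξ p.1 * η p.2) 2 volume := by
  have h1 := Lp.memLp ξ
  have h2 := Lp.memLp η
  have m : AEStronglyMeasurable (fun p : Pt n × Pt n => ξ p.1 * η p.2) volume :=
    (h1.1.comp_quasiMeasurePreserving Measure.quasiMeasurePreserving_fst).mul
      (h2.1.comp_quasiMeasurePreserving Measure.quasiMeasurePreserving_snd)
  rw [memLp_two_iff_integrable_sq_norm m]
  have h := ((memLp_two_iff_integrable_sq_norm h1.1).1 h1).mul_prod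
    ((memLp_two_iff_integrable_sq_norm h2.1).1 h2)
  refine h.congr (Filter.Eventually.of_forall fun p => ?_)
  simp [mul_pow]

/-- The vector `ξ ⊗ η`, that is, the function `(p, p') ↦ ξ(p) η(p')`. -/
noncomputable def tvec {n : ℕ} (ξ η : Hilb n) : Hilb2 n := (memLp_tensor ξ η).toLp _

/-- `T` is the operator `a ⊗ b`. -/
def IsOpTensor {n : ℕ} (a b : BH n) (T : BHH n) : Prop :=
  ∀ ξ η : Hilb n, T (tvec ξ η) = tvec (a ξ) (b η)

open Classical in
/-- The operator `a ⊗ b` on `H ⊗ H`: the unique bounded operator with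
`(a ⊗ b)(ξ ⊗ η) = aξ ⊗ bη`. -/
noncomputable def opTensor {n : ℕ} (a b : BH n) : BHH n :=
  if h : ∃ T, IsOpTensor a b T then h.choose else 0

/-! ### The C*-algebras -/

/-- The right slices `(id ⊗ ω)(T)`, with `ω` in the predual of `B(H)`. The elements of the predual
are the `ω = ∑ₖ ⟨ · ξₖ, ηₖ⟩` with `∑ₖ ‖ξₖ‖² < ∞` and `∑ₖ ‖ηₖ‖² < ∞`. -/
def rightSlices {n : ℕ} (T : BHH n) : Set (BH n) :=
  {S | ∃ ξ η : ℕ → Hilb n, (Summable fun k => ‖ξ k‖ ^ 2) ∧ (Summable fun k => ‖η k‖ ^ 2) ∧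
    ∀ ζ ζ' : Hilb n,
      HasSum (fun k => inner ℂ (tvec ζ' (η k)) (T (tvec ζ (ξ k)))) (inner ℂ ζ' (S ζ))}

/-- The C*-algebra generated by the right slices of `U_A`. -/
noncomputable def Ahat (n : ℕ) (lam : ℝ) : NonUnitalStarSubalgebra ℂ (BH n) :=
  (NonUnitalStarAlgebra.adjoin ℂ (rightSlices (U n lam))).topologicalClosure

/-- The (minimal) tensor product of a C*-algebra of operators on `H` with itself: the C*-algebra
on `H ⊗ H` generated by the `a ⊗ b`. -/
noncomputable def tensorSq {n : ℕ} (B : NonUnitalStarSubalgebra ℂ (BH n)) :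
    NonUnitalStarSubalgebra ℂ (BHH n) :=
  (NonUnitalStarAlgebra.adjoin ℂ {T | ∃ a ∈ B, ∃ b ∈ B, T = opTensor a b}).topologicalClosure

/-- The multiplier algebra of a nondegenerate C*-algebra `B` of operators on `H ⊗ H`, in its
standard realization as `{T : T B ⊆ B and B T ⊆ B}`. -/
noncomputable def multiplierAlg {n : ℕ} (B : NonUnitalStarSubalgebra ℂ (BHH n)) :
    StarSubalgebra ℂ (BHH n) where
  carrier := {T | ∀ c ∈ B, T * c ∈ B ∧ c * T ∈ B}
  mul_mem' {S T} hS hT c hc := by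
    refine ⟨?_, ?_⟩
    · rw [mul_assoc]; exact (hS _ (hT c hc).1).1
    · rw [← mul_assoc]; exact (hT _ (hS c hc).2).2
  add_mem' {S T} hS hT c hc := by
    rw [add_mul, mul_add]
    exact ⟨add_mem (hS c hc).1 (hT c hc).1, add_mem (hS c hc).2 (hT c hc).2⟩
  algebraMap_mem' z c hc := by
    rw [Algebra.algebraMap_eq_smul_one, smul_mul_assoc, mul_smul_comm, one_mul, mul_one]
    exact ⟨SMulMemClass.smul_mem z hc, SMulMemClass.smul_mem z hc⟩
  star_mem' {T} hT c hc := by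
    have h := hT (star c) (star_mem hc)
    refine ⟨?_, ?_⟩
    · simpa using star_mem h.2
    · simpa using star_mem h.1

/-! ### The comultiplication at the level of functions -/

/-- A kernel `F(x, y, r; x', y', r')` which is a function of `(x, y, x', y')` and a generalized
function of `(r, r')`. `F x y x' y' Φ` is its pairing `∬ F(x, y, r; x', y', r') Φ(r, r') dr dr'`
with a test function `Φ` (smooth, of compact support). -/
abbrev Kernel (n : ℕ) : Type :=
  EuclideanSpace ℝ (Fin n) → EuclideanSpace ℝ (Fin n) →
    EuclideanSpace ℝ (Fin n) → EuclideanSpace ℝ (Fin n) → (ℝ × ℝ → ℂ) → ℂ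

/-- The formula for `(ρ ⊗ ρ)_F`, that is,
`∬ (e^{λ s})ⁿ (e^{λ s'})ⁿ F(x, y, s; x', y', s')
  ξ(e^{λ s} x, e^{λ s} y, r - s; e^{λ s'} x', e^{λ s'} y', r' - s') ds ds'`. -/
noncomputable def rhoRhoFormula {n : ℕ} (lam : ℝ) (F : Kernel n) (ξ : Pt n × Pt n → ℂ) :
    Pt n × Pt n → ℂ :=
  fun ((x, y, r), (x', y', r')) => F x y x' y' fun (s, s') =>
    (Real.exp (lam * s) : ℂ) ^ n * (Real.exp (lam * s') : ℂ) ^ n *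
      ξ ((Real.exp (lam * s) • x, Real.exp (lam * s) • y, r - s),
        (Real.exp (lam * s') • x', Real.exp (lam * s') • y', r' - s'))

theorem isAddHaar_volume_prod (E F : Type*)
    [NormedAddCommGroup E] [MeasureSpace E] [BorelSpace E] [SecondCountableTopology E]
    [SFinite (volume : Measure E)] [(volume : Measure E).IsAddHaarMeasure]
    [NormedAddCommGroup F] [MeasureSpace F] [BorelSpace F]
    [SFinite (volume : Measure F)] [(volume : Measure F).IsAddHaarMeasure] :
    (volume : Measure (E × F)).IsAddHaarMeasure := by
  rw [Measure.volume_eq_prod]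
  infer_instance

instance instIsAddHaarPt (n : ℕ) : (volume : Measure (Pt n)).IsAddHaarMeasure := by
  have := isAddHaar_volume_prod (EuclideanSpace ℝ (Fin n)) ℝ
  exact isAddHaar_volume_prod _ _

instance instIsAddHaarPt2 (n : ℕ) : (volume : Measure (Pt n × Pt n)).IsAddHaarMeasure :=
  isAddHaar_volume_prod _ _

/-- `T` is the operator `(ρ ⊗ ρ)_F`: a bounded operator given by the formula on the dense
subspace of the Schwartz functions with compact support in `r` and `r'`. -/
def IsRhoRho {n : ℕ} (lam : ℝ) (F : Kernel n) (T : BHH n) : Prop :=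
  ∀ ξ ∈ Core2 n, T (ξ.toLp 2 volume) =ᵐ[volume] rhoRhoFormula lam F ξ

/-- The inner integrand, over `(r, r')`, in the pairing of `Δ̂f` with `Φ`. -/
noncomputable def innerIntegrand (Φ : ℝ × ℝ → ℂ) (z z' : ℝ) : ℝ × ℝ → ℂ :=
  fun (r, r') => conj (e (z * r + z' * r')) * Φ (r, r')

/-- The outer integrand, over `(s, z, z')`, in the pairing of `Δ̂f` with `Φ`. -/
noncomputable def outerIntegrand {n : ℕ} (lam : ℝ) (f : Pt n → ℂ)
    (x y x' y' : EuclideanSpace ℝ (Fin n)) (Φ : ℝ × ℝ → ℂ) : ℝ × ℝ × ℝ → ℂ :=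
  fun (s, z, z') => f (x + x', y + y', s) * e (eta lam s * beta x y') * e (s * (z + z')) *
    ∫ q : ℝ × ℝ, innerIntegrand Φ z z' q

/-- The kernel
`Δ̂f(x, y, r; x', y', r') = ∫ f(x + x', y + y', s) e[η_λ(s) β(x, y')] e[s (z + z')]
  e[-(z r + z' r')] ds dz dz'`.
This integral does not converge absolutely; as usual it is an oscillatory integral, so that in the
pairing with a test function `Φ(r, r')` the integration over `(r, r')` is carried out first. -/
noncomputable def DeltaHat {n : ℕ} (lam : ℝ) (f : Pt n → ℂ) : Kernel n :=
  fun x y x' y' Φ => ∫ w : ℝ × ℝ × ℝ, outerIntegrand lam f x y x' y' Φ w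

end QHeis

open QHeis

set_option linter.unusedSectionVars false

namespace QHeis

open Filter
open scoped ENNReal

/-! ### Operators given by formulas -/

section IsGivenBy

variable {Y : Type*} [MeasureSpace Y]

/-! Every operator except `U_A` and the bare tensors is an integral along a flow. The maps `α_s(x,
y, r) = (e^{λs}x, e^{λs}y, r - s)` with the weight `w(s) = (e^{λs})ⁿ` act unitarily on `L²`, and
`ρ_f` integrates `w(s) ζ ∘ α_s` against a kernel that sees a point only through `z = (x, y)`. So `Â`
is in effect a concrete crossed product by the dilation action of `ℝ` on the plane of the `z`. A
kernel bounded by `C` and living over a set `K` of parameters `s` gives norm at most `C |K|`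
(`IsFlow.exists_op`). Hence uniform approximation of kernels over a common compact set of `s` is
norm approximation of operators (`System.op_mem_closure`), and the statements on generation and
non-degeneracy reduce to it. The kernels in `C_c` give a star algebra under twisted convolution
(`System.core`).

Identification of `Â`: after the substitution `r' = -s`, a matrix coefficient of `U_A` in the second
variable is a kernel operator (`slice_U`). Conversely, letting one of the two vectors concentrate at
`z' = 0` recovers an arbitrary `C_c` kernel (`op_mem_closure_rightSlices`). So `Â` is the closure of
the core. For the product flow of `ℝ × ℝ`, sums of products of functions are uniformly dense, so `Â
⊗ Â` is the closure of the core there (`tensorSq_eq_closure_core`).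

Comultiplication: the point transformation of `U_A` carries the flow in the second variable to the
diagonal flow (`diag_Umap`), and the cocycle identity `eta_sub` matches the phases. Thus `U_A* (1 ⊗
ρ_f) U_A` is the kernel operator of the diagonal flow with kernel `f(z + z', s) e[η(s) β(x, y')]`
(`conj_op`). By Fourier inversion `Δ̂f` is this kernel times a delta function on the diagonal
(`DeltaHat_eq`), which identifies `(ρ ⊗ ρ)_{Δ̂f}`. Convolving the diagonal kernel with a `C_c`
kernel gives a `C_c` kernel, so the values are multipliers. Letting `f` concentrate at `s = 0` gives
non-degeneracy (`op_mem_closure_comul`). Uniqueness is density of the `ρ_f`. -/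

theorem IsGivenBy.unique {F : (Y → ℂ) → (Y → ℂ)}
    {S T : Lp ℂ 2 (volume : Measure Y) →L[ℂ] Lp ℂ 2 (volume : Measure Y)}
    (hS : IsGivenBy F S) (hT : IsGivenBy F T) : S = T := by
  ext1 ζ
  exact Lp.ext ((hS ζ).trans (hT ζ).symm)

theorem isGivenBy_opGivenBy {F : (Y → ℂ) → (Y → ℂ)} (h : ∃ T, IsGivenBy F T) :
    IsGivenBy F (opGivenBy F) := by
  unfold opGivenBy
  rw [dif_pos h]
  exact h.choose_spec

theorem IsGivenBy.opGivenBy_eq {F : (Y → ℂ) → (Y → ℂ)}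
    {T : Lp ℂ 2 (volume : Measure Y) →L[ℂ] Lp ℂ 2 (volume : Measure Y)}
    (hT : IsGivenBy F T) : opGivenBy F = T :=
  (isGivenBy_opGivenBy ⟨T, hT⟩).unique hT

theorem IsGivenBy.congr {F G : (Y → ℂ) → (Y → ℂ)}
    {T : Lp ℂ 2 (volume : Measure Y) →L[ℂ] Lp ℂ 2 (volume : Measure Y)}
    (hT : IsGivenBy F T) (h : ∀ ζ p, F ζ p = G ζ p) : IsGivenBy G T := by
  have : F = G := funext fun ζ => funext fun p => h ζ p
  rwa [← this]

theorem exists_isGivenBy (F : (Y → ℂ) → (Y → ℂ)) (C : ℝ) (hC : 0 ≤ C)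
    (hmem : ∀ ζ : Lp ℂ 2 (volume : Measure Y), AEStronglyMeasurable (F ζ) volume ∧
      eLpNorm (F ζ) 2 volume ≤ ENNReal.ofReal C * eLpNorm ζ 2 volume)
    (hadd : ∀ ζ ζ' : Lp ℂ 2 (volume : Measure Y), F ⇑(ζ + ζ') =ᵐ[volume] F ζ + F ζ')
    (hsmul : ∀ (c : ℂ) (ζ : Lp ℂ 2 (volume : Measure Y)), F ⇑(c • ζ) =ᵐ[volume] c • F ζ) :
    ∃ T, IsGivenBy F T ∧ ‖T‖ ≤ C := by
  have hm : ∀ ζ : Lp ℂ 2 (volume : Measure Y), MemLp (F ζ) 2 volume := fun ζ =>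
    ⟨(hmem ζ).1, (hmem ζ).2.trans_lt
      (ENNReal.mul_lt_top ENNReal.ofReal_lt_top (Lp.eLpNorm_lt_top ζ))⟩
  let T₀ : Lp ℂ 2 (volume : Measure Y) →ₗ[ℂ] Lp ℂ 2 (volume : Measure Y) :=
    { toFun := fun ζ => (hm ζ).toLp _
      map_add' := fun ζ ζ' => by
        refine Lp.ext ?_
        filter_upwards [(hm (ζ + ζ')).coeFn_toLp, (hm ζ).coeFn_toLp, (hm ζ').coeFn_toLp,
          hadd ζ ζ', Lp.coeFn_add ((hm ζ).toLp _) ((hm ζ').toLp _)] with p h1 h2 h3 h4 h5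
        rw [h1, h4, h5, Pi.add_apply, Pi.add_apply, h2, h3]
      map_smul' := fun c ζ => by
        refine Lp.ext ?_
        filter_upwards [(hm (c • ζ)).coeFn_toLp, (hm ζ).coeFn_toLp,
          hsmul c ζ, Lp.coeFn_smul c ((hm ζ).toLp _)] with p h1 h2 h4 h5
        rw [h1, h4, RingHom.id_apply, h5, Pi.smul_apply, Pi.smul_apply, h2] }
  have hb : ∀ ζ, ‖T₀ ζ‖ ≤ C * ‖ζ‖ := fun ζ => by
    change ‖(hm ζ).toLp _‖ ≤ _
    rw [Lp.norm_toLp, Lp.norm_def]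
    have := ENNReal.toReal_mono
      (ENNReal.mul_ne_top ENNReal.ofReal_ne_top (Lp.eLpNorm_ne_top ζ)) (hmem ζ).2
    rwa [ENNReal.toReal_mul, ENNReal.toReal_ofReal hC] at this
  exact ⟨T₀.mkContinuous C hb, fun ζ => (hm ζ).coeFn_toLp, T₀.mkContinuous_norm_le hC hb⟩

theorem eLpNorm_two_sq {E : Type*} [NormedAddCommGroup E] (f : Y → E) :
    eLpNorm f 2 volume ^ 2 = ∫⁻ p, ‖f p‖ₑ ^ 2 := by
  have := eLpNorm_nnreal_pow_eq_lintegral (μ := (volume : Measure Y)) (f := f)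
    (p := 2) two_ne_zero
  simpa using this

/-- Weighted composition operators that preserve the `L²` norm. -/
theorem exists_weightedComp (u : Y → ℂ) (τ : Y → Y) (hu : Measurable u) (hτ : Measurable τ)
    (hu0 : ∀ p, u p ≠ 0)
    (h : ∀ g : Y → ℝ≥0∞, Measurable g → ∫⁻ p, ‖u p‖ₑ ^ 2 * g (τ p) = ∫⁻ p, g p) :
    Measure.QuasiMeasurePreserving τ ∧
    ∃ T : Lp ℂ 2 (volume : Measure Y) →L[ℂ] Lp ℂ 2 (volume : Measure Y),
      IsGivenBy (fun ζ p => u p * ζ (τ p)) T ∧ ∀ ζ, ‖T ζ‖ = ‖ζ‖ := by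
  have hq : Measure.QuasiMeasurePreserving τ := by
    refine ⟨hτ, Measure.AbsolutelyContinuous.mk fun N hN h0 => ?_⟩
    rw [Measure.map_apply hτ hN]
    -- Tested on a null set `N`, the scaling identity says that `‖u‖²` integrates to zero over the
    -- preimage of `N`; since `u` has no zeros, that preimage is null.
    have h1 := h (N.indicator 1) (measurable_one.indicator hN)
    have hm : Measurable fun p => ‖u p‖ₑ ^ 2 * N.indicator 1 (τ p) :=
      (hu.enorm.pow_const 2).mul ((measurable_one.indicator hN).comp hτ)
    rw [lintegral_indicator_one hN, h0, lintegral_eq_zero_iff hm] at h1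
    refine measure_mono_null (fun p hp => ?_) h1
    simp only [Set.mem_preimage] at hp
    simp [hp, hu0]
  refine ⟨hq, ?_⟩
  have hn : ∀ ζ : Lp ℂ 2 (volume : Measure Y),
      eLpNorm (fun p => u p * ζ (τ p)) 2 volume = eLpNorm ζ 2 volume := fun ζ => by
    rw [← (ENNReal.pow_right_strictMono two_ne_zero).injective.eq_iff, eLpNorm_two_sq, eLpNorm_two_sq,
      ← h _ ((Lp.stronglyMeasurable ζ).measurable.enorm.pow_const 2)]
    simp_rw [enorm_mul, mul_pow]
  obtain ⟨T, hT, -⟩ := exists_isGivenBy (fun ζ p => u p * ζ (τ p)) 1 zero_le_one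
    (fun ζ => ⟨(hu.mul ((Lp.stronglyMeasurable ζ).measurable.comp hτ)).aestronglyMeasurable,
      by rw [hn, ENNReal.ofReal_one, one_mul]⟩)
    (fun ζ ζ' => by
      filter_upwards [hq.ae (Lp.coeFn_add ζ ζ')] with p hp
      rw [hp, Pi.add_apply, Pi.add_apply, mul_add])
    (fun c ζ => by
      filter_upwards [hq.ae (Lp.coeFn_smul c ζ)] with p hp
      rw [hp, Pi.smul_apply, Pi.smul_apply, smul_eq_mul, smul_eq_mul, mul_left_comm])
  refine ⟨T, hT, fun ζ => ?_⟩
  rw [Lp.norm_def, Lp.norm_def, eLpNorm_congr_ae (hT ζ), hn]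

end IsGivenBy

/-! ### Kernel operators over a flow -/

/-- The formula `ζ ↦ ∫ w(s) k(p, s) ζ(α_s p) ds`. -/
noncomputable def kerFormula {X S : Type*} [MeasureSpace S] (w : S → ℂ) (α : S → X → X)
    (k : X → S → ℂ) (ζ : X → ℂ) : X → ℂ :=
  fun p => ∫ s, w s * k p s * ζ (α s p)

/-- `ζ ↦ w(s) ζ(α_s ·)` is isometric on `L²` for every `s`. -/
structure IsFlow {X S : Type*} [MeasureSpace X] [MeasureSpace S] (w : S → ℂ) (α : S → X → X) :
    Prop where
  meas_w : Measurable w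
  meas_α : Measurable fun q : X × S => α q.2 q.1
  ne_zero : ∀ s, w s ≠ 0
  scale : ∀ s, ∀ g : X → ℝ≥0∞, Measurable g → ∫⁻ p, ‖w s‖ₑ ^ 2 * g (α s p) = ∫⁻ p, g p

/-- A measurable kernel, bounded by `C` and supported in `X × K`. -/
structure KerBound {X S : Type*} [MeasurableSpace X] [MeasurableSpace S] (k : X → S → ℂ)
    (K : Set S) (C : ℝ) : Prop where
  meas : Measurable fun q : X × S => k q.1 q.2
  bound : ∀ p s, ‖k p s‖ ≤ K.indicator (fun _ => C) s

section Flow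

variable {X S : Type*} [MeasureSpace X] [MeasureSpace S]
  [SFinite (volume : Measure X)] [SFinite (volume : Measure S)]
  {w : S → ℂ} {α : S → X → X} {k : X → S → ℂ} {K : Set S} {C : ℝ}

theorem IsFlow.comp {S' : Type*} [MeasureSpace S'] (h : IsFlow w α) {j : S' → S}
    (hj : Measurable j) : IsFlow (fun s => w (j s)) (fun s => α (j s)) where
  meas_w := h.meas_w.comp hj
  meas_α := h.meas_α.comp (measurable_fst.prodMk (hj.comp measurable_snd))
  ne_zero _ := h.ne_zero _
  scale _ := h.scale _

theorem IsFlow.measurable_apply (h : IsFlow w α) (s : S) : Measurable (α s) :=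
  h.meas_α.comp (measurable_id.prodMk measurable_const)

theorem IsFlow.quasi (h : IsFlow w α) (s : S) : Measure.QuasiMeasurePreserving (α s) :=
  (exists_weightedComp (fun _ => w s) (α s) measurable_const (h.measurable_apply s)
    (fun _ => h.ne_zero s) (h.scale s)).1

/-- Each `α s` pulls null sets back to null sets, and Tonelli exchanges the two quantifiers once the
exceptional set is enlarged to a measurable one. This is what makes `kerFormula` insensitive to the
choice of representative of `ζ`. -/
theorem IsFlow.ae_ae (h : IsFlow w α) {P : X → Prop} (hP : ∀ᵐ p, P p) :
    ∀ᵐ p : X, ∀ᵐ s : S, P (α s p) := by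
  obtain ⟨N, hsub, hN, h0⟩ := exists_measurable_superset_of_null hP
  have hm : MeasurableSet {q : X × S | α q.2 q.1 ∉ N} := (h.meas_α hN).compl
  have h1 : ∀ᵐ p : X, ∀ᵐ s : S, α s p ∉ N := by
    rw [Measure.ae_ae_comm (p := fun (p : X) (s : S) => α s p ∉ N) hm]
    refine Eventually.of_forall fun s => (h.quasi s).ae (p := fun p => p ∉ N) ?_
    exact measure_eq_zero_iff_ae_notMem.1 h0
  filter_upwards [h1] with p hp
  filter_upwards [hp] with s hs
  by_contra hc
  exact hs (hsub hc)

/-- Tonelli and the scaling identity; the `L²` estimates for kernel operators all come from here. -/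
theorem IsFlow.lintegral_lintegral (h : IsFlow w α) {g : X → ℝ≥0∞}
    (hg : Measurable g) :
    ∫⁻ p, ∫⁻ s in K, ‖w s‖ₑ ^ 2 * g (α s p) = volume K * ∫⁻ p, g p := by
  rw [lintegral_lintegral_swap]
  · simp_rw [h.scale _ g hg]
    rw [setLIntegral_const, mul_comm]
  · exact ((((h.meas_w.comp measurable_snd).enorm.pow_const 2)).mul
      (hg.comp h.meas_α)).aemeasurable

theorem IsFlow.ae_memLp (h : IsFlow w α) (hK : MeasurableSet K) (hK' : volume K ≠ ⊤)
    {ζ : X → ℂ} (hζm : Measurable ζ) (hζ : MemLp ζ 2 volume) :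
    ∀ᵐ p : X, MemLp (fun s => w s * ζ (α s p)) 2 (volume.restrict K) := by
  have h1 := h.lintegral_lintegral (K := K) (hζm.enorm.pow_const 2)
  rw [← eLpNorm_two_sq] at h1
  have h2 : volume K * eLpNorm ζ 2 volume ^ 2 ≠ ⊤ :=
    ENNReal.mul_ne_top hK' (ENNReal.pow_ne_top hζ.2.ne)
  rw [← h1] at h2
  have hmeas : Measurable fun q : X × S => ‖w q.2‖ₑ ^ 2 * ‖ζ (α q.2 q.1)‖ₑ ^ 2 :=
    (((h.meas_w.comp measurable_snd).enorm.pow_const 2)).mul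
      ((hζm.comp h.meas_α).enorm.pow_const 2)
  filter_upwards [ae_lt_top hmeas.lintegral_prod_right' h2] with p hp
  refine ⟨(h.meas_w.mul (hζm.comp (h.meas_α.comp
    measurable_prodMk_left))).aestronglyMeasurable, ?_⟩
  have := eLpNorm_nnreal_pow_eq_lintegral (μ := (volume.restrict K : Measure S))
    (f := fun s => w s * ζ (α s p)) (p := 2) two_ne_zero
  simp only [enorm_mul, NNReal.coe_ofNat, ENNReal.rpow_ofNat, ENNReal.coe_ofNat, mul_pow] at this
  rw [← this] at hp
  by_contra hc
  rw [not_lt, top_le_iff] at hc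
  rw [hc] at hp
  simp at hp

theorem IsFlow.ae_integrableOn (h : IsFlow w α) (hK : MeasurableSet K) (hK' : volume K ≠ ⊤)
    {ζ : X → ℂ} (hζm : Measurable ζ) (hζ : MemLp ζ 2 volume) :
    ∀ᵐ p : X, IntegrableOn (fun s => w s * ζ (α s p)) K := by
  have : IsFiniteMeasure (volume.restrict K : Measure S) := ⟨by simpa using hK'.lt_top⟩
  filter_upwards [h.ae_memLp hK hK' hζm hζ] with p hp
  exact hp.integrable (by norm_num)

theorem KerBound.enorm_le (hk : KerBound k K C) (p : X) (s : S) :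
    ‖k p s‖ₑ ≤ K.indicator (fun _ => ENNReal.ofReal C) s := by
  rw [← ofReal_norm]
  refine (ENNReal.ofReal_le_ofReal (hk.bound p s)).trans (le_of_eq ?_)
  by_cases hs : s ∈ K <;> simp [hs]

theorem KerBound.eq_zero (hk : KerBound k K C) (p : X) {s : S} (hs : s ∉ K) : k p s = 0 := by
  simpa [hs] using hk.bound p s

theorem IsFlow.ae_integrable (h : IsFlow w α) (hK : MeasurableSet K) (hK' : volume K ≠ ⊤)
    (hk : KerBound k K C) {ζ : X → ℂ} (hζm : Measurable ζ) (hζ : MemLp ζ 2 volume) :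
    ∀ᵐ p : X, Integrable (fun s => w s * k p s * ζ (α s p)) := by
  filter_upwards [h.ae_integrableOn hK hK' hζm hζ] with p hp
  have h1 : IntegrableOn (fun s => w s * k p s * ζ (α s p)) K := by
    have := (hp.norm.const_mul C)
    refine this.mono' (((h.meas_w.mul (hk.meas.comp measurable_prodMk_left)).mul
      (hζm.comp (h.meas_α.comp measurable_prodMk_left))).aestronglyMeasurable) ?_
    refine (ae_restrict_mem hK).mono fun s hs => ?_
    have hb := hk.bound p s
    rw [Set.indicator_of_mem hs] at hb
    calc ‖w s * k p s * ζ (α s p)‖ = ‖k p s‖ * ‖w s * ζ (α s p)‖ := by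
          simp only [norm_mul]; ring
      _ ≤ _ := by gcongr
  exact h1.integrable_of_forall_notMem_eq_zero fun s hs => by rw [hk.eq_zero p hs]; ring

/-- Cauchy–Schwarz over `K` bounds the square of the value at `p` by `C² |K| ∫_K ‖w(s) ζ(α_s p)‖²
ds`. Integration over `p` contributes a second factor `|K|`. -/
theorem IsFlow.exists_op (h : IsFlow w α) (hK : MeasurableSet K) (hK' : volume K ≠ ⊤)
    (hC : 0 ≤ C) (hk : KerBound k K C) :
    ∃ T, IsGivenBy (kerFormula w α k) T ∧ ‖T‖ ≤ C * (volume K).toReal := by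
  have hz : ∀ ζ : Lp ℂ 2 (volume : Measure X), Measurable (ζ : X → ℂ) := fun ζ =>
    (Lp.stronglyMeasurable ζ).measurable
  refine exists_isGivenBy _ _ (by positivity) (fun ζ => ⟨?_, ?_⟩) (fun ζ ζ' => ?_) fun c ζ => ?_
  · have hm : Measurable fun q : X × S => w q.2 * k q.1 q.2 * ζ (α q.2 q.1) :=
      ((h.meas_w.comp measurable_snd).mul hk.meas).mul ((hz ζ).comp h.meas_α)
    exact hm.stronglyMeasurable.integral_prod_right'.aestronglyMeasurable
  · rw [← ENNReal.pow_le_pow_left_iff two_ne_zero, eLpNorm_two_sq, mul_pow, eLpNorm_two_sq]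
    have hpt : ∀ᵐ p : X, ‖kerFormula w α k ζ p‖ₑ ^ 2 ≤
        ENNReal.ofReal C ^ 2 * volume K * ∫⁻ s in K, ‖w s‖ₑ ^ 2 * ‖ζ (α s p)‖ₑ ^ 2 := by
      refine Eventually.of_forall fun p => ?_
      have hmζ : Measurable fun s : S => ‖w s‖ₑ * ‖ζ (α s p)‖ₑ :=
        h.meas_w.enorm.mul ((hz ζ).comp (h.meas_α.comp measurable_prodMk_left)).enorm
      have h1 : ‖kerFormula w α k ζ p‖ₑ ≤
          ENNReal.ofReal C * ∫⁻ s in K, ‖w s‖ₑ * ‖ζ (α s p)‖ₑ := by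
        refine (enorm_integral_le_lintegral_enorm _).trans ?_
        rw [← lintegral_const_mul _ hmζ, ← lintegral_indicator hK]
        refine lintegral_mono fun s => ?_
        have hb := hk.enorm_le p s
        by_cases hs : s ∈ K
        · rw [Set.indicator_of_mem hs] at hb ⊢
          rw [enorm_mul, enorm_mul, mul_comm ‖w s‖ₑ, mul_assoc]
          gcongr
        · rw [hk.eq_zero p hs]; simp
      have h2 : (∫⁻ s in K, ‖w s‖ₑ * ‖ζ (α s p)‖ₑ) ^ 2 ≤
          volume K * ∫⁻ s in K, ‖w s‖ₑ ^ 2 * ‖ζ (α s p)‖ₑ ^ 2 := by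
        have hH := ENNReal.lintegral_mul_le_Lp_mul_Lq (volume.restrict K)
          (Real.HolderConjugate.two_two) (f := fun _ => 1) (g := fun s => ‖w s‖ₑ * ‖ζ (α s p)‖ₑ)
          aemeasurable_const hmζ.aemeasurable
        simp only [Pi.mul_apply, one_mul, ENNReal.one_rpow, lintegral_const,
          Measure.restrict_apply, MeasurableSet.univ, Set.univ_inter, one_mul] at hH
        refine (pow_le_pow_left' hH 2).trans (le_of_eq ?_)
        rw [mul_pow, ← ENNReal.rpow_natCast, ← ENNReal.rpow_natCast, ← ENNReal.rpow_mul,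
          ← ENNReal.rpow_mul]
        norm_num [mul_pow]
      calc _ ≤ (ENNReal.ofReal C * ∫⁻ s in K, ‖w s‖ₑ * ‖ζ (α s p)‖ₑ) ^ 2 := by gcongr
        _ ≤ _ := by rw [mul_pow, mul_assoc]; gcongr
    refine (lintegral_mono_ae hpt).trans ?_
    have hmm : Measurable fun q : X × S => ‖w q.2‖ₑ ^ 2 * ‖ζ (α q.2 q.1)‖ₑ ^ 2 :=
      (((h.meas_w.comp measurable_snd).enorm.pow_const 2)).mul
        (((hz ζ).comp h.meas_α).enorm.pow_const 2)
    rw [lintegral_const_mul _ hmm.lintegral_prod_right',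
      h.lintegral_lintegral ((hz ζ).enorm.pow_const 2), ← mul_assoc,
      ENNReal.ofReal_mul hC, ENNReal.ofReal_toReal hK', mul_pow, sq (volume K)]
    exact le_of_eq (by ring)
  · filter_upwards [h.ae_ae (Lp.coeFn_add ζ ζ'), h.ae_integrable hK hK' hk (hz ζ) (Lp.memLp ζ),
      h.ae_integrable hK hK' hk (hz ζ') (Lp.memLp ζ')] with p hp h1 h2
    rw [Pi.add_apply]
    unfold kerFormula
    rw [← integral_add h1 h2]
    refine integral_congr_ae ?_
    filter_upwards [hp] with s hs
    rw [hs, Pi.add_apply, mul_add]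
  · filter_upwards [h.ae_ae (Lp.coeFn_smul c ζ)] with p hp
    rw [Pi.smul_apply]
    unfold kerFormula
    rw [smul_eq_mul, ← integral_const_mul]
    refine integral_congr_ae ?_
    filter_upwards [hp] with s hs
    rw [hs, Pi.smul_apply, smul_eq_mul]; ring

/-- The kernel operator with kernel `k`. -/
noncomputable def kerOp (w : S → ℂ) (α : S → X → X) (k : X → S → ℂ) :
    Lp ℂ 2 (volume : Measure X) →L[ℂ] Lp ℂ 2 (volume : Measure X) :=
  opGivenBy (kerFormula w α k)

theorem IsFlow.isGivenBy (h : IsFlow w α) (hK : MeasurableSet K) (hK' : volume K ≠ ⊤)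
    (hk : KerBound k K C) : IsGivenBy (kerFormula w α k) (kerOp w α k) := by
  have hk' : KerBound k K |C| := ⟨hk.meas, fun p s => (hk.bound p s).trans
    (Set.indicator_le_indicator (le_abs_self C))⟩
  obtain ⟨T, hT, -⟩ := h.exists_op hK hK' (abs_nonneg C) hk'
  exact isGivenBy_opGivenBy ⟨T, hT⟩

theorem IsFlow.norm_kerOp_le (h : IsFlow w α) (hK : MeasurableSet K) (hK' : volume K ≠ ⊤)
    (hC : 0 ≤ C) (hk : KerBound k K C) : ‖kerOp w α k‖ ≤ C * (volume K).toReal := by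
  obtain ⟨T, hT, hn⟩ := h.exists_op hK hK' hC hk
  rwa [kerOp, hT.opGivenBy_eq]

theorem IsFlow.kerOp_add (h : IsFlow w α) (hK : MeasurableSet K) (hK' : volume K ≠ ⊤)
    {k' : X → S → ℂ} {C' : ℝ} (hk : KerBound k K C) (hk' : KerBound k' K C') :
    kerOp w α (fun p s => k p s + k' p s) = kerOp w α k + kerOp w α k' := by
  refine IsGivenBy.opGivenBy_eq fun ζ => ?_
  have hz := (Lp.stronglyMeasurable ζ).measurable
  filter_upwards [h.isGivenBy hK hK' hk ζ, h.isGivenBy hK hK' hk' ζ,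
    Lp.coeFn_add (kerOp w α k ζ) (kerOp w α k' ζ), h.ae_integrable hK hK' hk hz (Lp.memLp ζ),
    h.ae_integrable hK hK' hk' hz (Lp.memLp ζ)] with p h1 h2 h3 h4 h5
  rw [add_apply, h3, Pi.add_apply, h1, h2]
  unfold kerFormula
  rw [← integral_add h4 h5]
  congr 1
  ext s
  ring

theorem IsFlow.kerOp_smul (h : IsFlow w α) (hK : MeasurableSet K) (hK' : volume K ≠ ⊤)
    (hk : KerBound k K C) (c : ℂ) :
    kerOp w α (fun p s => c * k p s) = c • kerOp w α k := by
  refine IsGivenBy.opGivenBy_eq fun ζ => ?_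
  filter_upwards [h.isGivenBy hK hK' hk ζ, Lp.coeFn_smul c (kerOp w α k ζ)] with p h1 h3
  rw [smul_apply, h3, Pi.smul_apply, h1]
  unfold kerFormula
  rw [smul_eq_mul, ← integral_const_mul]
  congr 1
  ext s
  ring

/-- The separate bounds `C` and `C'` do not enter the estimate, so uniform closeness of kernels over
a common `K` already gives closeness in norm. -/
theorem IsFlow.norm_kerOp_sub_le (h : IsFlow w α) (hK : MeasurableSet K) (hK' : volume K ≠ ⊤)
    {k' : X → S → ℂ} {C' D : ℝ} (hk : KerBound k K C) (hk' : KerBound k' K C') (hD : 0 ≤ D)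
    (hd : ∀ p, ∀ s ∈ K, ‖k p s - k' p s‖ ≤ D) :
    ‖kerOp w α k - kerOp w α k'‖ ≤ D * (volume K).toReal := by
  have hkd : KerBound (fun p s => k p s - k' p s) K D := by
    refine ⟨hk.meas.sub hk'.meas, fun p s => ?_⟩
    by_cases hs : s ∈ K
    · simpa [hs] using hd p s hs
    · simp [hk.eq_zero p hs, hk'.eq_zero p hs, hs]
  have := h.kerOp_add hK hK' hkd hk'
  simp only [sub_add_cancel] at this
  rw [this, add_sub_cancel_right]
  exact h.norm_kerOp_le hK hK' hD hkd

/-- Intertwining of kernel operators by a weighted composition operator. -/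
theorem IsFlow.isGivenBy_conj {w' : S → ℂ} {α' : S → X → X} {k' : X → S → ℂ} {C' : ℝ}
    (h : IsFlow w α) (hK : MeasurableSet K) (hK' : volume K ≠ ⊤) (hk : KerBound k K C)
    (h' : IsFlow w' α') (hk' : KerBound k' K C')
    {u : X → ℂ} {τ : X → X} (hτ : Measure.QuasiMeasurePreserving τ)
    {V : Lp ℂ 2 (volume : Measure X) →L[ℂ] Lp ℂ 2 (volume : Measure X)}
    (hV : IsGivenBy (fun ζ p => u p * ζ (τ p)) V)
    (hα : ∀ p s, s ∈ K → α s (τ p) = τ (α' s p))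
    (hu : ∀ p s, s ∈ K → u p * (w s * k (τ p) s) = w' s * k' p s * u (α' s p)) :
    V * kerOp w α k = kerOp w' α' k' * V := by
  ext1 ζ
  refine Lp.ext ?_
  filter_upwards [hV (kerOp w α k ζ), hτ.ae (h.isGivenBy hK hK' hk ζ),
    h'.isGivenBy hK hK' hk' (V ζ), h'.ae_ae (hV ζ)] with p h1 h2 h3 h4
  rw [mul_apply_eq_comp, mul_apply_eq_comp, h1, h2, h3]
  unfold kerFormula
  rw [← integral_const_mul]
  refine integral_congr_ae ?_
  filter_upwards [h4] with s hs
  by_cases hsK : s ∈ K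
  · rw [hs, hα p s hsK, ← mul_assoc, hu p s hsK, mul_assoc]
  · simp only [hk.eq_zero _ hsK, hk'.eq_zero _ hsK]
    ring

end Flow

/-! ### Products and adjoints of kernel operators. -/

section Algebra

variable {X S : Type*} [MeasureSpace X] [MeasureSpace S]
  [SFinite (volume : Measure X)] [SFinite (volume : Measure S)]
  {w : S → ℂ} {α : S → X → X} {k : X → S → ℂ} {K : Set S} {C : ℝ}

/-- Composition of kernel operators: the first one integrates over `S'`, which acts
through `j : S' → S`. -/
theorem IsFlow.isGivenBy_mul [AddCommGroup S] [MeasurableAdd S] [MeasurableSub₂ S]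
    [(volume : Measure S).IsAddRightInvariant]
    {S' : Type*} [MeasureSpace S'] [SFinite (volume : Measure S')]
    (h : IsFlow w α) (hw : ∀ s t, w (s + t) = w s * w t)
    (hα : ∀ s t p, α t (α s p) = α (s + t) p)
    {j : S' → S} (hj : Measurable j) {h₁ : X → S' → ℂ} {K' : Set S'} {C' : ℝ}
    (hK' : MeasurableSet K') (hK'f : volume K' ≠ ⊤) (hh : KerBound h₁ K' C')
    (hK : MeasurableSet K) (hKf : volume K ≠ ⊤) (hk : KerBound k K C)
    {M : Set S} (hM : MeasurableSet M) (hMf : volume M ≠ ⊤)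
    (hKM : ∀ s ∈ K', ∀ t ∈ K, t + j s ∈ M) :
    IsGivenBy (kerFormula w α fun p u => ∫ s, h₁ p s * k (α (j s) p) (u - j s))
      (kerOp (fun s => w (j s)) (fun s => α (j s)) h₁ * kerOp w α k) := by
  intro ζ
  have hz := (Lp.stronglyMeasurable ζ).measurable
  have h' := h.comp hj
  filter_upwards [h'.isGivenBy hK' hK'f hh (kerOp w α k ζ),
    h'.ae_ae (h.isGivenBy hK hKf hk ζ), h.ae_integrableOn hM hMf hz (Lp.memLp ζ)] with p h1 h2 h3
  rw [mul_apply_eq_comp, h1]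
  unfold kerFormula
  have hk0 : ∀ s u, (s ∉ K' ∨ u ∉ M) → h₁ p s * k (α (j s) p) (u - j s) = 0 := by
    rintro s u hsu
    by_cases hs : s ∈ K'
    · rw [hk.eq_zero, mul_zero]
      intro hu
      have := hKM s hs _ hu
      rw [sub_add_cancel] at this
      exact hsu.elim (fun h => h hs) (fun h => h this)
    · rw [hh.eq_zero _ hs, zero_mul]
  have hmeas : Measurable fun q : S' × S =>
      h₁ p q.1 * k (α (j q.1) p) (q.2 - j q.1) * (w q.2 * ζ (α q.2 p)) := by
    refine Measurable.mul (Measurable.mul (hh.meas.comp (measurable_const.prodMk measurable_fst))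
      (hk.meas.comp (Measurable.prodMk ?_ ?_))) (Measurable.mul (h.meas_w.comp measurable_snd)
      (hz.comp (h.meas_α.comp (measurable_const.prodMk measurable_snd))))
    · exact h.meas_α.comp (measurable_const.prodMk (hj.comp measurable_fst))
    · exact measurable_snd.sub (hj.comp measurable_fst)
  have hint : Integrable (fun q : S' × S =>
      h₁ p q.1 * k (α (j q.1) p) (q.2 - j q.1) * (w q.2 * ζ (α q.2 p)))
      (volume.prod volume) := by
    -- `M` contains every sum `t + j s`, so the double integrand lives over `K' × M`. There it is
    -- dominated by a constant in `s` times an orbit function that is integrable over `M`.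
    have hdom : Integrable (fun q : S' × S => K'.indicator (fun _ => |C'| * |C|) q.1 *
        M.indicator (fun u => ‖w u * ζ (α u p)‖) q.2) (volume.prod volume) := by
      refine Integrable.mul_prod (f := K'.indicator (fun _ => |C'| * |C|))
        (g := M.indicator (fun u => ‖w u * ζ (α u p)‖)) ?_ ?_
      · exact (integrable_indicator_iff hK').2 (integrableOn_const hK'f)
      · exact (integrable_indicator_iff hM).2 h3.norm
    refine hdom.mono' hmeas.aestronglyMeasurable (Eventually.of_forall fun q => ?_)
    by_cases hs : q.1 ∈ K' ∧ q.2 ∈ M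
    · rw [Set.indicator_of_mem hs.1, Set.indicator_of_mem hs.2, norm_mul, norm_mul]
      have b1 : ‖h₁ p q.1‖ ≤ |C'| := (hh.bound p q.1).trans
        (by simp [hs.1, le_abs_self])
      have b2 : ‖k (α (j q.1) p) (q.2 - j q.1)‖ ≤ |C| := (hk.bound _ _).trans
        (by by_cases hq : q.2 - j q.1 ∈ K <;> simp [hq, le_abs_self])
      gcongr
    · rw [hk0 _ _ (by tauto), zero_mul, norm_zero]
      refine mul_nonneg (Set.indicator_nonneg (fun _ _ => by positivity) _)
        (Set.indicator_nonneg (fun _ _ => by positivity) _)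
  -- The substitution `t = u - j s` in the inner integral merges the two translations, because `w`
  -- is multiplicative and `α` an action; Fubini then collects the coefficient of `w u * ζ (α u p)`.
  calc ∫ s, w (j s) * h₁ p s * kerOp w α k ζ (α (j s) p)
      = ∫ s, ∫ u, h₁ p s * k (α (j s) p) (u - j s) * (w u * ζ (α u p)) := by
        refine integral_congr_ae ?_
        filter_upwards [h2] with s hs
        rw [hs]
        unfold kerFormula
        rw [← integral_const_mul,
          ← integral_sub_right_eq_self _ (j s)]
        congr 1
        ext u
        rw [hα]
        have e1 : w u = w (j s) * w (u - j s) := by rw [← hw]; congr 1; abel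
        have e2 : j s + (u - j s) = u := by abel
        rw [e1, e2]; ring
    _ = ∫ u, ∫ s, h₁ p s * k (α (j s) p) (u - j s) * (w u * ζ (α u p)) :=
        integral_integral_swap hint
    _ = _ := by
        congr 1
        ext u
        rw [integral_mul_const]; ring

/-- From `ab ≤ a² + b²`, the integrand is dominated by squares that are integrable over `X × K`.
This licenses the exchanges of integrals in the computation of the adjoint. -/
theorem IsFlow.integrable_pairing (h : IsFlow w α) (hK : MeasurableSet K) (hKf : volume K ≠ ⊤)
    (hk : KerBound k K C) {η ζ : X → ℂ} (hy : Measurable η) (hη2 : MemLp η 2 volume)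
    (hz : Measurable ζ) (hζ2 : MemLp ζ 2 volume) :
    Integrable (fun q : X × S => conj (η q.1) * (w q.2 * k q.1 q.2 * ζ (α q.2 q.1)))
      (volume.prod volume) := by
  have hm : Measurable fun q : X × S =>
      conj (η q.1) * (w q.2 * k q.1 q.2 * ζ (α q.2 q.1)) :=
    (Complex.continuous_conj.measurable.comp (hy.comp measurable_fst)).mul
      (((h.meas_w.comp measurable_snd).mul hk.meas).mul (hz.comp h.meas_α))
  refine ⟨hm.aestronglyMeasurable, ?_⟩
  rw [hasFiniteIntegral_iff_enorm]
  have hm2 : Measurable fun q : X × S =>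
      ‖η q.1‖ₑ ^ 2 + ‖w q.2‖ₑ ^ 2 * ‖ζ (α q.2 q.1)‖ₑ ^ 2 :=
    ((hy.comp measurable_fst).enorm.pow_const 2).add
      (((h.meas_w.comp measurable_snd).enorm.pow_const 2).mul
        ((hz.comp h.meas_α).enorm.pow_const 2))
  calc ∫⁻ q : X × S, ‖conj (η q.1) * (w q.2 * k q.1 q.2 * ζ (α q.2 q.1))‖ₑ
          ∂(volume.prod volume)
      ≤ ∫⁻ q : X × S in Set.univ ×ˢ K, ENNReal.ofReal C *
          (‖η q.1‖ₑ ^ 2 + ‖w q.2‖ₑ ^ 2 * ‖ζ (α q.2 q.1)‖ₑ ^ 2) ∂(volume.prod volume) := by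
        rw [← lintegral_indicator (MeasurableSet.univ.prod hK)]
        refine lintegral_mono fun q => ?_
        by_cases hq : q.2 ∈ K
        · have hb := hk.enorm_le q.1 q.2
          rw [Set.indicator_of_mem hq] at hb
          rw [Set.indicator_of_mem (by simpa using hq)]
          simp only [enorm_mul]
          have hc : ‖conj (η q.1)‖ₑ = ‖η q.1‖ₑ := by
            rw [← ofReal_norm, RCLike.norm_conj, ofReal_norm]
          rw [hc]
          have hab : ∀ a b : ℝ≥0∞, a * b ≤ a ^ 2 + b ^ 2 := fun a b => by
            rcases le_total a b with hab | hab
            · calc a * b ≤ b * b := by gcongr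
                _ = b ^ 2 := (sq b).symm
                _ ≤ _ := le_add_self
            · calc a * b ≤ a * a := by gcongr
                _ = a ^ 2 := (sq a).symm
                _ ≤ _ := le_self_add
          calc ‖η q.1‖ₑ * (‖w q.2‖ₑ * ‖k q.1 q.2‖ₑ * ‖ζ (α q.2 q.1)‖ₑ)
              = ‖k q.1 q.2‖ₑ * (‖η q.1‖ₑ * (‖w q.2‖ₑ * ‖ζ (α q.2 q.1)‖ₑ)) := by ring
            _ ≤ ENNReal.ofReal C * (‖η q.1‖ₑ ^ 2 + (‖w q.2‖ₑ * ‖ζ (α q.2 q.1)‖ₑ) ^ 2) := by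
                gcongr
                exact hab _ _
            _ = _ := by rw [mul_pow]
        · rw [hk.eq_zero _ hq]; simp
    _ = ENNReal.ofReal C * (volume K * (∫⁻ p, ‖η p‖ₑ ^ 2) + volume K * ∫⁻ p, ‖ζ p‖ₑ ^ 2) := by
        rw [lintegral_const_mul _ hm2, ← Measure.prod_restrict, Measure.restrict_univ,
          lintegral_prod _ hm2.aemeasurable]
        congr 1
        have hmm : Measurable fun q : X × S => ‖w q.2‖ₑ ^ 2 * ‖ζ (α q.2 q.1)‖ₑ ^ 2 :=
          (((h.meas_w.comp measurable_snd).enorm.pow_const 2).mul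
            ((hz.comp h.meas_α).enorm.pow_const 2))
        calc ∫⁻ p, ∫⁻ s in K, (‖η p‖ₑ ^ 2 + ‖w s‖ₑ ^ 2 * ‖ζ (α s p)‖ₑ ^ 2)
            = ∫⁻ p, (volume K * ‖η p‖ₑ ^ 2 + ∫⁻ s in K, ‖w s‖ₑ ^ 2 * ‖ζ (α s p)‖ₑ ^ 2) := by
              congr 1
              ext p
              rw [lintegral_add_left measurable_const, setLIntegral_const, mul_comm (volume K)]
          _ = _ := by
              rw [lintegral_add_left ((hy.enorm.pow_const 2).const_mul _),
                lintegral_const_mul _ (hy.enorm.pow_const 2),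
                h.lintegral_lintegral (hz.enorm.pow_const 2)]
    _ < ⊤ := by
        rw [← eLpNorm_two_sq, ← eLpNorm_two_sq]
        exact ENNReal.mul_lt_top ENNReal.ofReal_lt_top (ENNReal.add_lt_top.2
          ⟨ENNReal.mul_lt_top hKf.lt_top (ENNReal.pow_lt_top hη2.2),
            ENNReal.mul_lt_top hKf.lt_top (ENNReal.pow_lt_top hζ2.2)⟩)

/-- The adjoint of a kernel operator. -/
theorem IsFlow.isGivenBy_adjoint [AddCommGroup S] [MeasurableNeg S]
    [(volume : Measure S).IsNegInvariant]
    (h : IsFlow w α) (hw : ∀ s t, w (s + t) = w s * w t) (hw0 : w 0 = 1)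
    (hwr : ∀ s, conj (w s) = w s)
    (hα : ∀ s t p, α t (α s p) = α (s + t) p) (hα0 : ∀ p, α 0 p = p)
    (hK : MeasurableSet K) (hKf : volume K ≠ ⊤) (hk : KerBound k K C) :
    star (kerOp w α k) = kerOp w α fun p s => conj (k (α s p) (-s)) := by
  have hkst : KerBound (fun p s => conj (k (α s p) (-s))) (-K) C := by
    refine ⟨?_, fun p s => ?_⟩
    · exact Complex.continuous_conj.measurable.comp
        (hk.meas.comp (h.meas_α.prodMk measurable_snd.neg))
    · rw [RCLike.norm_conj]
      exact hk.bound _ _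
  have hKn : MeasurableSet (-K) := hK.neg
  have hKnf : volume (-K) ≠ ⊤ := by rwa [Measure.measure_neg]
  rw [ContinuousLinearMap.star_eq_adjoint, eq_comm, ContinuousLinearMap.eq_adjoint_iff]
  intro η ζ
  have hz := (Lp.stronglyMeasurable ζ).measurable
  have hy := (Lp.stronglyMeasurable η).measurable
  rw [L2.inner_def, L2.inner_def]
  have e1 : ∫ p, inner ℂ (kerOp w α (fun p s => conj (k (α s p) (-s))) η p) (ζ p) =
      ∫ p, ∫ s, w s * k (α s p) (-s) * conj (η (α s p)) * ζ p := by
    refine integral_congr_ae ?_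
    filter_upwards [h.isGivenBy hKn hKnf hkst η] with p hp
    rw [hp, RCLike.inner_apply']
    unfold kerFormula
    rw [← integral_conj, ← integral_mul_const]
    congr 1
    ext s
    simp only [map_mul, hwr, Complex.conj_conj]
  have e2 : ∫ p, inner ℂ (η p) (kerOp w α k ζ p) =
      ∫ p, ∫ s, conj (η p) * (w s * k p s * ζ (α s p)) := by
    refine integral_congr_ae ?_
    filter_upwards [h.isGivenBy hK hKf hk ζ] with p hp
    rw [hp, RCLike.inner_apply']
    unfold kerFormula
    rw [← integral_const_mul]
  have hint := h.integrable_pairing hK hKf hk hy (Lp.memLp η) hz (Lp.memLp ζ)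
  -- The scaling identity for nonnegative functions, carried over to complex ones: it says that `α
  -- s` pushes `‖w s‖²` times the measure to the measure itself, and `w s` is real.
  have hscale : ∀ s, ∀ g : X → ℂ, Measurable g →
      ∫ p, w s * w s * g (α s p) = ∫ p, g p := fun s g hg => by
    have hmp : Measure.map (α s) (ENNReal.ofReal (‖w s‖ ^ 2) • volume) = (volume : Measure X) := by
      ext A hA
      rw [Measure.map_apply (h.measurable_apply s) hA, Measure.smul_apply, smul_eq_mul]
      have := h.scale s (A.indicator 1) (measurable_one.indicator hA)
      have hm : Measurable fun p => A.indicator (1 : X → ℝ≥0∞) (α s p) :=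
        (measurable_one.indicator hA).comp (h.measurable_apply s)
      rw [lintegral_indicator_one hA, lintegral_const_mul _ hm] at this
      rw [← this, ENNReal.ofReal_pow (norm_nonneg _), ofReal_norm]
      congr 1
      rw [← lintegral_indicator_one (h.measurable_apply s hA)]
      rfl
    rw [← hmp, integral_map (h.measurable_apply s).aemeasurable hg.aestronglyMeasurable]
    rw [integral_const_mul, integral_smul_measure, hmp, ENNReal.toReal_ofReal (by positivity)]
    have : w s * w s = ((‖w s‖ ^ 2 : ℝ) : ℂ) := by
      calc w s * w s = conj (w s) * w s := by rw [hwr]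
        _ = _ := by rw [Complex.conj_mul']; push_cast; rfl
    rw [this, Complex.real_smul]
  have hint2 : Integrable (fun q : X × S => w q.2 * k (α q.2 q.1) (-q.2) *
      conj (η (α q.2 q.1)) * ζ q.1) (volume.prod volume) := by
    have := (Complex.conjCLE.toContinuousLinearMap.integrable_comp
      (h.integrable_pairing hKn hKnf hkst hz (Lp.memLp ζ) hy (Lp.memLp η)))
    refine this.congr (Eventually.of_forall fun q => ?_)
    simp only [ContinuousLinearEquiv.coe_coe, Complex.conjCLE_apply, map_mul, hwr,
      Complex.conj_conj]
    ring
  have hg : ∀ s, Measurable fun p =>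
      w s * k (α s p) (-s) * conj (η (α s p)) * ζ p := fun s =>
    ((measurable_const.mul (hk.meas.comp ((h.measurable_apply s).prodMk measurable_const))).mul
      (Complex.continuous_conj.measurable.comp (hy.comp (h.measurable_apply s)))).mul hz
  rw [e1, e2, integral_integral_swap (f := fun p s => conj (η p) * (w s * k p s * ζ (α s p))) hint,
    integral_integral_swap
    (f := fun p s => w s * k (α s p) (-s) * conj (η (α s p)) * ζ p) hint2, ← integral_neg_eq_self (μ := (volume : Measure S))]
  congr 1
  ext s
  -- With `s` already replaced by `-s`, the substitution `p ↦ α s p` moves the flow from `η` to `ζ`;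
  -- one factor of its density cancels against `w (-s)`.
  rw [← hscale s]
  · have e3 : w s * w (-s) = 1 := by rw [← hw, add_neg_cancel, hw0]
    have e4 : ∀ p, α (-s) (α s p) = p := fun p => by rw [hα, add_neg_cancel, hα0]
    congr 1
    ext p
    rw [e4, neg_neg]
    linear_combination (w s * k p s * conj (η p) * ζ (α s p)) * e3
  · exact hg (-s)

end Algebra

/-! ### Systems: a group `S` acting on `X` and, continuously, on a quotient `Z` of `X` -/

/-- A group `S` acting on a measure space `X`, scaling the measure by `w ^ (-2)`, and acting
compatibly and continuously on a quotient `Z` of `X`. -/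
structure System (X Z S : Type*) [MeasureSpace X] [MeasureSpace S] [AddCommGroup S]
    [TopologicalSpace S] [TopologicalSpace Z] [MeasurableSpace Z] where
  w : S → ℂ
  α : S → X → X
  γ : S → Z → Z
  π : X → Z
  flow : IsFlow w α
  w_add : ∀ s t, w (s + t) = w s * w t
  w_real : ∀ s, conj (w s) = w s
  α_add : ∀ s t p, α t (α s p) = α (s + t) p
  α_zero : ∀ p, α 0 p = p
  γ_add : ∀ s t z, γ t (γ s z) = γ (s + t) z
  γ_zero : ∀ z, γ 0 z = z
  γ_cont : Continuous fun q : S × Z => γ q.1 q.2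
  π_meas : Measurable π
  π_α : ∀ s p, π (α s p) = γ s (π p)

/-- A continuous kernel on `Z × S`, bounded by `C` and supported in `Z × K`, `K` compact. -/
structure IsKer {Z S : Type*} [TopologicalSpace Z] [TopologicalSpace S] (f : Z × S → ℂ)
    (K : Set S) (C : ℝ) : Prop where
  cont : Continuous f
  compact : IsCompact K
  bound : ∀ z s, ‖f (z, s)‖ ≤ K.indicator (fun _ => C) s

section IsKer
variable {Z S : Type*} [TopologicalSpace Z] [TopologicalSpace S] {f g : Z × S → ℂ}
  {K : Set S} {C C' : ℝ}

theorem IsKer.eq_zero (hf : IsKer f K C) (z : Z) {s : S} (hs : s ∉ K) : f (z, s) = 0 := by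
  simpa [hs] using hf.bound z s

theorem IsKer.mono (hf : IsKer f K C) {K' : Set S} (hK : K ⊆ K') (hK' : IsCompact K')
    (hC : C ≤ C') (hC' : 0 ≤ C') : IsKer f K' C' := by
  refine ⟨hf.cont, hK', fun z s => ?_⟩
  by_cases hs : s ∈ K
  · have := hf.bound z s
    rw [Set.indicator_of_mem hs] at this
    rw [Set.indicator_of_mem (hK hs)]
    exact this.trans hC
  · rw [hf.eq_zero z hs, norm_zero]
    exact Set.indicator_nonneg (fun _ _ => hC') _

theorem exists_isKer (hf : Continuous f) (hc : HasCompactSupport f) :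
    ∃ K C, 0 ≤ C ∧ IsKer f K C := by
  obtain ⟨C, hC⟩ := hf.bounded_above_of_compact_support hc
  refine ⟨Prod.snd '' tsupport f, |C|, abs_nonneg C, hf, hc.isCompact.image continuous_snd,
    fun z s => ?_⟩
  by_cases hs : s ∈ Prod.snd '' tsupport f
  · rw [Set.indicator_of_mem hs]
    exact (hC _).trans (le_abs_self C)
  · rw [Set.indicator_of_notMem hs]
    have : (z, s) ∉ tsupport f := fun h => hs ⟨_, h, rfl⟩
    rw [image_eq_zero_of_notMem_tsupport this, norm_zero]

end IsKer

/-! ### The calculus of continuous kernels on `Z × S`. -/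

namespace System

variable {X Z S : Type*} [MeasureSpace X] [SFinite (volume : Measure X)]
  [MeasureSpace S] [AddCommGroup S] [TopologicalSpace S] [IsTopologicalAddGroup S]
  [SecondCountableTopology S] [T2Space S] [BorelSpace S]
  [SigmaFinite (volume : Measure S)] [IsFiniteMeasureOnCompacts (volume : Measure S)]
  [TopologicalSpace Z] [SecondCountableTopology Z] [MeasurableSpace Z] [BorelSpace Z]
  (D : System X Z S)

theorem w_zero : D.w 0 = 1 := by
  have := D.w_add 0 0
  rw [add_zero] at this
  exact mul_right_cancel₀ (D.flow.ne_zero 0) (by rw [one_mul, ← this])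

/-- The restriction of a system along a homomorphism of groups. -/
def comp {S' : Type*} [MeasureSpace S'] [AddCommGroup S'] [TopologicalSpace S']
    [BorelSpace S'] (j : S' →+ S) (hj : Continuous j) : System X Z S' where
  w s := D.w (j s)
  α s := D.α (j s)
  γ s := D.γ (j s)
  π := D.π
  flow := D.flow.comp hj.measurable
  w_add s t := by rw [map_add, D.w_add]
  w_real s := D.w_real _
  α_add s t p := by rw [D.α_add, map_add]
  α_zero p := by rw [map_zero, D.α_zero]
  γ_add s t p := by rw [D.γ_add, map_add]
  γ_zero p := by rw [map_zero, D.γ_zero]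
  γ_cont := D.γ_cont.comp ((hj.comp continuous_fst).prodMk continuous_snd)
  π_meas := D.π_meas
  π_α s p := D.π_α _ _

/-- The operator with kernel `f(π(p), s)`. -/
noncomputable def op (f : Z × S → ℂ) :
    Lp ℂ 2 (volume : Measure X) →L[ℂ] Lp ℂ 2 (volume : Measure X) :=
  kerOp D.w D.α fun p s => f (D.π p, s)

variable {D} {f g : Z × S → ℂ} {K : Set S} {C C' : ℝ}

theorem kerBound (hf : IsKer f K C) : KerBound (fun p s => f (D.π p, s)) K C :=
  ⟨hf.cont.measurable.comp ((D.π_meas.comp measurable_fst).prodMk measurable_snd),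
    fun _ _ => hf.bound _ _⟩

theorem isGivenBy_op (hf : IsKer f K C) :
    IsGivenBy (kerFormula D.w D.α fun p s => f (D.π p, s)) (D.op f) :=
  D.flow.isGivenBy hf.compact.measurableSet hf.compact.measure_lt_top.ne (kerBound hf)

theorem op_add (hf : IsKer f K C) (hg : IsKer g K C') :
    D.op (fun q => f q + g q) = D.op f + D.op g :=
  D.flow.kerOp_add hf.compact.measurableSet hf.compact.measure_lt_top.ne (kerBound hf) (kerBound hg)

theorem op_smul (hf : IsKer f K C) (c : ℂ) : D.op (fun q => c * f q) = c • D.op f :=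
  D.flow.kerOp_smul hf.compact.measurableSet hf.compact.measure_lt_top.ne (kerBound hf) c

theorem op_zero : D.op (fun _ => 0) = 0 := by
  have h : IsKer (fun _ : Z × S => (0 : ℂ)) ∅ 0 := ⟨continuous_const, isCompact_empty, by simp⟩
  simpa using D.op_smul h 0

theorem norm_op_sub_le (hf : IsKer f K C) (hg : IsKer g K C') {ε : ℝ} (hε : 0 ≤ ε)
    (h : ∀ z, ∀ s ∈ K, ‖f (z, s) - g (z, s)‖ ≤ ε) :
    ‖D.op f - D.op g‖ ≤ ε * (volume K).toReal :=
  D.flow.norm_kerOp_sub_le hf.compact.measurableSet hf.compact.measure_lt_top.ne (kerBound hf)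
    (kerBound hg) hε fun _ s hs => h _ s hs

theorem op_sum {ι : Type*} {F : ι → Z × S → ℂ} {B : ι → ℝ} (t : Finset ι) (hK : IsCompact K)
    (hF : ∀ i ∈ t, IsKer (F i) K (B i)) :
    IsKer (fun q => ∑ i ∈ t, F i q) K (∑ i ∈ t, B i) ∧
      D.op (fun q => ∑ i ∈ t, F i q) = ∑ i ∈ t, D.op (F i) := by
  classical
  induction t using Finset.induction_on with
  | empty =>
    simp only [Finset.sum_empty, op_zero, and_true]
    exact ⟨continuous_const, hK, fun z s => by simp⟩
  | insert i t hi ih =>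
    obtain ⟨h1, h2⟩ := ih fun j hj => hF j (Finset.mem_insert_of_mem hj)
    have h3 := hF i (Finset.mem_insert_self i t)
    simp only [Finset.sum_insert hi]
    refine ⟨⟨h3.cont.add h1.cont, hK, fun z s => ?_⟩, by rw [op_add h3 h1, h2]⟩
    refine (norm_add_le _ _).trans ((add_le_add (h3.bound z s) (h1.bound z s)).trans ?_)
    by_cases hs : s ∈ K <;> simp [hs]

/-- The approximants need no bound of their own: they inherit one from `f`, being uniformly close to
it over the same `K`. -/
theorem op_mem_closure (hf : IsKer f K C)
    {A : Set (Lp ℂ 2 (volume : Measure X) →L[ℂ] Lp ℂ 2 (volume : Measure X))}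
    (h : ∀ ε > 0, ∃ g : Z × S → ℂ, Continuous g ∧ (∀ z, ∀ s ∉ K, g (z, s) = 0) ∧ D.op g ∈ A ∧
      ∀ z, ∀ s ∈ K, ‖f (z, s) - g (z, s)‖ ≤ ε) : D.op f ∈ closure A := by
  rw [Metric.mem_closure_iff]
  intro ε hε
  set v := (volume K).toReal with hv
  have hv0 : 0 ≤ v := ENNReal.toReal_nonneg
  -- Dividing by `v + 1` rather than `v` covers `v = 0` and leaves a strict inequality.
  obtain ⟨g, hgc, hg0, hgA, hgd⟩ := h (ε / (v + 1)) (by positivity)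
  refine ⟨_, hgA, ?_⟩
  have hg : IsKer g K (C + ε / (v + 1)) := by
    refine ⟨hgc, hf.compact, fun z s => ?_⟩
    by_cases hs : s ∈ K
    · rw [Set.indicator_of_mem hs]
      have h1 := hf.bound z s
      rw [Set.indicator_of_mem hs] at h1
      have h2 := norm_sub_norm_le (g (z, s)) (f (z, s))
      rw [norm_sub_rev] at h2
      linarith [hgd z s hs]
    · simp [hg0 z s hs, hs]
  rw [dist_eq_norm]
  refine (norm_op_sub_le hf hg (by positivity) hgd).trans_lt ?_
  rw [← hv, div_mul_eq_mul_div, div_lt_iff₀ (by positivity)]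
  nlinarith

section mul

variable [(volume : Measure S).IsAddRightInvariant] [LocallyCompactSpace S] [LocallyCompactSpace Z]
  [T2Space Z]
  {S' : Type*} [MeasureSpace S'] [AddCommGroup S'] [TopologicalSpace S'] [T2Space S']
  [IsTopologicalAddGroup S']
  [SecondCountableTopology S'] [BorelSpace S'] [SigmaFinite (volume : Measure S')]
  [IsLocallyFiniteMeasure (volume : Measure S')]
  {j : S' →+ S} {hj : Continuous j} {h : Z × S' → ℂ} {K' : Set S'} {Ch : ℝ}

variable (D) in
/-- The twisted convolution of kernels. -/
noncomputable def conv (j : S' →+ S) (h : Z × S' → ℂ) (f : Z × S → ℂ) : Z × S → ℂ :=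
  fun q => ∫ s, h (q.1, s) * f (D.γ (j s) q.1, q.2 - j s)

theorem continuous_conv (hj : Continuous j) (hh : IsKer h K' Ch) (hf : Continuous f) :
    Continuous (D.conv j h f) := by
  have e : D.conv j h f = fun q => ∫ s in K', h (q.1, s) * f (D.γ (j s) q.1, q.2 - j s) := by
    ext q
    refine (setIntegral_eq_integral_of_forall_compl_eq_zero fun s hs => ?_).symm
    rw [hh.eq_zero _ hs, zero_mul]
  rw [e]
  refine continuous_parametric_integral_of_continuous
    (f := fun (q : Z × S) (s : S') => h (q.1, s) * f (D.γ (j s) q.1, q.2 - j s)) ?_ hh.compact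
  have h1 : Continuous fun p : (Z × S) × S' => D.γ (j p.2) p.1.1 :=
    D.γ_cont.comp ((hj.comp continuous_snd).prodMk (continuous_fst.comp continuous_fst))
  have h2 : Continuous fun p : (Z × S) × S' => p.1.2 - j p.2 :=
    (continuous_snd.comp continuous_fst).sub (hj.comp continuous_snd)
  exact (hh.cont.comp ((continuous_fst.comp continuous_fst).prodMk continuous_snd)).mul
    (hf.comp (h1.prodMk h2))

/-- The inverse translations by the compact set `K'` sweep the support of `f` over a compact image,
which is `L`. -/
theorem translate_support (hj : Continuous j) (hK' : IsCompact K') (hf : HasCompactSupport f) :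
    ∃ L : Set (Z × S), IsCompact L ∧ ∀ q ∉ L, ∀ s ∈ K', f (D.γ (j s) q.1, q.2 - j s) = 0 := by
  refine ⟨(fun p : S' × (Z × S) => (D.γ (-j p.1) p.2.1, p.2.2 + j p.1)) '' (K' ×ˢ tsupport f),
    (hK'.prod hf.isCompact).image ?_, fun q hq s hs => ?_⟩
  · refine Continuous.prodMk (D.γ_cont.comp (Continuous.prodMk (hj.comp continuous_fst).neg
      (continuous_fst.comp continuous_snd))) ?_
    exact (continuous_snd.comp continuous_snd).add (hj.comp continuous_fst)
  · have : (D.γ (j s) q.1, q.2 - j s) ∉ tsupport f := fun hmem => hq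
      ⟨(s, (D.γ (j s) q.1, q.2 - j s)), ⟨hs, hmem⟩, by
        simp only [D.γ_add, add_neg_cancel, D.γ_zero, sub_add_cancel]⟩
    rw [image_eq_zero_of_notMem_tsupport this]

theorem hasCompactSupport_conv (hj : Continuous j) (hh : IsKer h K' Ch)
    (hf : HasCompactSupport f) : HasCompactSupport (D.conv j h f) := by
  obtain ⟨L, hL, h0⟩ := D.translate_support hj hh.compact hf
  refine HasCompactSupport.intro hL fun q hq => ?_
  refine integral_eq_zero_of_ae (Eventually.of_forall fun s => ?_)
  by_cases hs : s ∈ K'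
  · simp only [h0 q hq s hs, mul_zero, Pi.zero_apply]
  · simp only [hh.eq_zero _ hs, zero_mul, Pi.zero_apply]

/-- Only `f` has compact support in `Z`; `h` is merely bounded there. With `j` the identity this
makes the core an algebra, and with `j` the diagonal of `ℝ × ℝ` it makes the comultiplication take
values in multipliers. -/
theorem op_mul (hh : IsKer h K' Ch) (hf : Continuous f) (hfc : HasCompactSupport f) :
    (D.comp j hj).op h * D.op f = D.op (D.conv j h f) := by
  obtain ⟨K, C, hC, hK⟩ := exists_isKer hf hfc
  have hMc : IsCompact ((fun p : S × S' => p.1 + j p.2) '' (K ×ˢ K')) :=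
    (hK.compact.prod hh.compact).image (continuous_fst.add (hj.comp continuous_snd))
  have := D.flow.isGivenBy_mul D.w_add D.α_add (j := j) hj.measurable
    hh.compact.measurableSet hh.compact.measure_lt_top.ne
    (kerBound (D := D.comp j hj) hh)
    hK.compact.measurableSet hK.compact.measure_lt_top.ne (kerBound (D := D) hK)
    hMc.measurableSet hMc.measure_lt_top.ne (fun s hs t ht => ⟨(t, s), ⟨ht, hs⟩, rfl⟩)
  refine (IsGivenBy.opGivenBy_eq (this.congr fun ζ p => ?_)).symm
  simp only [D.π_α]
  rfl

end mul

section star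

variable [T2Space Z] [(volume : Measure S).IsNegInvariant]

variable (D) in
/-- The adjoint kernel. -/
def kerStar (f : Z × S → ℂ) : Z × S → ℂ := fun q => conj (f (D.γ q.2 q.1, -q.2))

theorem op_star (hf : IsKer f K C) : star (D.op f) = D.op (D.kerStar f) := by
  unfold op
  rw [D.flow.isGivenBy_adjoint D.w_add D.w_zero D.w_real D.α_add D.α_zero
    hf.compact.measurableSet hf.compact.measure_lt_top.ne (kerBound hf)]
  simp only [D.π_α]
  rfl

theorem continuous_kerStar (hf : Continuous f) : Continuous (D.kerStar f) :=
  Complex.continuous_conj.comp (hf.comp ((D.γ_cont.comp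
    (continuous_snd.prodMk continuous_fst)).prodMk continuous_snd.neg))

theorem hasCompactSupport_kerStar (hf : HasCompactSupport f) :
    HasCompactSupport (D.kerStar f) := by
  have hc : Continuous fun q : Z × S => (D.γ q.2 q.1, -q.2) :=
    (D.γ_cont.comp (continuous_snd.prodMk continuous_fst)).prodMk continuous_snd.neg
  refine HasCompactSupport.intro (hf.isCompact.image hc)
    fun q hq => ?_
  have : (D.γ q.2 q.1, -q.2) ∉ tsupport f := fun hmem => hq
    ⟨_, hmem, by simp only [D.γ_add, add_neg_cancel, D.γ_zero, neg_neg]⟩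
  unfold kerStar
  rw [image_eq_zero_of_notMem_tsupport this, map_zero]

end star

section core

variable [(volume : Measure S).IsNegInvariant] [(volume : Measure S).IsAddRightInvariant]
  [LocallyCompactSpace S] [LocallyCompactSpace Z] [T2Space Z]

variable (D) in
/-- The star algebra of the operators with continuous kernels of compact support. -/
noncomputable def core :
    NonUnitalStarSubalgebra ℂ (Lp ℂ 2 (volume : Measure X) →L[ℂ] Lp ℂ 2 (volume : Measure X)) where
  carrier := {T | ∃ f : Z × S → ℂ, Continuous f ∧ HasCompactSupport f ∧ T = D.op f}
  add_mem' := by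
    rintro _ _ ⟨f, hf, hfc, rfl⟩ ⟨g, hg, hgc, rfl⟩
    obtain ⟨K, C, hC, hK⟩ := exists_isKer hf hfc
    obtain ⟨L, C', hC', hL⟩ := exists_isKer hg hgc
    have hKL := hK.compact.union hL.compact
    exact ⟨_, hf.add hg, hfc.add hgc, (op_add (hK.mono Set.subset_union_left hKL le_rfl hC)
      (hL.mono Set.subset_union_right hKL le_rfl hC')).symm⟩
  zero_mem' := ⟨fun _ => 0, continuous_const, HasCompactSupport.zero, op_zero.symm⟩
  smul_mem' := by
    rintro c _ ⟨f, hf, hfc, rfl⟩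
    obtain ⟨K, C, hC, hK⟩ := exists_isKer hf hfc
    exact ⟨_, continuous_const.mul hf, hfc.mul_left, (op_smul hK c).symm⟩
  mul_mem' := by
    rintro _ _ ⟨f, hf, hfc, rfl⟩ ⟨g, hg, hgc, rfl⟩
    obtain ⟨K, C, hC, hK⟩ := exists_isKer hf hfc
    have hid : Continuous (AddMonoidHom.id S) := continuous_id
    exact ⟨_, continuous_conv hid hK hg, hasCompactSupport_conv hid hK hgc,
      op_mul (hj := hid) hK hg hgc⟩
  star_mem' := by
    rintro _ ⟨f, hf, hfc, rfl⟩
    obtain ⟨K, C, hC, hK⟩ := exists_isKer hf hfc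
    exact ⟨_, continuous_kerStar hf, hasCompactSupport_kerStar hfc, op_star hK⟩

end core

end System

/-! ### Unitary weighted composition operators -/

/-- The weighted composition along the inverse map is a right inverse of an isometry `T`.
Multiplying by `star T` on the left identifies it with `star T`, so `T` is unitary. -/
theorem exists_unitary_weightedComp {Y : Type*} [MeasureSpace Y] (u v : Y → ℂ) (τ σ : Y → Y)
    (hu : Measurable u) (hv : Measurable v) (hτ : Measurable τ) (hσ : Measurable σ)
    (hστ : ∀ p, σ (τ p) = p) (hτσ : ∀ p, τ (σ p) = p) (huv : ∀ p, u p * v (τ p) = 1)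
    (h : ∀ g : Y → ℝ≥0∞, Measurable g → ∫⁻ p, ‖u p‖ₑ ^ 2 * g (τ p) = ∫⁻ p, g p) :
    Measure.QuasiMeasurePreserving τ ∧
    ∃ T : Lp ℂ 2 (volume : Measure Y) →L[ℂ] Lp ℂ 2 (volume : Measure Y),
      IsGivenBy (fun ζ p => u p * ζ (τ p)) T ∧ T ∈ unitary _ := by
  have hvu : ∀ p, v p * u (σ p) = 1 := fun p => by
    have := huv (σ p)
    rwa [hτσ, mul_comm] at this
  obtain ⟨hτq, T, hT, hTn⟩ := exists_weightedComp u τ hu hτ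
    (fun p h0 => by simpa [h0] using huv p) h
  obtain ⟨hσq, V, hV, hVn⟩ := exists_weightedComp v σ hv hσ
    (fun p h0 => by simpa [h0] using hvu p) (fun g hg => by
      have := h (fun p => ‖v p‖ₑ ^ 2 * g (σ p)) ((hv.enorm.pow_const 2).mul (hg.comp hσ))
      rw [← this]
      congr 1
      ext p
      rw [hστ, ← mul_assoc, ← mul_pow, ← enorm_mul, huv]
      simp)
  have hTV : T * V = 1 := by
    ext1 ζ
    refine Lp.ext ?_
    filter_upwards [hT (V ζ), hτq.ae (hV ζ)] with p h1 h2
    rw [mul_apply_eq_comp, h1, h2, hστ, ← mul_assoc, huv, one_mul]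
    rfl
  have hTT : star T * T = 1 := (ContinuousLinearMap.norm_map_iff_adjoint_comp_self T).1 hTn
  have hst : star T = V := by
    calc star T = star T * (T * V) := by rw [hTV, mul_one]
      _ = V := by rw [← mul_assoc, hTT, one_mul]
  exact ⟨hτq, T, hT, hTT, by rw [hst, hTV]⟩

/-! ### Products of systems -/

theorem lintegral_scale_prod {X Y : Type*} [MeasureSpace X] [MeasureSpace Y]
    [SFinite (volume : Measure X)] [SFinite (volume : Measure Y)]
    {d d' : ℝ≥0∞} {τ : X → X} {τ' : Y → Y} (hτ : Measurable τ) (hτ' : Measurable τ')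
    (h : ∀ g : X → ℝ≥0∞, Measurable g → ∫⁻ p, d * g (τ p) = ∫⁻ p, g p)
    (h' : ∀ g : Y → ℝ≥0∞, Measurable g → ∫⁻ p, d' * g (τ' p) = ∫⁻ p, g p)
    (g : X × Y → ℝ≥0∞) (hg : Measurable g) :
    ∫⁻ p : X × Y, d * d' * g (τ p.1, τ' p.2) = ∫⁻ p : X × Y, g p := by
  have hm : Measurable fun p : X × Y => g (τ p.1, τ' p.2) :=
    hg.comp ((hτ.comp measurable_fst).prodMk (hτ'.comp measurable_snd))
  rw [Measure.volume_eq_prod, lintegral_prod _ (hm.const_mul _).aemeasurable,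
    lintegral_prod _ hg.aemeasurable, ← h _ hg.lintegral_prod_right']
  congr 1
  ext x
  simp_rw [mul_assoc]
  have hmx : Measurable fun y => d' * g (τ x, τ' y) :=
    (hm.comp measurable_prodMk_left).const_mul _
  rw [lintegral_const_mul _ hmx]
  congr 1
  exact h' (fun y => g (τ x, y)) (hg.comp measurable_prodMk_left)

/-- The product of two systems. -/
def System.prod {X Z S X' Z' S' : Type*} [MeasureSpace X] [MeasureSpace S] [AddCommGroup S]
    [TopologicalSpace S] [TopologicalSpace Z] [MeasurableSpace Z]
    [MeasureSpace X'] [MeasureSpace S'] [AddCommGroup S']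
    [TopologicalSpace S'] [TopologicalSpace Z'] [MeasurableSpace Z']
    [SFinite (volume : Measure X)] [SFinite (volume : Measure X')]
    (D : System X Z S) (D' : System X' Z' S') : System (X × X') (Z × Z') (S × S') where
  w s := D.w s.1 * D'.w s.2
  α s p := (D.α s.1 p.1, D'.α s.2 p.2)
  γ s z := (D.γ s.1 z.1, D'.γ s.2 z.2)
  π p := (D.π p.1, D'.π p.2)
  flow :=
    { meas_w := (D.flow.meas_w.comp measurable_fst).mul (D'.flow.meas_w.comp measurable_snd)
      meas_α := (D.flow.meas_α.comp (Measurable.prodMk (measurable_fst.comp measurable_fst)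
        (measurable_fst.comp measurable_snd))).prodMk
        (D'.flow.meas_α.comp (Measurable.prodMk (measurable_snd.comp measurable_fst)
        (measurable_snd.comp measurable_snd)))
      ne_zero := fun s => mul_ne_zero (D.flow.ne_zero _) (D'.flow.ne_zero _)
      scale := fun s g hg => by
        simp_rw [enorm_mul, mul_pow]
        exact lintegral_scale_prod (D.flow.meas_α.comp (measurable_id.prodMk measurable_const))
          (D'.flow.meas_α.comp (measurable_id.prodMk measurable_const))
          (D.flow.scale s.1) (D'.flow.scale s.2) g hg }
  w_add s t := by
    rw [Prod.fst_add, Prod.snd_add, D.w_add, D'.w_add]; ring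
  w_real s := by rw [map_mul, D.w_real, D'.w_real]
  α_add s t p := by simp only [D.α_add, D'.α_add, Prod.fst_add, Prod.snd_add]
  α_zero p := by simp only [D.α_zero, D'.α_zero, Prod.fst_zero, Prod.snd_zero]
  γ_add s t p := by simp only [D.γ_add, D'.γ_add, Prod.fst_add, Prod.snd_add]
  γ_zero p := by simp only [D.γ_zero, D'.γ_zero, Prod.fst_zero, Prod.snd_zero]
  γ_cont := (D.γ_cont.comp (Continuous.prodMk (continuous_fst.comp continuous_fst)
        (continuous_fst.comp continuous_snd))).prodMk
        (D'.γ_cont.comp (Continuous.prodMk (continuous_snd.comp continuous_fst)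
        (continuous_snd.comp continuous_snd)))
  π_meas := (D.π_meas.comp measurable_fst).prodMk (D'.π_meas.comp measurable_snd)
  π_α s p := by simp only [D.π_α, D'.π_α]

/-! ### The dilation system -/

/-- The space of the variables `(x, y)`. -/
abbrev Zt (n : ℕ) : Type := EuclideanSpace ℝ (Fin n) × EuclideanSpace ℝ (Fin n)

theorem lintegral_scale_smul (n : ℕ) {c : ℝ} (hc : 0 < c) (g : EuclideanSpace ℝ (Fin n) → ℝ≥0∞)
    (hg : Measurable g) : ∫⁻ x, ENNReal.ofReal c ^ n * g (c • x) = ∫⁻ x, g x := by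
  have h1 : ∫⁻ x, g (c • x) = ENNReal.ofReal |(c ^ n)⁻¹| * ∫⁻ x, g x := by
    have := Measure.map_addHaar_smul (volume : Measure (EuclideanSpace ℝ (Fin n))) hc.ne'
    rw [finrank_euclideanSpace, Fintype.card_fin] at this
    rw [← smul_eq_mul, ← lintegral_smul_measure, ← this,
      lintegral_map hg (measurable_const_smul c)]
  rw [lintegral_const_mul _ (f := fun x => g (c • x)) (hg.comp (measurable_const_smul c)), h1, ← mul_assoc,
    ← ENNReal.ofReal_pow hc.le, ← ENNReal.ofReal_mul (by positivity),
    abs_of_pos (by positivity), mul_inv_cancel₀ (by positivity), ENNReal.ofReal_one, one_mul]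

/-- The system of `ρ`: `ℝ` acts on the `(x, y, r)` by dilation in `x, y` and translation in `r`. -/
noncomputable def sys (n : ℕ) (lam : ℝ) : System (Pt n) (Zt n) ℝ where
  w s := (Real.exp (lam * s) : ℂ) ^ n
  α s p := (Real.exp (lam * s) • p.1, Real.exp (lam * s) • p.2.1, p.2.2 - s)
  γ s z := (Real.exp (lam * s) • z.1, Real.exp (lam * s) • z.2)
  π p := (p.1, p.2.1)
  flow :=
    { meas_w := Continuous.measurable (by fun_prop)
      meas_α := Continuous.measurable (by fun_prop)
      ne_zero := fun s => pow_ne_zero _ (by exact_mod_cast (Real.exp_pos _).ne')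
      scale := fun s g hg => by
        have hd : ‖(Real.exp (lam * s) : ℂ) ^ n‖ₑ ^ 2 = ENNReal.ofReal (Real.exp (lam * s)) ^ n *
            (ENNReal.ofReal (Real.exp (lam * s)) ^ n * 1) := by
          rw [enorm_pow, ← ofReal_norm, Complex.norm_real, Real.norm_of_nonneg (Real.exp_pos _).le]
          ring
        rw [hd]
        have h0 := lintegral_scale_smul n (Real.exp_pos (lam * s))
        have h1 : ∀ g : ℝ → ℝ≥0∞, Measurable g → ∫⁻ r, 1 * g (r - s) = ∫⁻ r, g r := fun g hg => by
          simp_rw [one_mul]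
          exact lintegral_sub_right_eq_self g s
        exact lintegral_scale_prod (measurable_const_smul _)
          (τ' := fun q : EuclideanSpace ℝ (Fin n) × ℝ => (Real.exp (lam * s) • q.1, q.2 - s))
          (Continuous.measurable (by fun_prop)) h0
          (lintegral_scale_prod (τ' := fun r => r - s) (measurable_const_smul _)
            (Continuous.measurable (by fun_prop)) h0 h1) g hg }
  w_add s t := by
    rw [mul_add, Real.exp_add]; push_cast; ring
  w_real s := by rw [map_pow, Complex.conj_ofReal]
  α_add s t p := by
    simp only [smul_smul, ← Real.exp_add, sub_sub]
    rw [mul_add, add_comm (lam * s)]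
  α_zero p := by simp
  γ_add s t p := by
    simp only [smul_smul, ← Real.exp_add]
    rw [mul_add, add_comm (lam * s)]
  γ_zero p := by simp
  γ_cont := by fun_prop
  π_meas := Continuous.measurable (by fun_prop)
  π_α s p := rfl

theorem rhoFormula_eq {n : ℕ} (lam : ℝ) (f : Pt n → ℂ) (ζ : Pt n → ℂ) :
    kerFormula (sys n lam).w (sys n lam).α
      (fun p s => f (((sys n lam).π p).1, ((sys n lam).π p).2, s)) ζ = rhoFormula lam f ζ := rfl

/-- A function of `(x, y, r)` as a kernel. -/
def unc {n : ℕ} (f : Pt n → ℂ) : Zt n × ℝ → ℂ := fun q => f (q.1.1, q.1.2, q.2)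

theorem rho_eq_op {n : ℕ} (lam : ℝ) (f : Pt n → ℂ) : rho lam f = (sys n lam).op (unc f) := rfl

/-- The system of `ρ ⊗ ρ`. -/
noncomputable abbrev sys2 (n : ℕ) (lam : ℝ) :
    System (Pt n × Pt n) (Zt n × Zt n) (ℝ × ℝ) := (sys n lam).prod (sys n lam)

/-! ### The multiplicative unitary -/

theorem continuous_e : Continuous e := by
  unfold e
  fun_prop

theorem continuous_eta (lam : ℝ) : Continuous (eta lam) := by
  unfold eta
  by_cases h : lam = 0
  · simp only [h, if_true]; fun_prop
  · simp only [h, if_false]; fun_prop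

theorem norm_e (t : ℝ) : ‖e t‖ = 1 := by
  unfold e
  have : (2 * Real.pi * Complex.I * t : ℂ) = ((2 * Real.pi * t : ℝ) : ℂ) * Complex.I := by
    push_cast; ring
  rw [this, Complex.norm_exp_ofReal_mul_I]

theorem conj_e_mul_e (t : ℝ) : conj (e t) * e t = 1 := by
  rw [Complex.conj_mul', norm_e]; simp

theorem e_add (s t : ℝ) : e (s + t) = e s * e t := by
  unfold e
  rw [← Complex.exp_add]
  push_cast
  ring_nf

theorem conj_e (t : ℝ) : conj (e t) = e (-t) := by
  unfold e
  rw [← Complex.exp_conj]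
  have : conj (2 : ℂ) = 2 := Complex.conj_ofReal 2
  simp [this]

theorem continuous_beta {n : ℕ} :
    Continuous fun q : EuclideanSpace ℝ (Fin n) × EuclideanSpace ℝ (Fin n) => beta q.1 q.2 := by
  unfold beta
  fun_prop

section U

variable (n : ℕ) (lam : ℝ)

/-- The weight of `U_A`. -/
noncomputable def Uweight (q : Pt n × Pt n) : ℂ :=
  (Real.exp (-lam * q.2.2.2) : ℂ) ^ n *
    conj (e (eta lam q.2.2.2 * beta (Real.exp (-lam * q.2.2.2) • q.1.1)
      (q.2.2.1 - Real.exp (-lam * q.2.2.2) • q.1.2.1)))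

/-- The transformation of `U_A`. -/
noncomputable def Umap (q : Pt n × Pt n) : Pt n × Pt n :=
  ((Real.exp (-lam * q.2.2.2) • q.1.1, Real.exp (-lam * q.2.2.2) • q.1.2.1, q.1.2.2 + q.2.2.2),
    (q.2.1 - Real.exp (-lam * q.2.2.2) • q.1.1, q.2.2.1 - Real.exp (-lam * q.2.2.2) • q.1.2.1,
      q.2.2.2))

theorem UFormula_eq :
    UFormula (n := n) lam = fun ξ q => Uweight n lam q * ξ (Umap n lam q) := rfl

theorem continuous_Uweight : Continuous (Uweight n lam) := by
  unfold Uweight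
  have h1 := continuous_e
  have h2 := continuous_eta lam
  have h3 := @continuous_beta n
  refine Continuous.mul (by fun_prop) (Complex.continuous_conj.comp (h1.comp (Continuous.mul
    (by fun_prop) (h3.comp (Continuous.prodMk (by fun_prop) (by fun_prop))))))

theorem continuous_Umap : Continuous (Umap n lam) := by
  unfold Umap
  fun_prop

/-- For fixed `p'` the first point moves by the flow at time `-r'`, whose density is exactly the
squared weight. Afterwards, for a fixed first point, the second is only translated, which preserves
Lebesgue measure. -/
theorem lintegral_Umap (g : Pt n × Pt n → ℝ≥0∞) (hg : Measurable g) :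
    ∫⁻ q, ‖Uweight n lam q‖ₑ ^ 2 * g (Umap n lam q) = ∫⁻ q, g q := by
  have hw : ∀ q : Pt n × Pt n, ‖Uweight n lam q‖ₑ = ‖(sys n lam).w (-q.2.2.2)‖ₑ := fun q => by
    have h1 : ‖Uweight n lam q‖ = ‖(sys n lam).w (-q.2.2.2)‖ := by
      unfold Uweight
      rw [norm_mul, RCLike.norm_conj, norm_e, mul_one, neg_mul, ← mul_neg]
      rfl
    rw [← ofReal_norm, h1, ofReal_norm]
  have hU : ∀ q : Pt n × Pt n, Umap n lam q = ((sys n lam).α (-q.2.2.2) q.1,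
      q.2 - (((sys n lam).α (-q.2.2.2) q.1).1, ((sys n lam).α (-q.2.2.2) q.1).2.1, 0)) := fun q => by
    obtain ⟨⟨x, y, r⟩, x', y', r'⟩ := q
    unfold Umap sys
    simp
  have hm := (continuous_Umap n lam).measurable
  have hmw := (continuous_Uweight n lam).measurable
  have hsh : Measurable fun q : Pt n × Pt n => g (q.1, q.2 - (q.1.1, q.1.2.1, 0)) :=
    hg.comp (Continuous.measurable (by fun_prop))
  have hmu : Measurable fun q => ‖Uweight n lam q‖ₑ ^ 2 * g (Umap n lam q) :=
    (hmw.enorm.pow_const 2).mul (hg.comp hm)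
  rw [Measure.volume_eq_prod, lintegral_prod_symm _ hmu.aemeasurable, lintegral_prod _ hg.aemeasurable]
  calc ∫⁻ p', ∫⁻ p, ‖Uweight n lam (p, p')‖ₑ ^ 2 * g (Umap n lam (p, p'))
      = ∫⁻ p', ∫⁻ p : Pt n, g (p, p' - (p.1, p.2.1, 0)) := by
        congr 1
        ext p'
        have hp' : Measurable fun p : Pt n => g (p, p' - (p.1, p.2.1, 0)) :=
          hsh.comp measurable_prodMk_right
        rw [← (sys n lam).flow.scale (-p'.2.2) _ hp']
        congr 1
        ext p
        rw [hw, hU]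
    _ = ∫⁻ p : Pt n, ∫⁻ p', g (p, p' - (p.1, p.2.1, 0)) :=
        (lintegral_lintegral_swap (f := fun p p' : Pt n => g (p, p' - (p.1, p.2.1, 0)))
          hsh.aemeasurable).symm
    _ = _ := by
        congr 1
        ext p
        exact lintegral_sub_right_eq_self (fun p' => g (p, p')) _

/-- Undoing the translation first and the dilation second gives an explicit inverse of `Umap`, and
the inverse weight carries the conjugate phase. -/
theorem U_spec : Measure.QuasiMeasurePreserving (Umap n lam) ∧
    IsGivenBy (UFormula lam) (U n lam) ∧ U n lam ∈ unitary (BHH n) := by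
  have h3 := @continuous_beta n
  have hv : Continuous fun q : Pt n × Pt n => (Real.exp (lam * q.2.2.2) : ℂ) ^ n *
      e (eta lam q.2.2.2 * beta q.1.1 q.2.2.1) := by
    have h1 := continuous_e
    have h2 := continuous_eta lam
    exact Continuous.mul (by fun_prop) (h1.comp (Continuous.mul
      (by fun_prop) (h3.comp (Continuous.prodMk (by fun_prop) (by fun_prop)))))
  have he : ∀ r : ℝ, Real.exp (lam * r) * Real.exp (-lam * r) = 1 := fun r => by
    rw [← Real.exp_add]; simp
  have he' : ∀ r : ℝ, Real.exp (-lam * r) * Real.exp (lam * r) = 1 := fun r => by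
    rw [← Real.exp_add]; simp
  obtain ⟨hq, T, hT, hTu⟩ := exists_unitary_weightedComp (Uweight n lam)
    (fun q : Pt n × Pt n => (Real.exp (lam * q.2.2.2) : ℂ) ^ n *
      e (eta lam q.2.2.2 * beta q.1.1 q.2.2.1)) (Umap n lam)
    (fun q => ((Real.exp (lam * q.2.2.2) • q.1.1, Real.exp (lam * q.2.2.2) • q.1.2.1,
      q.1.2.2 - q.2.2.2), (q.2.1 + q.1.1, q.2.2.1 + q.1.2.1, q.2.2.2)))
    (continuous_Uweight n lam).measurable hv.measurable (continuous_Umap n lam).measurable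
    (Continuous.measurable (by fun_prop))
    (fun q => by
      have := he q.2.2.2
      rw [neg_mul] at this
      simp [Umap, smul_smul, this])
    (fun q => by
      have := he' q.2.2.2
      rw [neg_mul] at this
      simp [Umap, smul_smul, this])
    (fun q => by
      have h4 := conj_e_mul_e (eta lam q.2.2.2 * beta (Real.exp (-lam * q.2.2.2) • q.1.1)
        (q.2.2.1 - Real.exp (-lam * q.2.2.2) • q.1.2.1))
      have h5 : (Real.exp (-lam * q.2.2.2) : ℂ) ^ n * (Real.exp (lam * q.2.2.2) : ℂ) ^ n = 1 := by
        rw [← mul_pow, ← Complex.ofReal_mul, he']; simp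
      unfold Uweight
      simp only [Umap]
      linear_combination (conj (e (eta lam q.2.2.2 * beta (Real.exp (-lam * q.2.2.2) • q.1.1)
        (q.2.2.1 - Real.exp (-lam * q.2.2.2) • q.1.2.1))) *
        e (eta lam q.2.2.2 * beta (Real.exp (-lam * q.2.2.2) • q.1.1)
        (q.2.2.1 - Real.exp (-lam * q.2.2.2) • q.1.2.1))) * h5 + h4)
    (lintegral_Umap n lam)
  have hU : U n lam = T := IsGivenBy.opGivenBy_eq hT
  exact ⟨hq, by rw [hU]; exact hT, by rw [hU]; exact hTu⟩

end U

/-! ### Approximation -/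

/-- An approximate identity, uniformly for a family of functions indexed by a compact set. -/
theorem exists_bump_approx {P W : Type*} [TopologicalSpace P] [NormedAddCommGroup W]
    [NormedSpace ℝ W] [FiniteDimensional ℝ W] [MeasureSpace W] [BorelSpace W]
    [(volume : Measure W).IsAddHaarMeasure] {H : P × W → ℂ} (hH : Continuous H) {K : Set P}
    (hK : IsCompact K) (h0 : ∀ q ∉ K, ∀ w, ‖w‖ ≤ 1 → H (q, w) = 0) {ε : ℝ} (hε : 0 < ε) :
    ∃ θ : W → ℝ, Continuous θ ∧ (∀ w, 1 < ‖w‖ → θ w = 0) ∧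
      ∀ q, ‖(∫ w, (θ w : ℂ) * H (q, w)) - H (q, 0)‖ ≤ ε := by
  -- Compactness of `K` makes continuity at `w = 0` uniform in `q`. Outside `K` nothing needs proof
  -- as long as the bump stays in the unit ball, hence the cap by `1` in the radius below.
  have h1 : ∀ᶠ w in nhds (0 : W), ∀ q ∈ K, ‖H (q, w) - H (q, 0)‖ < ε := by
    refine hK.eventually_forall_of_forall_eventually fun q hq => ?_
    have hc : Continuous fun z : W × P => ‖H (z.2, z.1) - H (z.2, 0)‖ := by fun_prop
    exact hc.continuousAt.eventually_lt continuousAt_const (by simpa using hε)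
  obtain ⟨δ, hδ, hδK⟩ := Metric.eventually_nhds_iff.1 h1
  set ρ := min (δ / 2) 1 with hρ
  have hρ0 : 0 < ρ := lt_min (by positivity) one_pos
  let b : ContDiffBump (0 : W) := ⟨ρ / 2, ρ, by positivity, by linarith⟩
  have hcont : Continuous (b.normed volume) := (b.contDiff_normed (n := 0)).continuous
  have hball : ∀ w, b.normed volume w ≠ 0 → ‖w‖ ≤ ρ := fun w hw => by
    have : w ∈ tsupport (b.normed volume) := subset_tsupport _ hw
    rw [b.tsupport_normed_eq] at this
    simpa using this
  have hb : ∀ q w, b.normed volume w ≠ 0 → ‖H (q, w) - H (q, 0)‖ ≤ ε := fun q w hw => by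
    have hw' := hball w hw
    by_cases hq : q ∈ K
    · refine (hδK ?_ q hq).le
      rw [dist_zero_right]
      linarith [min_le_left (δ / 2) 1]
    · rw [h0 q hq w (hw'.trans (min_le_right _ _)), h0 q hq 0 (by simp)]
      simpa using hε.le
  refine ⟨b.normed volume, hcont, fun w hw => ?_, fun q => ?_⟩
  · by_contra hne
    have := (hball w hne).trans (min_le_right _ _)
    linarith
  · have hi1 : Integrable fun w => (b.normed volume w : ℂ) * H (q, w) := by
      refine Continuous.integrable_of_hasCompactSupport (by fun_prop) ?_
      exact (b.hasCompactSupport_normed (μ := volume)).comp_left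
        (g := fun x : ℝ => (x : ℂ)) Complex.ofReal_zero |>.mul_right
    have hi2 : Integrable fun w => (b.normed volume w : ℂ) :=
      b.integrable_normed.ofReal
    have e1 : H (q, 0) = ∫ w, (b.normed volume w : ℂ) * H (q, 0) := by
      rw [integral_mul_const, integral_complex_ofReal, b.integral_normed]; simp
    rw [e1, ← integral_sub hi1 (hi2.mul_const _)]
    calc ‖∫ w, ((b.normed volume w : ℂ) * H (q, w) - (b.normed volume w : ℂ) * H (q, 0))‖
        ≤ ∫ w, b.normed volume w * ε := by
          refine norm_integral_le_of_norm_le (b.integrable_normed.mul_const _)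
            (Eventually.of_forall fun w => ?_)
          have hn := b.nonneg_normed (μ := volume) w
          rw [← mul_sub, norm_mul, Complex.norm_real, Real.norm_of_nonneg hn]
          by_cases hw : b.normed volume w = 0
          · simp [hw]
          · exact mul_le_mul_of_nonneg_left (hb q w hw) hn
      _ = ε := by rw [integral_mul_const, b.integral_normed, one_mul]

/-- Approximation of a function of compact support on a product by sums of products. -/
theorem exists_tensor_approx {A B : Type*} [TopologicalSpace A] [TopologicalSpace B]
    [LocallyCompactSpace A] [T2Space A] [LocallyCompactSpace B] [T2Space B]
    {G : A × B → ℂ} (hG : Continuous G) (hGc : HasCompactSupport G) :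
    ∃ KA : Set A, ∃ KB : Set B, IsCompact KA ∧ IsCompact KB ∧
      (∀ a b, (a ∉ KA ∨ b ∉ KB) → G (a, b) = 0) ∧
      ∀ ε > 0, ∃ (ι : Type) (_ : Fintype ι) (φ : ι → A → ℂ) (ψ : ι → B → ℂ),
        (∀ i, Continuous (φ i) ∧ ∀ a ∉ KA, φ i a = 0) ∧
        (∀ i, Continuous (ψ i) ∧ ∀ b ∉ KB, ψ i b = 0) ∧
        ∀ a b, ‖G (a, b) - ∑ i, φ i a * ψ i b‖ ≤ ε := by
  set K₁ := Prod.fst '' tsupport G with hK₁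
  set K₂ := Prod.snd '' tsupport G with hK₂
  have hc1 : IsCompact K₁ := hGc.isCompact.image continuous_fst
  have hc2 : IsCompact K₂ := hGc.isCompact.image continuous_snd
  -- The functions of a partition of unity spill over `K₁`, so a compact neighbourhood is fixed
  -- first. Since it does not depend on `ε`, all approximants share their supports.
  obtain ⟨KA, hKA, hKK⟩ := exists_compact_superset hc1
  have hz1 : ∀ a b, a ∉ K₁ → G (a, b) = 0 := fun a b ha =>
    image_eq_zero_of_notMem_tsupport fun hm => ha ⟨_, hm, rfl⟩
  have hz2 : ∀ a b, b ∉ K₂ → G (a, b) = 0 := fun a b hb =>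
    image_eq_zero_of_notMem_tsupport fun hm => hb ⟨_, hm, rfl⟩
  refine ⟨KA, K₂, hKA, hc2, fun a b hab => ?_, fun ε hε => ?_⟩
  · rcases hab with h | h
    · exact hz1 a b fun hm => h (interior_subset (hKK hm))
    · exact hz2 a b h
  -- On `V a` the slices `G (a', ·)` stay within `ε` of `G (a, ·)`, uniformly on `K₂`. A partition
  -- of unity subordinate to finitely many of these sets then averages the slices at the centres.
  let V : A → Set A := fun a => interior KA ∩ interior {a' | ∀ b ∈ K₂, ‖G (a', b) - G (a, b)‖ < ε}
  have hV : ∀ a ∈ K₁, V a ∈ nhds a := fun a ha => by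
    refine inter_mem (isOpen_interior.mem_nhds (hKK ha)) (interior_mem_nhds.2 ?_)
    refine hc2.eventually_forall_of_forall_eventually fun b hb => ?_
    have hc : Continuous fun z : A × B => ‖G (z.1, z.2) - G (a, z.2)‖ := by fun_prop
    exact hc.continuousAt.eventually_lt continuousAt_const (by simpa using hε)
  obtain ⟨t, ht⟩ := hc1.elim_nhds_subcover V hV
  let e := t.equivFin
  obtain ⟨p, hp, hpc⟩ := PartitionOfUnity.exists_isSubordinate_of_locallyFinite_t2space hc1
    (fun i : Fin t.card => V (e.symm i)) (fun i => isOpen_interior.inter isOpen_interior)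
    (locallyFinite_of_finite _) (fun a ha => by
      obtain ⟨x, hx, hax⟩ := Set.mem_iUnion₂.1 (ht.2 ha)
      exact Set.mem_iUnion.2 ⟨e ⟨x, hx⟩, by simpa using hax⟩)
  have hsupp : ∀ i a, p i a ≠ 0 → a ∈ V (e.symm i) := fun i a h =>
    hp i (subset_tsupport _ h)
  refine ⟨Fin t.card, inferInstance, fun i a => (p i a : ℂ), fun i b => G (e.symm i, b),
    fun i => ⟨by fun_prop, fun a ha => ?_⟩, fun i => ⟨by fun_prop, fun b hb => hz2 _ b hb⟩,
    fun a b => ?_⟩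
  · by_contra hne
    exact ha (interior_subset (hsupp i a (by simpa using hne)).1)
  · have e1 : G (a, b) = ∑ i, (p i a : ℂ) * G (a, b) := by
      by_cases ha : a ∈ K₁
      · have := p.sum_eq_one ha
        rw [finsum_eq_sum_of_fintype] at this
        rw [← Finset.sum_mul, ← Complex.ofReal_sum, this]; simp
      · simp [hz1 a b ha]
    have hs : ∑ i, p i a ≤ 1 := by
      have := p.sum_le_one a
      rwa [finsum_eq_sum_of_fintype] at this
    calc ‖G (a, b) - ∑ i, (p i a : ℂ) * G (e.symm i, b)‖
        = ‖∑ i, (p i a : ℂ) * (G (a, b) - G (e.symm i, b))‖ := by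
          simp_rw [mul_sub, Finset.sum_sub_distrib]
          rw [← e1]
      _ ≤ ∑ i, p i a * ε := by
          refine norm_sum_le_of_le _ fun i _ => ?_
          rw [norm_mul, Complex.norm_real, Real.norm_of_nonneg (p.nonneg i a)]
          by_cases hi : p i a = 0
          · simp [hi]
          · refine mul_le_mul_of_nonneg_left ?_ (p.nonneg i a)
            by_cases hb : b ∈ K₂
            · exact (interior_subset (hsupp i a hi).2 b hb).le
            · rw [hz2 _ b hb, hz2 _ b hb]; simpa using hε.le
      _ ≤ ε := by
          rw [← Finset.sum_mul]
          nlinarith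

theorem dense_compactSupport {Y : Type*} [NormedAddCommGroup Y] [NormedSpace ℝ Y]
    [FiniteDimensional ℝ Y] [MeasureSpace Y] [BorelSpace Y]
    [IsFiniteMeasureOnCompacts (volume : Measure Y)] :
    Dense {ζ : Lp ℂ 2 (volume : Measure Y) |
      ∃ g : Y → ℂ, Continuous g ∧ HasCompactSupport g ∧ ζ =ᵐ[volume] g} := by
  refine (Lp.dense_hasCompactSupport_contDiff (E := Y) (F := ℂ) (μ := volume) (p := 2)
    (by norm_num)).mono ?_
  rintro ζ ⟨g, h1, h2, h3⟩
  exact ⟨g, h3.continuous, h2, h1⟩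

/-! ### Elementary tensors -/

section Tensor
variable {n : ℕ}

theorem tvec_coe (ξ η : Hilb n) : tvec ξ η =ᵐ[volume] fun p => ξ p.1 * η p.2 :=
  (memLp_tensor ξ η).coeFn_toLp

theorem ae_fst {P : Pt n → Prop} (h : ∀ᵐ p, P p) : ∀ᵐ q : Pt n × Pt n, P q.1 :=
  Measure.quasiMeasurePreserving_fst.ae h

theorem ae_snd {P : Pt n → Prop} (h : ∀ᵐ p, P p) : ∀ᵐ q : Pt n × Pt n, P q.2 :=
  Measure.quasiMeasurePreserving_snd.ae h

/-- Elementary tensors, as a bilinear map. -/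
noncomputable def tvecₗ (n : ℕ) : Hilb n →ₗ[ℂ] Hilb n →ₗ[ℂ] Hilb2 n :=
  LinearMap.mk₂ ℂ tvec
    (fun ξ ξ' η => by
      refine Lp.ext ?_
      filter_upwards [tvec_coe (ξ + ξ') η, tvec_coe ξ η, tvec_coe ξ' η,
        Lp.coeFn_add (tvec ξ η) (tvec ξ' η), ae_fst (Lp.coeFn_add ξ ξ')] with q h1 h2 h3 h4 h5
      rw [h1, h4, Pi.add_apply, h2, h3, h5, Pi.add_apply, add_mul])
    (fun c ξ η => by
      refine Lp.ext ?_
      filter_upwards [tvec_coe (c • ξ) η, tvec_coe ξ η,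
        Lp.coeFn_smul c (tvec ξ η), ae_fst (Lp.coeFn_smul c ξ)] with q h1 h2 h4 h5
      rw [h1, h4, Pi.smul_apply, h2, h5, Pi.smul_apply, smul_eq_mul, smul_eq_mul, mul_assoc])
    (fun ξ η η' => by
      refine Lp.ext ?_
      filter_upwards [tvec_coe ξ (η + η'), tvec_coe ξ η, tvec_coe ξ η',
        Lp.coeFn_add (tvec ξ η) (tvec ξ η'), ae_snd (Lp.coeFn_add η η')] with q h1 h2 h3 h4 h5
      rw [h1, h4, Pi.add_apply, h2, h3, h5, Pi.add_apply, mul_add])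
    (fun c ξ η => by
      refine Lp.ext ?_
      filter_upwards [tvec_coe ξ (c • η), tvec_coe ξ η,
        Lp.coeFn_smul c (tvec ξ η), ae_snd (Lp.coeFn_smul c η)] with q h1 h2 h4 h5
      rw [h1, h4, Pi.smul_apply, h2, h5, Pi.smul_apply, smul_eq_mul, smul_eq_mul, mul_left_comm])

theorem inner_tvec (ξ η ξ' η' : Hilb n) :
    inner ℂ (tvec ξ η) (tvec ξ' η') = inner ℂ ξ ξ' * inner ℂ η η' := by
  rw [L2.inner_def, L2.inner_def, L2.inner_def, ← integral_prod_mul]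
  refine integral_congr_ae ?_
  filter_upwards [tvec_coe ξ η, tvec_coe ξ' η'] with q h1 h2
  rw [h1, h2]
  simp only [RCLike.inner_apply, map_mul]
  ring

open scoped TensorProduct in
/-- The isometric embedding of the algebraic tensor product. -/
noncomputable def tvecIsom (n : ℕ) : (Hilb n ⊗[ℂ] Hilb n) →ₗᵢ[ℂ] Hilb2 n :=
  (TensorProduct.lift (tvecₗ n)).isometryOfInner fun x y => by
    induction x with
    | zero => simp
    | add x x' hx hx' => rw [map_add, inner_add_left, inner_add_left, hx, hx']
    | tmul ξ η =>
      induction y with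
      | zero => simp
      | add x x' hx hx' => rw [map_add, inner_add_right, inner_add_right, hx, hx']
      | tmul ξ' η' =>
        rw [TensorProduct.inner_tmul]
        exact inner_tvec ξ η ξ' η'

theorem tvecIsom_tmul (ξ η : Hilb n) : tvecIsom n (ξ ⊗ₜ[ℂ] η) = tvec ξ η := rfl

theorem norm_tvec (ξ η : Hilb n) : ‖tvec ξ η‖ = ‖ξ‖ * ‖η‖ := by
  rw [← tvecIsom_tmul, LinearIsometry.norm_map, TensorProduct.norm_tmul]

theorem eLpNorm_le_of_compact {Y : Type*} [MeasureSpace Y] {f : Y → ℂ} {K : Set Y}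
    (hK : MeasurableSet K) {ε : ℝ} (h0 : ∀ p ∉ K, f p = 0) (hε : ∀ p, ‖f p‖ ≤ ε) :
    eLpNorm f 2 volume ≤ volume K ^ (2 : ℝ)⁻¹ * ENNReal.ofReal ε := by
  have : f = K.indicator f := by
    ext p
    by_cases hp : p ∈ K <;> simp [hp, h0]
  rw [this, eLpNorm_indicator_eq_eLpNorm_restrict hK]
  refine (eLpNorm_le_of_ae_bound (Eventually.of_forall hε)).trans (le_of_eq ?_)
  simp

/-- Functions in `C_c` are dense in `L²`, and uniform approximation by sums of products over a fixed
compact set is `L²` approximation. -/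
theorem denseRange_tvecIsom (n : ℕ) : DenseRange (tvecIsom n) := by
  have hcl : Dense (closure (Set.range (tvecIsom n))) := by
    refine dense_compactSupport.mono ?_
    rintro ζ ⟨g, hg, hgc, hζ⟩
    obtain ⟨KA, KB, hKA, hKB, hg0, happ⟩ := exists_tensor_approx hg hgc
    rw [Metric.mem_closure_iff]
    intro ε hε
    have hKc := hKA.prod hKB
    set v := ((volume (KA ×ˢ KB)) ^ (2 : ℝ)⁻¹).toReal with hv
    have hvf : (volume (KA ×ˢ KB)) ^ (2 : ℝ)⁻¹ ≠ ⊤ :=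
      ENNReal.rpow_ne_top_of_nonneg (by norm_num) hKc.measure_lt_top.ne
    have hv0 : 0 ≤ v := ENNReal.toReal_nonneg
    obtain ⟨ι, hι, φ, ψ, hφ, hψ, hd⟩ := happ (ε / (v + 1)) (by positivity)
    have mφ : ∀ i, MemLp (φ i) 2 volume := fun i =>
      (hφ i).1.memLp_of_hasCompactSupport (HasCompactSupport.intro hKA (hφ i).2)
    have mψ : ∀ i, MemLp (ψ i) 2 volume := fun i =>
      (hψ i).1.memLp_of_hasCompactSupport (HasCompactSupport.intro hKB (hψ i).2)
    refine ⟨_, ⟨∑ i, (mφ i).toLp ⊗ₜ[ℂ] (mψ i).toLp, rfl⟩, ?_⟩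
    rw [map_sum, dist_eq_norm, Lp.norm_def]
    have hae : (ζ - ∑ i, tvecIsom n ((mφ i).toLp ⊗ₜ[ℂ] (mψ i).toLp) : Hilb2 n) =ᵐ[volume]
        fun q => g q - ∑ i, φ i q.1 * ψ i q.2 := by
      have h1 : ∀ᵐ q : Pt n × Pt n, ∀ i, tvec (mφ i).toLp (mψ i).toLp q = φ i q.1 * ψ i q.2 := by
        rw [ae_all_iff]
        intro i
        filter_upwards [tvec_coe (mφ i).toLp (mψ i).toLp, ae_fst (mφ i).coeFn_toLp,
          ae_snd (mψ i).coeFn_toLp] with q h1 h2 h3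
        rw [h1, h2, h3]
      filter_upwards [Lp.coeFn_sub ζ (∑ i, tvecIsom n ((mφ i).toLp ⊗ₜ[ℂ] (mψ i).toLp)), hζ, h1,
        Lp.coeFn_finsetSum (Finset.univ : Finset ι)
          (fun i => tvecIsom n ((mφ i).toLp ⊗ₜ[ℂ] (mψ i).toLp))] with q h2 h3 h4 h5
      rw [h2, Pi.sub_apply, h3, h5, Finset.sum_apply]
      simp only [tvecIsom_tmul, h4]
    rw [eLpNorm_congr_ae hae]
    have hle := eLpNorm_le_of_compact (f := fun q : Pt n × Pt n => g q - ∑ i, φ i q.1 * ψ i q.2)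
      hKc.measurableSet (ε := ε / (v + 1)) (fun q hq => by
        rw [Set.mem_prod, not_and_or] at hq
        rw [hg0 q.1 q.2 hq, zero_sub, neg_eq_zero]
        refine Finset.sum_eq_zero fun i _ => ?_
        rcases hq with h | h
        · rw [(hφ i).2 _ h, zero_mul]
        · rw [(hψ i).2 _ h, mul_zero]) (fun q => hd q.1 q.2)
    have := ENNReal.toReal_mono (ENNReal.mul_ne_top hvf ENNReal.ofReal_ne_top) hle
    rw [ENNReal.toReal_mul, ENNReal.toReal_ofReal (by positivity), ← hv] at this
    refine this.trans_lt ?_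
    rw [← mul_div_assoc, div_lt_iff₀ (by positivity)]
    nlinarith
  rw [DenseRange, ← dense_closure]
  exact hcl

end Tensor

/-! ### Norm bounds on the algebraic tensor product of operators. -/

section TensorMap
open scoped TensorProduct

variable {H : Type*} [NormedAddCommGroup H] [InnerProductSpace ℂ H] [CompleteSpace H]

theorem inner_map_id (a b : H →L[ℂ] H) (s t : H ⊗[ℂ] H) :
    inner ℂ (TensorProduct.map (a : H →ₗ[ℂ] H) LinearMap.id s)
      (TensorProduct.map (b : H →ₗ[ℂ] H) LinearMap.id t) =
    inner ℂ s (TensorProduct.map ((star a * b : H →L[ℂ] H) : H →ₗ[ℂ] H) LinearMap.id t) := by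
  induction s with
  | zero => simp
  | add x x' hx hx' => rw [map_add, inner_add_left, inner_add_left, hx, hx']
  | tmul ξ η =>
    induction t with
    | zero => simp
    | add x x' hx hx' => rw [map_add, map_add, inner_add_right, inner_add_right, hx, hx']
    | tmul ξ' η' =>
      simp only [TensorProduct.map_tmul, TensorProduct.inner_tmul, LinearMap.id_apply,
        ContinuousLinearMap.coe_coe, mul_apply_eq_comp]
      rw [ContinuousLinearMap.star_eq_adjoint, ContinuousLinearMap.adjoint_inner_right]

/-- Positivity of `‖a‖² - a*a` provides `c` with `c*c = ‖a‖² - a*a`, and then `‖(a ⊗ 1)t‖² + ‖(c ⊗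
1)t‖² = ‖a‖² ‖t‖²`. -/
theorem norm_map_id_le (a : H →L[ℂ] H) (t : H ⊗[ℂ] H) :
    ‖TensorProduct.map (a : H →ₗ[ℂ] H) LinearMap.id t‖ ≤ ‖a‖ * ‖t‖ := by
  have h0 : 0 ≤ algebraMap ℝ (H →L[ℂ] H) (‖a‖ ^ 2) - star a * a :=
    sub_nonneg.2 CStarAlgebra.star_mul_le_algebraMap_norm_sq
  obtain ⟨c, hc⟩ := CStarAlgebra.nonneg_iff_eq_star_mul_self.1 h0
  have h1 : ‖TensorProduct.map (a : H →ₗ[ℂ] H) LinearMap.id t‖ ^ 2 +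
      ‖TensorProduct.map (c : H →ₗ[ℂ] H) LinearMap.id t‖ ^ 2 = ‖a‖ ^ 2 * ‖t‖ ^ 2 := by
    rw [← inner_self_eq_norm_sq (𝕜 := ℂ), ← inner_self_eq_norm_sq (𝕜 := ℂ),
      ← inner_self_eq_norm_sq (𝕜 := ℂ) t, inner_map_id, inner_map_id, ← map_add,
      ← inner_add_right (𝕜 := ℂ) t (TensorProduct.map ((star a * a : H →L[ℂ] H) : H →ₗ[ℂ] H)
        LinearMap.id t), ← LinearMap.add_apply, ← TensorProduct.map_add_left, ← ContinuousLinearMap.toLinearMap_add,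
      ← hc, add_sub_cancel]
    have : ((algebraMap ℝ (H →L[ℂ] H) (‖a‖ ^ 2) : H →L[ℂ] H) : H →ₗ[ℂ] H) =
        ((‖a‖ ^ 2 : ℝ) : ℂ) • LinearMap.id := by
      ext x
      rw [Algebra.algebraMap_eq_smul_one]
      exact (Complex.coe_smul _ _).symm
    rw [this, TensorProduct.map_smul_left, TensorProduct.map_id, LinearMap.smul_apply,
      LinearMap.id_apply, inner_smul_right]
    simp only [RCLike.re_to_complex, Complex.re_ofReal_mul]
  nlinarith [norm_nonneg (TensorProduct.map (a : H →ₗ[ℂ] H) LinearMap.id t), norm_nonneg a,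
    norm_nonneg t, sq_nonneg ‖TensorProduct.map (c : H →ₗ[ℂ] H) LinearMap.id t‖,
    mul_nonneg (norm_nonneg a) (norm_nonneg t), abs_le_of_sq_le_sq'
      (show ‖TensorProduct.map (a : H →ₗ[ℂ] H) LinearMap.id t‖ ^ 2 ≤ (‖a‖ * ‖t‖) ^ 2 by
        rw [mul_pow, ← h1]; nlinarith [sq_nonneg
          ‖TensorProduct.map (c : H →ₗ[ℂ] H) LinearMap.id t‖])
      (mul_nonneg (norm_nonneg a) (norm_nonneg t))]

/-- `a ⊗ b` factors through `b ⊗ 1` and `a ⊗ 1` with flips in between, and the flip is isometric. -/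
theorem norm_map_le (a b : H →L[ℂ] H) (t : H ⊗[ℂ] H) :
    ‖TensorProduct.map (a : H →ₗ[ℂ] H) (b : H →ₗ[ℂ] H) t‖ ≤ ‖a‖ * ‖b‖ * ‖t‖ := by
  have h1 : TensorProduct.map (a : H →ₗ[ℂ] H) (b : H →ₗ[ℂ] H) t =
      TensorProduct.map (a : H →ₗ[ℂ] H) LinearMap.id (TensorProduct.comm ℂ H H
        (TensorProduct.map (b : H →ₗ[ℂ] H) LinearMap.id (TensorProduct.comm ℂ H H t))) := by
    induction t with
    | zero => simp
    | add x y hx hy => simp only [map_add, hx, hy]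
    | tmul x y => simp
  rw [h1]
  refine (norm_map_id_le _ _).trans ?_
  rw [TensorProduct.norm_comm, mul_assoc]
  refine mul_le_mul_of_nonneg_left ((norm_map_id_le _ _).trans ?_) (norm_nonneg _)
  rw [TensorProduct.norm_comm]

end TensorMap

/-! ### The operators `a ⊗ b` on `H ⊗ H`. -/

section OpTensor
variable {n : ℕ}

open scoped TensorProduct in
theorem exists_opTensor (a b : BH n) : ∃ T, IsOpTensor a b T ∧ ‖T‖ ≤ ‖a‖ * ‖b‖ := by
  let J := tvecIsom n
  let M : Hilb n ⊗[ℂ] Hilb n →L[ℂ] Hilb2 n :=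
    (J.toLinearMap ∘ₗ TensorProduct.map (a : Hilb n →ₗ[ℂ] Hilb n)
      (b : Hilb n →ₗ[ℂ] Hilb n)).mkContinuous (‖a‖ * ‖b‖) fun t => by
        rw [LinearMap.comp_apply]
        change ‖J _‖ ≤ _
        rw [J.norm_map]
        exact norm_map_le a b t
  have hM : ‖M‖ ≤ ‖a‖ * ‖b‖ := LinearMap.mkContinuous_norm_le _ (by positivity) _
  have hd : DenseRange J.toContinuousLinearMap := denseRange_tvecIsom n
  refine ⟨M.extend J.toContinuousLinearMap, fun ξ η => ?_, ?_⟩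
  · have := M.extend_eq hd J.isometry.isUniformInducing (ξ ⊗ₜ[ℂ] η)
    exact this
  · refine (M.opNorm_extend_le (N := 1) hd fun x => ?_).trans ?_
    · simp [J.norm_map]
    · simpa using hM

theorem isOpTensor_opTensor (a b : BH n) : IsOpTensor a b (opTensor a b) := by
  have h : ∃ T, IsOpTensor a b T := (exists_opTensor a b).imp fun _ h => h.1
  unfold opTensor
  rw [dif_pos h]
  exact h.choose_spec

theorem ext_tvec {S T : BHH n} (h : ∀ ξ η, S (tvec ξ η) = T (tvec ξ η)) : S = T := by
  have h1 : (S : Hilb2 n → Hilb2 n) = T := by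
    refine (denseRange_tvecIsom n).equalizer S.continuous T.continuous (funext fun t => ?_)
    induction t with
    | zero => simp
    | add x y hx hy =>
      simp only [Function.comp_apply, map_add] at hx hy ⊢
      rw [hx, hy]
    | tmul x y => exact h x y
  exact DFunLike.coe_injective h1

theorem IsOpTensor.eq_opTensor {a b : BH n} {T : BHH n} (h : IsOpTensor a b T) :
    T = opTensor a b :=
  ext_tvec fun ξ η => (h ξ η).trans (isOpTensor_opTensor a b ξ η).symm

theorem norm_opTensor_le (a b : BH n) : ‖opTensor a b‖ ≤ ‖a‖ * ‖b‖ := by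
  obtain ⟨T, hT, hn⟩ := exists_opTensor a b
  rwa [← hT.eq_opTensor]

theorem tvec_add_left (ξ ξ' η : Hilb n) : tvec (ξ + ξ') η = tvec ξ η + tvec ξ' η :=
  LinearMap.map_add₂ (tvecₗ n) ξ ξ' η

theorem tvec_add_right (ξ η η' : Hilb n) : tvec ξ (η + η') = tvec ξ η + tvec ξ η' :=
  map_add (tvecₗ n ξ) η η'

theorem tvec_smul_left (c : ℂ) (ξ η : Hilb n) : tvec (c • ξ) η = c • tvec ξ η :=
  LinearMap.map_smul₂ (tvecₗ n) c ξ η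

theorem tvec_smul_right (c : ℂ) (ξ η : Hilb n) : tvec ξ (c • η) = c • tvec ξ η :=
  map_smul (tvecₗ n ξ) c η

theorem opTensor_mul (a b a' b' : BH n) :
    opTensor (a * a') (b * b') = opTensor a b * opTensor a' b' := by
  refine (IsOpTensor.eq_opTensor fun ξ η => ?_).symm
  rw [mul_apply_eq_comp, isOpTensor_opTensor, isOpTensor_opTensor]
  rfl

theorem opTensor_star (a b : BH n) : star (opTensor a b) = opTensor (star a) (star b) := by
  refine ext_tvec fun ξ η => ?_
  rw [isOpTensor_opTensor]
  refine (denseRange_tvecIsom n).eq_of_inner_right ℂ fun t => ?_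
  induction t with
  | zero => simp
  | add x y hx hy => rw [map_add, inner_add_left, inner_add_left, hx, hy]
  | tmul x y =>
    rw [ContinuousLinearMap.star_eq_adjoint, ContinuousLinearMap.adjoint_inner_right, tvecIsom_tmul,
      isOpTensor_opTensor, inner_tvec, inner_tvec, ContinuousLinearMap.star_eq_adjoint,
      ContinuousLinearMap.star_eq_adjoint, ContinuousLinearMap.adjoint_inner_right,
      ContinuousLinearMap.adjoint_inner_right]

/-- `(a, b) ↦ a ⊗ b` as a bounded bilinear map. -/
noncomputable def opTensorL (n : ℕ) : BH n →L[ℂ] BH n →L[ℂ] BHH n :=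
  LinearMap.mkContinuous₂ (LinearMap.mk₂ ℂ opTensor
    (fun a a' b => (IsOpTensor.eq_opTensor fun ξ η => by
      rw [add_apply, add_apply, isOpTensor_opTensor, isOpTensor_opTensor, tvec_add_left]).symm)
    (fun c a b => (IsOpTensor.eq_opTensor fun ξ η => by
      rw [smul_apply, smul_apply, isOpTensor_opTensor, tvec_smul_left]).symm)
    (fun a b b' => (IsOpTensor.eq_opTensor fun ξ η => by
      rw [add_apply, add_apply, isOpTensor_opTensor, isOpTensor_opTensor, tvec_add_right]).symm)
    (fun c a b => (IsOpTensor.eq_opTensor fun ξ η => by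
      rw [smul_apply, smul_apply, isOpTensor_opTensor, tvec_smul_right]).symm)) 1
    fun a b => by rw [one_mul]; exact norm_opTensor_le a b

/-! ### Kernel operators and tensor products -/

instance instSigmaFinitePt (n : ℕ) : SigmaFinite (volume : Measure (Pt n)) := inferInstance

instance instSigmaFinitePt2 (n : ℕ) : SigmaFinite (volume : Measure (Pt n × Pt n)) :=
  Measure.instSigmaFiniteProdVolume

instance instIsAddHaarPlane : (volume : Measure (ℝ × ℝ)).IsAddHaarMeasure :=
  isAddHaar_volume_prod _ _

instance instIsAddHaarZt (n : ℕ) : (volume : Measure (Zt n)).IsAddHaarMeasure :=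
  isAddHaar_volume_prod _ _

variable {lam : ℝ}

/-- The tensor product of two kernels. -/
def kerTensor (f g : Zt n × ℝ → ℂ) : (Zt n × Zt n) × (ℝ × ℝ) → ℂ :=
  fun q => f (q.1.1, q.2.1) * g (q.1.2, q.2.2)

theorem isKer_kerTensor {f g : Zt n × ℝ → ℂ} {K L : Set ℝ} {C C' : ℝ} (hC : 0 ≤ C)
    (hf : IsKer f K C) (hg : IsKer g L C') :
    IsKer (kerTensor f g) (K ×ˢ L) (C * C') := by
  have h1 := hf.cont
  have h2 := hg.cont
  refine ⟨by unfold kerTensor; fun_prop, hf.compact.prod hg.compact, fun z s => ?_⟩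
  by_cases hs1 : s.1 ∈ K
  · by_cases hs2 : s.2 ∈ L
    · have b1 := hf.bound z.1 s.1
      have b2 := hg.bound z.2 s.2
      rw [Set.indicator_of_mem hs1] at b1
      rw [Set.indicator_of_mem hs2] at b2
      have hs : s ∈ K ×ˢ L := ⟨hs1, hs2⟩
      rw [Set.indicator_of_mem hs]
      unfold kerTensor
      rw [norm_mul]
      exact mul_le_mul b1 b2 (norm_nonneg _) hC
    · have : s ∉ K ×ˢ L := fun h => hs2 h.2
      simp [kerTensor, hg.eq_zero _ hs2, this]
  · have : s ∉ K ×ˢ L := fun h => hs1 h.1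
    simp [kerTensor, hf.eq_zero _ hs1, this]

theorem opTensor_op {f g : Zt n × ℝ → ℂ} {K L : Set ℝ} {C C' : ℝ} (hC : 0 ≤ C)
    (hf : IsKer f K C) (hg : IsKer g L C') :
    opTensor ((sys n lam).op f) ((sys n lam).op g) = (sys2 n lam).op (kerTensor f g) := by
  refine (IsOpTensor.eq_opTensor fun ξ η => Lp.ext ?_).symm
  have hfg := isKer_kerTensor hC hf hg
  filter_upwards [System.isGivenBy_op (D := sys2 n lam) hfg (tvec ξ η),
    (sys2 n lam).flow.ae_ae (tvec_coe ξ η),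
    tvec_coe ((sys n lam).op f ξ) ((sys n lam).op g η),
    ae_fst (System.isGivenBy_op (D := sys n lam) hf ξ),
    ae_snd (System.isGivenBy_op (D := sys n lam) hg η)] with q h1 h2 h3 h4 h5
  rw [h1, h3, h4, h5]
  unfold kerFormula
  rw [← integral_prod_mul, ← Measure.volume_eq_prod]
  refine integral_congr_ae ?_
  filter_upwards [h2] with s hs
  rw [hs]
  simp only [sys2, System.prod, kerTensor]
  ring

theorem continuous_addMonoidHom_inr : Continuous (AddMonoidHom.inr ℝ ℝ) :=
  continuous_const.prodMk continuous_id

/-- The kernel of `1 ⊗ ρ_f`. -/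
def kerRight (f : Zt n × ℝ → ℂ) : (Zt n × Zt n) × ℝ → ℂ := fun q => f (q.1.2, q.2)

theorem isKer_kerRight {f : Zt n × ℝ → ℂ} {K : Set ℝ} {C : ℝ} (hf : IsKer f K C) :
    IsKer (kerRight f) K C := by
  have h1 := hf.cont
  exact ⟨by unfold kerRight; fun_prop, hf.compact, fun z s => hf.bound _ _⟩

/-- The factor `1` integrates over nothing, so the acting group is only the second copy of `ℝ`;
relative to `sys2` the kernel would contain a delta function. -/
theorem opTensor_one_op {f : Zt n × ℝ → ℂ} {K : Set ℝ} {C : ℝ} (hf : IsKer f K C) :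
    opTensor 1 ((sys n lam).op f) =
      ((sys2 n lam).comp (AddMonoidHom.inr ℝ ℝ) continuous_addMonoidHom_inr).op (kerRight f) := by
  refine (IsOpTensor.eq_opTensor fun ξ η => Lp.ext ?_).symm
  filter_upwards [System.isGivenBy_op (D := (sys2 n lam).comp (AddMonoidHom.inr ℝ ℝ)
      continuous_addMonoidHom_inr) (isKer_kerRight hf) (tvec ξ η),
    ((sys2 n lam).comp (AddMonoidHom.inr ℝ ℝ) continuous_addMonoidHom_inr).flow.ae_ae
      (tvec_coe ξ η),
    tvec_coe ξ ((sys n lam).op f η),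
    ae_snd (System.isGivenBy_op (D := sys n lam) hf η)] with q h1 h2 h3 h4
  rw [h1, one_apply_eq_self, h3, h4]
  unfold kerFormula
  rw [← integral_const_mul]
  refine integral_congr_ae ?_
  filter_upwards [h2] with s hs
  rw [hs]
  simp only [sys2, System.prod, kerRight, System.comp, AddMonoidHom.inr_apply,
    (sys n lam).α_zero, (sys n lam).w_zero]
  ring

end OpTensor

/-! ### Slices -/

section Slice
variable {n : ℕ}

/-- `ζ ↦ ξ ↦ ζ ⊗ ξ` as a bounded bilinear map. -/
noncomputable def tvecL (n : ℕ) : Hilb n →L[ℂ] Hilb n →L[ℂ] Hilb2 n :=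
  (tvecₗ n).mkContinuous₂ 1 fun ξ η => by
    rw [one_mul]
    exact (norm_tvec ξ η).le

theorem tvecL_apply (ξ η : Hilb n) : tvecL n ξ η = tvec ξ η := rfl

/-- The slice of `T` by the functional `⟨ · ξ, η⟩`. -/
noncomputable def slice (T : BHH n) (ξ η : Hilb n) : BH n :=
  ContinuousLinearMap.adjoint ((tvecL n).flip η) ∘L (T ∘L (tvecL n).flip ξ)

theorem inner_slice (T : BHH n) (ξ η ζ ζ' : Hilb n) :
    inner ℂ ζ' (slice T ξ η ζ) = inner ℂ (tvec ζ' η) (T (tvec ζ ξ)) := by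
  unfold slice
  rw [ContinuousLinearMap.comp_apply, ContinuousLinearMap.adjoint_inner_right]
  rfl

theorem norm_tvecL_flip_le (ξ : Hilb n) : ‖(tvecL n).flip ξ‖ ≤ ‖ξ‖ := by
  refine ContinuousLinearMap.opNorm_le_bound _ (norm_nonneg _) fun ζ => ?_
  rw [ContinuousLinearMap.flip_apply, tvecL_apply, norm_tvec, mul_comm]

theorem norm_slice_le (T : BHH n) (ξ η : Hilb n) : ‖slice T ξ η‖ ≤ ‖T‖ * (‖ξ‖ * ‖η‖) := by
  unfold slice
  calc _ ≤ ‖ContinuousLinearMap.adjoint ((tvecL n).flip η)‖ * (‖T‖ * ‖(tvecL n).flip ξ‖) :=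
        (ContinuousLinearMap.opNorm_comp_le _ _).trans
          (mul_le_mul_of_nonneg_left (ContinuousLinearMap.opNorm_comp_le _ _) (norm_nonneg _))
    _ ≤ ‖η‖ * (‖T‖ * ‖ξ‖) := by
        rw [LinearIsometryEquiv.norm_map]
        have h1 := norm_tvecL_flip_le ξ
        have h2 := norm_tvecL_flip_le η
        gcongr
    _ = _ := by ring

theorem continuous_slice (T : BHH n) : Continuous fun p : Hilb n × Hilb n => slice T p.1 p.2 := by
  unfold slice
  have h1 : Continuous fun p : Hilb n × Hilb n =>
      ContinuousLinearMap.adjoint ((tvecL n).flip p.2) :=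
    ContinuousLinearMap.adjoint.continuous.comp ((tvecL n).flip.continuous.comp continuous_snd)
  have h2 : Continuous fun p : Hilb n × Hilb n => T ∘L (tvecL n).flip p.1 :=
    continuous_const.clm_comp ((tvecL n).flip.continuous.comp continuous_fst)
  exact h1.clm_comp h2

theorem slice_mem_rightSlices (T : BHH n) (ξ η : Hilb n) : slice T ξ η ∈ rightSlices T := by
  refine ⟨fun k => if k = 0 then ξ else 0, fun k => if k = 0 then η else 0,
    summable_of_hasFiniteSupport (Set.Finite.subset (Set.finite_singleton 0) fun k hk => ?_),
    summable_of_hasFiniteSupport (Set.Finite.subset (Set.finite_singleton 0) fun k hk => ?_),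
    fun ζ ζ' => ?_⟩
  · by_contra h
    rw [Set.mem_singleton_iff] at h
    simp [h] at hk
  · by_contra h
    rw [Set.mem_singleton_iff] at h
    simp [h] at hk
  · rw [inner_slice]
    have := hasSum_single (f := fun k : ℕ => inner ℂ (tvec ζ' (if k = 0 then η else 0))
      (T (tvec ζ (if k = 0 then ξ else 0)))) 0 fun k hk => by
        simp only [hk, if_false]
        have h0 : tvec ζ (0 : Hilb n) = 0 := map_zero (tvecL n ζ)
        rw [h0, map_zero, inner_zero_right]
    simpa using this

/-- The series defining a slice is given only weakly, but `‖ξ k‖ ‖η k‖` is dominated by a summable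
sequence, so the vector slices sum in norm, and to the same operator. -/
theorem rightSlices_subset (T : BHH n) (A : AddSubmonoid (BH n)) (hA : IsClosed (A : Set (BH n)))
    (h : ∀ ξ η, slice T ξ η ∈ A) : rightSlices T ⊆ A := by
  rintro S ⟨ξ, η, hξ, hη, hS⟩
  have hsum : Summable fun k => slice T (ξ k) (η k) := by
    refine Summable.of_norm_bounded (g := fun k => ‖T‖ * (‖ξ k‖ ^ 2 + ‖η k‖ ^ 2))
      ((hξ.add hη).mul_left _) fun k => (norm_slice_le _ _ _).trans ?_
    refine mul_le_mul_of_nonneg_left ?_ (norm_nonneg _)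
    nlinarith [sq_nonneg (‖ξ k‖ - ‖η k‖), sq_nonneg ‖ξ k‖, sq_nonneg ‖η k‖]
  have hST : HasSum (fun k => slice T (ξ k) (η k)) S := by
    have h1 := hsum.hasSum
    have h2 : S = ∑' k, slice T (ξ k) (η k) := by
      ext1 ζ
      refine ext_inner_left ℂ fun ζ' => ?_
      have h3 := h1.mapL ((innerSL ℂ ζ').comp (ContinuousLinearMap.apply ℂ (Hilb n) ζ))
      refine (hS ζ ζ').unique ?_
      simpa only [ContinuousLinearMap.comp_apply, ContinuousLinearMap.apply_apply,
        innerSL_apply_apply, inner_slice] using h3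
    rwa [h2]
  exact hA.mem_of_tendsto hST (Eventually.of_forall fun s => sum_mem fun k _ => h _ _)

end Slice

/-! ### Slices of `U_A` as kernel operators. -/

section SliceU
variable {n : ℕ} {lam : ℝ}

/-- The sign is changed because `U_A` shifts `r` by `+r'` while the flow shifts it by `-s`;
integration over `r'` becomes integration over the flow time `s = -r'`. -/
theorem integral_Pt_eq {Φ : Pt n → ℂ} (hΦ : Integrable Φ) :
    ∫ p, Φ p = ∫ s : ℝ, ∫ z : Zt n, Φ (z.1, z.2, -s) := by
  have hmp : MeasurePreserving (MeasurableEquiv.prodAssoc :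
      (EuclideanSpace ℝ (Fin n) × EuclideanSpace ℝ (Fin n)) × ℝ ≃ᵐ Pt n) :=
    volume_preserving_prodAssoc
  rw [← hmp.integral_comp']
  have hi := (hmp.integrable_comp_emb (MeasurableEquiv.measurableEmbedding _)).2 hΦ
  rw [Measure.volume_eq_prod] at hi ⊢
  rw [integral_prod_symm (fun x : Zt n × ℝ => Φ (MeasurableEquiv.prodAssoc x)) hi]
  exact (integral_neg_eq_self
    (fun s : ℝ => ∫ z : Zt n, Φ (MeasurableEquiv.prodAssoc (z, s))) volume).symm

/-- The phase in `U_A`, as a function of `((x, y), s)` and `(x', y')`. -/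
noncomputable def slicePhase (lam : ℝ) (q : (Zt n × ℝ) × Zt n) : ℂ :=
  conj (e (eta lam (-q.1.2) * beta ((sys n lam).γ q.1.2 q.1.1).1
    (q.2.2 - ((sys n lam).γ q.1.2 q.1.1).2)))

/-- The integrand of the kernel of a slice. -/
noncomputable def sliceIntegrand (lam : ℝ) (g : Zt n × ℝ → ℂ) (q : (Zt n × ℝ) × Zt n) : ℂ :=
  slicePhase lam q * g (q.2 - (sys n lam).γ q.1.2 q.1.1, -q.1.2)

/-- The kernel of a slice. -/
noncomputable def sliceKer (lam : ℝ) (g h : Zt n × ℝ → ℂ) (q : Zt n × ℝ) : ℂ :=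
  ∫ z' : Zt n, conj (h (z', -q.2)) * sliceIntegrand lam g (q, z')

theorem continuous_γ_comp {P : Type*} [TopologicalSpace P] {a : P → ℝ} {b : P → Zt n}
    (ha : Continuous a) (hb : Continuous b) : Continuous fun p => (sys n lam).γ (a p) (b p) :=
  (sys n lam).γ_cont.comp (ha.prodMk hb)

theorem continuous_sliceIntegrand {g : Zt n × ℝ → ℂ} (hg : Continuous g) :
    Continuous (sliceIntegrand lam g) := by
  have hγ : Continuous fun q : (Zt n × ℝ) × Zt n => (sys n lam).γ q.1.2 q.1.1 :=
    continuous_γ_comp (by fun_prop) (by fun_prop)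
  have h1 := continuous_e
  have h2 := continuous_eta lam
  have h3 := @continuous_beta n
  unfold sliceIntegrand slicePhase
  refine Continuous.mul (Complex.continuous_conj.comp (h1.comp (Continuous.mul
    (by fun_prop) (h3.comp (hγ.fst.prodMk ?_))))) ?_
  · exact continuous_snd.snd.sub hγ.snd
  · exact hg.comp ((continuous_snd.sub hγ).prodMk (by fun_prop))

theorem sliceIntegrand_support {g : Zt n × ℝ → ℂ} (hgc : HasCompactSupport g) {L : Set (Zt n)}
    (hL : IsCompact L) : ∃ M : Set (Zt n × ℝ), IsCompact M ∧
      ∀ q ∉ M, ∀ z' ∈ L, sliceIntegrand lam g (q, z') = 0 := by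
  refine ⟨(fun p : Zt n × (Zt n × ℝ) => ((sys n lam).γ p.2.2 (p.1 - p.2.1), -p.2.2)) ''
    (L ×ˢ tsupport g), (hL.prod hgc.isCompact).image ?_, fun q hq z' hz' => ?_⟩
  · exact (continuous_γ_comp (by fun_prop) (by fun_prop)).prodMk (by fun_prop)
  · have : (z' - (sys n lam).γ q.2 q.1, -q.2) ∉ tsupport g := fun hm => hq
      ⟨(z', (z' - (sys n lam).γ q.2 q.1, -q.2)), ⟨hz', hm⟩, by
        simp only [sub_sub_cancel, neg_neg, (sys n lam).γ_add, add_neg_cancel,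
          (sys n lam).γ_zero]⟩
    unfold sliceIntegrand
    rw [image_eq_zero_of_notMem_tsupport this, mul_zero]

theorem sliceKer_spec {g h : Zt n × ℝ → ℂ} (hg : Continuous g) (hgc : HasCompactSupport g)
    (hh : Continuous h) (hhc : HasCompactSupport h) :
    Continuous (sliceKer lam g h) ∧ HasCompactSupport (sliceKer lam g h) := by
  have hi := continuous_sliceIntegrand (lam := lam) hg
  have hLc : IsCompact (Prod.fst '' tsupport h) := hhc.isCompact.image continuous_fst
  have h0 : ∀ z' ∉ Prod.fst '' tsupport h, ∀ s, h (z', s) = 0 := fun z' hz s =>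
    image_eq_zero_of_notMem_tsupport fun hm => hz ⟨_, hm, rfl⟩
  constructor
  · have e1 : sliceKer lam g h = fun q => ∫ z' in Prod.fst '' tsupport h,
        conj (h (z', -q.2)) * sliceIntegrand lam g (q, z') := by
      ext q
      refine (setIntegral_eq_integral_of_forall_compl_eq_zero fun z' hz => ?_).symm
      rw [h0 z' hz, map_zero, zero_mul]
    rw [e1]
    refine continuous_parametric_integral_of_continuous (f := fun (q : Zt n × ℝ) (z' : Zt n) =>
      conj (h (z', -q.2)) * sliceIntegrand lam g (q, z')) ?_ hLc
    exact (Complex.continuous_conj.comp (hh.comp (by fun_prop))).mul hi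
  · obtain ⟨M, hM, hM0⟩ := sliceIntegrand_support (lam := lam) hgc hLc
    refine HasCompactSupport.intro hM fun q hq => ?_
    unfold sliceKer
    refine integral_eq_zero_of_ae (Eventually.of_forall fun z' => ?_)
    by_cases hz : z' ∈ Prod.fst '' tsupport h
    · simp only [hM0 q hq z' hz, mul_zero, Pi.zero_apply]
    · simp only [h0 z' hz, map_zero, zero_mul, Pi.zero_apply]

/-- At `r' = -s` the first component of `Umap` is `α_s p`, and the weight is `w(s)` times a phase
depending on `p` only through `π p`. Integrating out `z'` in the matrix coefficient therefore leaves
a kernel operator of the flow. -/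
theorem slice_U {g h : Zt n × ℝ → ℂ} (hg : Continuous g) (hgc : HasCompactSupport g)
    (hh : Continuous h) (hhc : HasCompactSupport h) {ξ η : Hilb n}
    (hξ : ξ =ᵐ[volume] fun p => g ((p.1, p.2.1), p.2.2))
    (hη : η =ᵐ[volume] fun p => h ((p.1, p.2.1), p.2.2)) :
    slice (U n lam) ξ η = (sys n lam).op (sliceKer lam g h) := by
  obtain ⟨hk, hkc⟩ := sliceKer_spec (lam := lam) hg hgc hh hhc
  obtain ⟨K, C, hC, hK⟩ := exists_isKer hk hkc
  obtain ⟨hUq, hU, -⟩ := U_spec n lam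
  ext1 ζ
  refine ext_inner_left ℂ fun ζ' => ?_
  rw [inner_slice, L2.inner_def, L2.inner_def]
  set F : Pt n × Pt n → ℂ := fun q => conj (ζ' q.1) * (conj (h ((q.2.1, q.2.2.1), q.2.2.2)) *
    (Uweight n lam q * (ζ (Umap n lam q).1 * g (((Umap n lam q).2.1, (Umap n lam q).2.2.1),
      (Umap n lam q).2.2.2)))) with hF
  have hae : (fun q => inner ℂ (tvec ζ' η q) (U n lam (tvec ζ ξ) q)) =ᵐ[volume] F := by
    filter_upwards [tvec_coe ζ' η, hU (tvec ζ ξ), hUq.ae (tvec_coe ζ ξ), ae_snd hη,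
      hUq.ae (ae_snd hξ)] with q h1 h2 h3 h4 h5
    rw [h1, h2, UFormula_eq]
    simp only
    rw [h3, h4, h5, RCLike.inner_apply', map_mul, hF]
    ring
  have hint : Integrable F := (L2.integrable_inner (𝕜 := ℂ) _ _).congr hae
  rw [integral_congr_ae hae]
  rw [Measure.volume_eq_prod] at hint ⊢
  rw [integral_prod _ hint]
  refine integral_congr_ae ?_
  filter_upwards [hint.prod_right_ae, System.isGivenBy_op (D := sys n lam) hK ζ] with p h1 h2
  rw [h2, RCLike.inner_apply', integral_Pt_eq h1]
  unfold kerFormula sliceKer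
  rw [← integral_const_mul]
  congr 1
  ext s
  rw [← integral_const_mul, ← integral_mul_const, ← integral_const_mul]
  congr 1
  ext z'
  have hW : Uweight n lam (p, (z'.1, z'.2, -s)) =
      (sys n lam).w s * slicePhase lam (((sys n lam).π p, s), z') := by
    simp only [Uweight, slicePhase, sys, neg_mul_neg]
  have hM : Umap n lam (p, (z'.1, z'.2, -s)) = ((sys n lam).α s p,
      (z' - (sys n lam).γ s ((sys n lam).π p)).1, (z' - (sys n lam).γ s ((sys n lam).π p)).2,
      -s) := by
    simp only [Umap, sys, neg_mul_neg, sub_eq_add_neg]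
    rfl
  simp only [hF, hW, hM, sliceIntegrand]
  ring

end SliceU

/-! ### Three descriptions of `Â`: core, slices and the operators `ρ_f`. -/

section AhatEq
variable {n : ℕ} {lam : ℝ}

theorem hasCompactSupport_unc {f : Pt n → ℂ} (hf : HasCompactSupport f) :
    HasCompactSupport (unc f) :=
  hf.comp_homeomorph (Homeomorph.prodAssoc _ _ _)

theorem continuous_unc {f : Pt n → ℂ} (hf : Continuous f) : Continuous (unc f) := by
  unfold unc
  fun_prop

/-- A kernel as a function of `(x, y, r)`. -/
def cur {n : ℕ} (f : Zt n × ℝ → ℂ) : Pt n → ℂ := fun p => f ((p.1, p.2.1), p.2.2)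

theorem hasCompactSupport_cur {f : Zt n × ℝ → ℂ} (hf : HasCompactSupport f) :
    HasCompactSupport (cur f) :=
  hf.comp_homeomorph (Homeomorph.prodAssoc _ _ _).symm

theorem continuous_cur {f : Zt n × ℝ → ℂ} (hf : Continuous f) : Continuous (cur f) := by
  unfold cur
  fun_prop

theorem exists_cutoff {X : Type*} [TopologicalSpace X] [LocallyCompactSpace X] [T2Space X]
    {K : Set X} (hK : IsCompact K) : ∃ χ : X → ℝ, Continuous χ ∧ HasCompactSupport χ ∧
      (∀ x ∈ K, χ x = 1) ∧ ∀ x, 0 ≤ χ x ∧ χ x ≤ 1 := by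
  obtain ⟨χ, h1, -, h2, h3⟩ := exists_continuous_one_zero_of_isCompact hK isClosed_empty
    (Set.disjoint_empty K)
  exact ⟨χ, χ.continuous, h2, fun x hx => h1 hx, h3⟩

theorem slice_U_mem (ξ η : Hilb n) :
    slice (U n lam) ξ η ∈ closure ((sys n lam).core : Set (BH n)) := by
  have hd := dense_compactSupport (Y := Pt n)
  refine map_mem_closure₂ (f := slice (U n lam)) (continuous_slice _) (hd ξ) (hd η) ?_
  rintro ξ ⟨g, hg, hgc, hξ⟩ η ⟨h, hh, hhc, hη⟩
  obtain ⟨h1, h2⟩ := sliceKer_spec (lam := lam) (continuous_unc hg) (hasCompactSupport_unc hgc)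
    (continuous_unc hh) (hasCompactSupport_unc hhc)
  exact ⟨_, h1, h2, slice_U (continuous_unc hg) (hasCompactSupport_unc hgc)
    (continuous_unc hh) (hasCompactSupport_unc hhc) hξ hη⟩

/-- The kernel of a slice averages `sliceIntegrand lam g` over `z'` against `h`. If `g` is chosen so
that the value at `z' = 0` is `f`, and `h` concentrates there, the kernels tend to `f` uniformly. A
single pair of vectors suffices for each approximant. -/
theorem op_mem_closure_rightSlices {f : Zt n × ℝ → ℂ} (hf : Continuous f)
    (hfc : HasCompactSupport f) :
    (sys n lam).op f ∈ closure (rightSlices (U n lam)) := by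
  obtain ⟨K, C, hC, hK⟩ := exists_isKer hf hfc
  have h1 := continuous_e
  have h2 := continuous_eta lam
  have h3 := @continuous_beta n
  have hcγ : Continuous fun q : Zt n × ℝ => (sys n lam).γ q.2 (-q.1) :=
    continuous_γ_comp (by fun_prop) (by fun_prop)
  -- The solution of `sliceIntegrand lam g (q, 0) = f q`: the map `(z, s) ↦ (-γ_s z, -s)` is
  -- inverted and the phase divided out.
  set g : Zt n × ℝ → ℂ := fun q => e (eta lam q.2 * beta (-q.1.1) q.1.2) *
    f ((sys n lam).γ q.2 (-q.1), -q.2) with hg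
  have hgcont : Continuous g := by
    refine Continuous.mul (h1.comp (Continuous.mul (by fun_prop)
      (h3.comp (Continuous.prodMk (by fun_prop) (by fun_prop))))) (hf.comp (hcγ.prodMk (by fun_prop)))
  have hgc : HasCompactSupport g := by
    refine HasCompactSupport.intro (hfc.isCompact.image (f := fun q : Zt n × ℝ =>
      (-(sys n lam).γ q.2 q.1, -q.2))
      ((continuous_γ_comp (by fun_prop) (by fun_prop)).neg.prodMk (by fun_prop))) fun q hq => ?_
    have : ((sys n lam).γ q.2 (-q.1), -q.2) ∉ tsupport f := fun hm => hq
      ⟨_, hm, by simp only [(sys n lam).γ_add, add_neg_cancel, (sys n lam).γ_zero, neg_neg]⟩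
    rw [hg]
    simp only [image_eq_zero_of_notMem_tsupport this, mul_zero]
  have hg0 : ∀ z, ∀ s ∉ K, g (z, -s) = 0 := fun z s hs => by
    rw [hg]
    simp only [neg_neg, hK.eq_zero _ hs, mul_zero]
  have hI0 : ∀ q : Zt n × ℝ, sliceIntegrand lam g (q, 0) = f q := fun q => by
    have e1 : (sys n lam).γ (-q.2) (-(0 - (sys n lam).γ q.2 q.1)) = q.1 := by
      rw [zero_sub, neg_neg, (sys n lam).γ_add, add_neg_cancel, (sys n lam).γ_zero]
    unfold sliceIntegrand slicePhase
    rw [hg]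
    rw [zero_sub] at e1
    simp only [neg_neg, Prod.snd_zero, zero_sub, Prod.fst_neg, Prod.snd_neg] at e1 ⊢
    rw [e1]
    rw [← mul_assoc, conj_e_mul_e, one_mul]
  obtain ⟨M, hM, hM0⟩ := sliceIntegrand_support (lam := lam) hgc
    (isCompact_closedBall (0 : Zt n) 1)
  -- `h` needs compact support in `r` as well; a cutoff equal to `1` on `-K` does not disturb the
  -- kernel over `K`.
  obtain ⟨χ, hχ, hχc, hχ1, -⟩ := exists_cutoff hK.compact.neg
  refine System.op_mem_closure hK fun ε hε => ?_
  obtain ⟨θ, hθ, hθ0, hθε⟩ := exists_bump_approx (continuous_sliceIntegrand (lam := lam) hgcont) hM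
    (fun q hq w hw => hM0 q hq w (by simpa using hw)) hε
  set h : Zt n × ℝ → ℂ := fun q => ((θ q.1 * χ q.2 : ℝ) : ℂ) with hh
  have hhcont : Continuous h := by fun_prop
  have hhc : HasCompactSupport h := by
    refine HasCompactSupport.intro ((isCompact_closedBall (0 : Zt n) 1).prod hχc.isCompact)
      fun q hq => ?_
    rw [Set.mem_prod, not_and_or] at hq
    rw [hh]
    rcases hq with hq | hq
    · simp [hθ0 q.1 (by simpa using hq)]
    · simp [image_eq_zero_of_notMem_tsupport hq]
  obtain ⟨hk1, hk2⟩ := sliceKer_spec (lam := lam) hgcont hgc hhcont hhc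
  have hmg : MemLp (cur g) 2 (volume : Measure (Pt n)) :=
    (continuous_cur hgcont).memLp_of_hasCompactSupport (hasCompactSupport_cur hgc)
  have hmh : MemLp (cur h) 2 (volume : Measure (Pt n)) :=
    (continuous_cur hhcont).memLp_of_hasCompactSupport (hasCompactSupport_cur hhc)
  refine ⟨sliceKer lam g h, hk1, fun z s hs => ?_, ?_, fun z s hs => ?_⟩
  · unfold sliceKer sliceIntegrand
    simp only [hg0 _ s hs, mul_zero, integral_zero]
  · rw [← slice_U hgcont hgc hhcont hhc hmg.coeFn_toLp hmh.coeFn_toLp]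
    exact slice_mem_rightSlices _ _ _
  · have := hθε (z, s)
    rw [hI0] at this
    rw [norm_sub_rev]
    have e2 : sliceKer lam g h (z, s) =
        ∫ w, (θ w : ℂ) * sliceIntegrand lam g ((z, s), w) := by
      unfold sliceKer
      congr 1
      ext w
      rw [hh]
      simp only [hχ1 (-s) (by simpa using hs), mul_one, Complex.conj_ofReal]
    rwa [e2]

theorem isKer_unc {f : 𝓢(Pt n, ℂ)} (hf : f ∈ AhatFun n) :
    ∃ K C, 0 ≤ C ∧ IsKer (unc f) K C := by
  obtain ⟨R, hR⟩ := hf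
  have hb := SchwartzMap.norm_le_seminorm ℝ f
  refine ⟨Metric.closedBall 0 R, SchwartzMap.seminorm ℝ 0 0 f, apply_nonneg _ _,
    continuous_unc f.continuous, isCompact_closedBall _ _, fun z s => ?_⟩
  by_cases hs : s ∈ Metric.closedBall (0 : ℝ) R
  · rw [Set.indicator_of_mem hs]
    exact hb _
  · rw [Set.indicator_of_notMem hs]
    rw [Metric.mem_closedBall, dist_zero_right, not_le, Real.norm_eq_abs] at hs
    have : unc f (z, s) = 0 := hR _ _ _ hs
    rw [this, norm_zero]

/-- A Schwartz function is small off a compact set, so a cutoff changes it uniformly little, and the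
support in `r` stays inside `K`. -/
theorem rho_mem_closure_core {f : 𝓢(Pt n, ℂ)} (hf : f ∈ AhatFun n) :
    rho lam f ∈ closure ((sys n lam).core : Set (BH n)) := by
  obtain ⟨K, C, hC, hK⟩ := isKer_unc hf
  rw [rho_eq_op]
  refine System.op_mem_closure hK fun ε hε => ?_
  have h1 := f.tendsto_cocompact.eventually (Metric.closedBall_mem_nhds (0 : ℂ) hε)
  obtain ⟨L, hL, hLf⟩ := mem_cocompact.1 h1
  obtain ⟨χ, hχ, hχc, hχ1, hχb⟩ := exists_cutoff hL
  have hgc : Continuous fun p => (χ p : ℂ) * f p := by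
    have := f.continuous
    fun_prop
  have hgs : HasCompactSupport fun p => (χ p : ℂ) * f p :=
    (hχc.comp_left (g := fun x : ℝ => (x : ℂ)) Complex.ofReal_zero).mul_right
  refine ⟨unc fun p => (χ p : ℂ) * f p, continuous_unc hgc, fun z s hs => ?_,
    ⟨_, continuous_unc hgc, hasCompactSupport_unc hgs, rfl⟩, fun z s hs => ?_⟩
  · have := hK.eq_zero z hs
    unfold unc at this ⊢
    simp only [this, mul_zero]
  · unfold unc
    set p : Pt n := (z.1, z.2, s)
    change ‖f p - χ p * f p‖ ≤ ε
    by_cases hp : p ∈ L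
    · rw [hχ1 p hp]; simpa using hε.le
    · have h2 : ‖f p‖ ≤ ε := by simpa using hLf hp
      have h3 : f p - χ p * f p = ((1 - χ p : ℝ) : ℂ) * f p := by push_cast; ring
      rw [h3, norm_mul, Complex.norm_real, Real.norm_of_nonneg (by linarith [(hχb p).2])]
      nlinarith [(hχb p).1, (hχb p).2, norm_nonneg (f p)]

/-- Smooth uniform approximations can be taken to vanish wherever `f` does, so the same `K` serves
and they are Schwartz functions of compact support. -/
theorem op_mem_closure_rho {f : Zt n × ℝ → ℂ} (hf : Continuous f) (hfc : HasCompactSupport f) :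
    (sys n lam).op f ∈ closure {b | ∃ f ∈ AhatFun n, b = rho lam f} := by
  obtain ⟨K, C, hC, hK⟩ := exists_isKer hf hfc
  refine System.op_mem_closure hK fun ε hε => ?_
  obtain ⟨g, hg, hgd, hgs⟩ := (continuous_cur hf).exists_contDiff_approx (⊤ : ℕ∞)
    (ε := fun _ => ε) continuous_const fun _ => hε
  have hgc : HasCompactSupport g := (hasCompactSupport_cur hfc).mono hgs
  have h0 : ∀ p : Pt n, p.2.2 ∉ K → g p = 0 := fun p hp => by
    by_contra hne
    exact hgs hne (hK.eq_zero _ hp)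
  refine ⟨unc g, continuous_unc hg.continuous, fun z s hs => h0 _ hs,
    ⟨hgc.toSchwartzMap hg, ?_, rfl⟩, fun z s hs => ?_⟩
  · obtain ⟨R, hR⟩ := hK.compact.isBounded.subset_closedBall 0
    refine ⟨R, fun x y r hr => h0 (x, y, r) fun hm => ?_⟩
    have := hR hm
    rw [Metric.mem_closedBall, dist_zero_right, Real.norm_eq_abs] at this
    linarith
  · have := hgd (z.1, z.2, s)
    rw [dist_comm, dist_eq_norm] at this
    exact this.le

/-- The core is already a star algebra, so its closure contains whatever the slices generate;
conversely its elements are limits of slices alone. -/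
theorem Ahat_eq_closure_core :
    (Ahat n lam : Set (BH n)) = closure ((sys n lam).core : Set (BH n)) := by
  have h1 : rightSlices (U n lam) ⊆ ((sys n lam).core.topologicalClosure : Set (BH n)) := by
    refine rightSlices_subset _ (sys n lam).core.topologicalClosure.toAddSubmonoid
      (NonUnitalStarSubalgebra.isClosed_topologicalClosure _) fun ξ η => slice_U_mem ξ η
  refine Set.Subset.antisymm ?_ ?_
  · exact NonUnitalStarSubalgebra.topologicalClosure_minimal _
      (NonUnitalStarAlgebra.adjoin_le h1)
      (NonUnitalStarSubalgebra.isClosed_topologicalClosure _)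
  · refine closure_minimal ?_ (NonUnitalStarSubalgebra.isClosed_topologicalClosure _)
    rintro _ ⟨f, hf, hfc, rfl⟩
    exact closure_mono (NonUnitalStarAlgebra.subset_adjoin ℂ _) (op_mem_closure_rightSlices hf hfc)

theorem Ahat_eq_closure_rightSlices :
    (Ahat n lam : Set (BH n)) = closure (rightSlices (U n lam)) := by
  refine Set.Subset.antisymm ?_ (closure_mono (NonUnitalStarAlgebra.subset_adjoin ℂ _))
  rw [Ahat_eq_closure_core]
  refine closure_minimal ?_ isClosed_closure
  rintro _ ⟨f, hf, hfc, rfl⟩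
  exact op_mem_closure_rightSlices hf hfc

theorem Ahat_eq_closure_rho :
    (Ahat n lam : Set (BH n)) = closure {b | ∃ f ∈ AhatFun n, b = rho lam f} := by
  rw [Ahat_eq_closure_core]
  refine Set.Subset.antisymm (closure_minimal ?_ isClosed_closure)
    (closure_minimal ?_ isClosed_closure)
  · rintro _ ⟨f, hf, hfc, rfl⟩
    exact op_mem_closure_rho hf hfc
  · rintro _ ⟨f, hf, rfl⟩
    exact rho_mem_closure_core hf

end AhatEq

/-! ### The minimal tensor square of `Â`. -/

section TensorSq
variable {n : ℕ} {lam : ℝ}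

theorem continuous_kerTensor {f g : Zt n × ℝ → ℂ} (hf : Continuous f) (hg : Continuous g) :
    Continuous (kerTensor f g) := by
  unfold kerTensor
  fun_prop

theorem hasCompactSupport_kerTensor {f g : Zt n × ℝ → ℂ} (hf : HasCompactSupport f)
    (hg : HasCompactSupport g) : HasCompactSupport (kerTensor f g) := by
  refine HasCompactSupport.intro (((hf.isCompact.prod hg.isCompact).image
    (f := fun q : (Zt n × ℝ) × (Zt n × ℝ) => ((q.1.1, q.2.1), (q.1.2, q.2.2)))
    (by fun_prop))) fun q hq => ?_
  unfold kerTensor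
  by_cases h1 : (q.1.1, q.2.1) ∈ tsupport f
  · by_cases h2 : (q.1.2, q.2.2) ∈ tsupport g
    · exact absurd ⟨((q.1.1, q.2.1), (q.1.2, q.2.2)), ⟨h1, h2⟩, rfl⟩ hq
    · rw [image_eq_zero_of_notMem_tsupport h2, mul_zero]
  · rw [image_eq_zero_of_notMem_tsupport h1, zero_mul]

theorem opTensor_mem_closure_core {a b : BH n} (ha : a ∈ Ahat n lam) (hb : b ∈ Ahat n lam) :
    opTensor a b ∈ closure ((sys2 n lam).core : Set (BHH n)) := by
  have h : ∀ c ∈ Ahat n lam, c ∈ closure ((sys n lam).core : Set (BH n)) := fun c hc => by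
    rw [← Ahat_eq_closure_core]; exact hc
  refine map_mem_closure₂ (f := opTensor) ?_ (h a ha) (h b hb) ?_
  · exact (opTensorL n).continuous₂
  · rintro _ ⟨f, hf, hfc, rfl⟩ _ ⟨g, hg, hgc, rfl⟩
    obtain ⟨K, C, hC, hK⟩ := exists_isKer hf hfc
    obtain ⟨L, C', hC', hL⟩ := exists_isKer hg hgc
    exact ⟨_, continuous_kerTensor hf hg, hasCompactSupport_kerTensor hfc hgc,
      opTensor_op hC hK hL⟩

theorem op_mem_Ahat {f : Zt n × ℝ → ℂ} (hf : Continuous f) (hfc : HasCompactSupport f) :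
    (sys n lam).op f ∈ Ahat n lam := by
  rw [← SetLike.mem_coe, Ahat_eq_closure_core]
  exact subset_closure ⟨f, hf, hfc, rfl⟩

/-- With the variables regrouped as `(z, s)` and `(z', s')`, a sum of products approximating `F` is
the kernel of a sum of operators `a ⊗ b`. -/
theorem op_mem_closure_tensor {F : (Zt n × Zt n) × (ℝ × ℝ) → ℂ} (hF : Continuous F)
    (hFc : HasCompactSupport F) : (sys2 n lam).op F ∈ tensorSq (Ahat n lam) := by
  obtain ⟨K, C, hC, hK⟩ := exists_isKer hF hFc
  have hGc : HasCompactSupport fun q : (Zt n × ℝ) × (Zt n × ℝ) =>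
      F ((q.1.1, q.2.1), (q.1.2, q.2.2)) :=
    hFc.comp_homeomorph (Homeomorph.prodProdProdComm _ _ _ _)
  obtain ⟨KA, KB, hKA, hKB, h0, happ⟩ := exists_tensor_approx
    (G := fun q : (Zt n × ℝ) × (Zt n × ℝ) => F ((q.1.1, q.2.1), (q.1.2, q.2.2)))
    (by fun_prop) hGc
  have hK2 : IsCompact ((Prod.snd '' KA) ×ˢ (Prod.snd '' KB)) :=
    (hKA.image continuous_snd).prod (hKB.image continuous_snd)
  have hnot : ∀ (z : Zt n × Zt n) (s : ℝ × ℝ), s ∉ (Prod.snd '' KA) ×ˢ (Prod.snd '' KB) →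
      ((z.1, s.1) ∉ KA ∨ (z.2, s.2) ∉ KB) := fun z s hs => by
    by_contra hc
    push Not at hc
    exact hs ⟨⟨_, hc.1, rfl⟩, ⟨_, hc.2, rfl⟩⟩
  -- One compact set of parameters must serve `F` and all approximants, whatever `ε`; the product of
  -- the projections of `KA` and `KB` does.
  have hKF : IsKer F ((Prod.snd '' KA) ×ˢ (Prod.snd '' KB)) C := by
    refine ⟨hF, hK2, fun z s => ?_⟩
    by_cases hs : s ∈ (Prod.snd '' KA) ×ˢ (Prod.snd '' KB)
    · rw [Set.indicator_of_mem hs]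
      refine (hK.bound z s).trans ?_
      by_cases hsK : s ∈ K <;> simp [hsK, hC]
    · rw [Set.indicator_of_notMem hs]
      have := h0 (z.1, s.1) (z.2, s.2) (hnot z s hs)
      simp only [Prod.mk.eta] at this
      rw [this, norm_zero]
  refine System.op_mem_closure hKF fun ε hε => ?_
  obtain ⟨ι, hι, φ, ψ, hφ, hψ, hd⟩ := happ ε hε
  have hφc : ∀ i, HasCompactSupport (φ i) := fun i => HasCompactSupport.intro hKA (hφ i).2
  have hψc : ∀ i, HasCompactSupport (ψ i) := fun i => HasCompactSupport.intro hKB (hψ i).2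
  choose K1 C1 hC1 hK1 using fun i => exists_isKer (hφ i).1 (hφc i)
  choose K2 C2 hC2 hK2' using fun i => exists_isKer (hψ i).1 (hψc i)
  have hz : ∀ i (z : Zt n × Zt n) (s : ℝ × ℝ), s ∉ (Prod.snd '' KA) ×ˢ (Prod.snd '' KB) →
      kerTensor (φ i) (ψ i) (z, s) = 0 := fun i z s hs => by
    unfold kerTensor
    rcases hnot z s hs with h | h
    · simp only [(hφ i).2 _ h, zero_mul]
    · simp only [(hψ i).2 _ h, mul_zero]
  have hker : ∀ i, IsKer (kerTensor (φ i) (ψ i)) ((Prod.snd '' KA) ×ˢ (Prod.snd '' KB))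
      (C1 i * C2 i) := fun i => by
    have h1 := isKer_kerTensor (hC1 i) (hK1 i) (hK2' i)
    refine ⟨h1.cont, hK2, fun z s => ?_⟩
    by_cases hs : s ∈ (Prod.snd '' KA) ×ˢ (Prod.snd '' KB)
    · rw [Set.indicator_of_mem hs]
      refine (h1.bound z s).trans ?_
      by_cases hsK : s ∈ K1 i ×ˢ K2 i
      · rw [Set.indicator_of_mem hsK]
      · rw [Set.indicator_of_notMem hsK]
        exact mul_nonneg (hC1 i) (hC2 i)
    · rw [hz i z s hs]; simp [hs]
  obtain ⟨hs1, hs2⟩ := System.op_sum (D := sys2 n lam) Finset.univ hK2 (fun i _ => hker i)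
  refine ⟨_, hs1.cont, fun z s hs => hs1.eq_zero z hs, ?_, fun z s _ => hd (z.1, s.1) (z.2, s.2)⟩
  rw [hs2]
  refine sum_mem fun i _ => NonUnitalStarAlgebra.subset_adjoin ℂ _
    ⟨_, op_mem_Ahat (hφ i).1 (hφc i), _, op_mem_Ahat (hψ i).1 (hψc i), ?_⟩
  rw [opTensor_op (hC1 i) (hK1 i) (hK2' i)]

theorem tensorSq_eq_closure_core :
    (tensorSq (Ahat n lam) : Set (BHH n)) = closure ((sys2 n lam).core : Set (BHH n)) := by
  refine Set.Subset.antisymm ?_ (closure_minimal ?_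
    (NonUnitalStarSubalgebra.isClosed_topologicalClosure _))
  · refine NonUnitalStarSubalgebra.topologicalClosure_minimal (t := (sys2 n lam).core.topologicalClosure) _
      (NonUnitalStarAlgebra.adjoin_le ?_)
      (NonUnitalStarSubalgebra.isClosed_topologicalClosure _)
    rintro _ ⟨a, ha, b, hb, rfl⟩
    exact opTensor_mem_closure_core ha hb
  · rintro _ ⟨F, hF, hFc, rfl⟩
    exact op_mem_closure_tensor hF hFc

end TensorSq

/-! ### The comultiplication -/

section Delta
variable {n : ℕ} {lam : ℝ}

/-- The diagonal of `ℝ × ℝ`. -/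
def diagHom : ℝ →+ ℝ × ℝ := (AddMonoidHom.id ℝ).prod (AddMonoidHom.id ℝ)

theorem continuous_diagHom : Continuous diagHom := continuous_id.prodMk continuous_id

/-- The system in which `ℝ` acts diagonally. -/
noncomputable abbrev sysDiag (n : ℕ) (lam : ℝ) : System (Pt n × Pt n) (Zt n × Zt n) ℝ :=
  (sys2 n lam).comp diagHom continuous_diagHom

/-- The kernel of `U_A* (1 ⊗ ρ_f) U_A`. -/
noncomputable def kerDelta (lam : ℝ) (f : Zt n × ℝ → ℂ) : (Zt n × Zt n) × ℝ → ℂ :=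
  fun q => f (q.1.1 + q.1.2, q.2) * e (eta lam q.2 * beta q.1.1.1 q.1.2.2)

theorem isKer_kerDelta {f : Zt n × ℝ → ℂ} {K : Set ℝ} {C : ℝ} (hf : IsKer f K C) :
    IsKer (kerDelta lam f) K C := by
  have h1 := continuous_e
  have h2 := continuous_eta lam
  have h3 := @continuous_beta n
  have h4 := hf.cont
  have h5 : Continuous fun q : (Zt n × Zt n) × ℝ => beta q.1.1.1 q.1.2.2 :=
    h3.comp (f := fun q : (Zt n × Zt n) × ℝ => (q.1.1.1, q.1.2.2)) (by fun_prop)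
  refine ⟨?_, hf.compact, fun z s => ?_⟩
  · unfold kerDelta
    fun_prop
  unfold kerDelta
  rw [norm_mul, norm_e, mul_one]
  exact hf.bound _ _

/-- The cocycle identity behind the comultiplication. The factor `e^{2λs}` is what `β` gains when
both of its arguments are dilated by `e^{λs}`. -/
theorem eta_sub (lam r s : ℝ) :
    eta lam r - eta lam s = Real.exp (2 * lam * s) * eta lam (r - s) := by
  unfold eta
  split_ifs with h
  · simp [h]
  · have : 2 * lam * r = 2 * lam * s + 2 * lam * (r - s) := by ring
    rw [this, Real.exp_add]
    field_simp
    ring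

theorem beta_smul_smul (c d : ℝ) (x y : EuclideanSpace ℝ (Fin n)) :
    beta (c • x) (d • y) = c * d * beta x y := by
  unfold beta
  rw [real_inner_smul_left, real_inner_smul_right]
  ring

theorem exp_neg_mul_sub (lam r s : ℝ) :
    Real.exp (-lam * (r - s)) = Real.exp (lam * s) * Real.exp (-lam * r) := by
  rw [← Real.exp_add]
  ring_nf

/-- Dilating by `e^{λs}` after `e^{-λr'}` is the same as lowering `r'` by `s`, so the diagonal flow
after `Umap` is the flow of the second point alone before it. -/
theorem diag_Umap (s : ℝ) (p : Pt n × Pt n) :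
    (sysDiag n lam).α s (Umap n lam p) = Umap n lam (p.1, (sys n lam).α s p.2) := by
  obtain ⟨⟨x, y, r⟩, x', y', r'⟩ := p
  have h1 : (sysDiag n lam).α s (Umap n lam ((x, y, r), x', y', r')) =
      ((Real.exp (lam * s) • Real.exp (-lam * r') • x, Real.exp (lam * s) • Real.exp (-lam * r') • y,
        r + r' - s), (Real.exp (lam * s) • (x' - Real.exp (-lam * r') • x),
        Real.exp (lam * s) • (y' - Real.exp (-lam * r') • y), r' - s)) := rfl
  have h2 : Umap n lam ((x, y, r), (sys n lam).α s (x', y', r')) =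
      ((Real.exp (-lam * (r' - s)) • x, Real.exp (-lam * (r' - s)) • y, r + (r' - s)),
        (Real.exp (lam * s) • x' - Real.exp (-lam * (r' - s)) • x,
        Real.exp (lam * s) • y' - Real.exp (-lam * (r' - s)) • y, r' - s)) := rfl
  rw [h1, h2, exp_neg_mul_sub]
  simp only [smul_smul, smul_sub, add_sub_assoc]

/-- `Umap` splits `z'` into two points with sum `z'`, so `f` is evaluated at `z'` again. By
`eta_sub` the phase of `kerDelta` turns `η(r')` into `η(r') - η(s)`, the phase of `U_A` at the moved
point; the powers of `e^{λs}` balance. -/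
theorem Uweight_mul_kerDelta (f : Zt n × ℝ → ℂ) (s : ℝ) (p : Pt n × Pt n) :
    Uweight n lam p * ((sysDiag n lam).w s *
      kerDelta lam f ((sysDiag n lam).π (Umap n lam p), s)) =
    (sys n lam).w s * kerRight f ((sysDiag n lam).π p, s) *
      Uweight n lam (p.1, (sys n lam).α s p.2) := by
  obtain ⟨⟨x, y, r⟩, x', y', r'⟩ := p
  set a := Real.exp (-lam * r') with ha
  have h1 : Uweight n lam ((x, y, r), x', y', r') = (a : ℂ) ^ n *
      conj (e (eta lam r' * beta (a • x) (y' - a • y))) := rfl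
  have h2 : (sysDiag n lam).w s =
      (Real.exp (lam * s) : ℂ) ^ n * (Real.exp (lam * s) : ℂ) ^ n := rfl
  have h3 : (sys n lam).w s = (Real.exp (lam * s) : ℂ) ^ n := rfl
  have h4 : kerDelta lam f ((sysDiag n lam).π (Umap n lam ((x, y, r), x', y', r')), s) =
      f ((a • x + (x' - a • x), a • y + (y' - a • y)), s) *
        e (eta lam s * beta (a • x) (y' - a • y)) := rfl
  have h5 : kerRight f ((sysDiag n lam).π ((x, y, r), x', y', r'), s) = f ((x', y'), s) := rfl
  have h6 : Uweight n lam ((x, y, r), (sys n lam).α s (x', y', r')) =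
      (Real.exp (-lam * (r' - s)) : ℂ) ^ n * conj (e (eta lam (r' - s) *
        beta (Real.exp (-lam * (r' - s)) • x)
          (Real.exp (lam * s) • y' - Real.exp (-lam * (r' - s)) • y))) := rfl
  have h7 : eta lam (r' - s) * beta (Real.exp (-lam * (r' - s)) • x)
      (Real.exp (lam * s) • y' - Real.exp (-lam * (r' - s)) • y) =
      (eta lam r' - eta lam s) * beta (a • x) (y' - a • y) := by
    have h8 : Real.exp (2 * lam * s) = Real.exp (lam * s) * Real.exp (lam * s) := by
      rw [← Real.exp_add]
      ring_nf
    rw [exp_neg_mul_sub, ← ha, mul_smul, mul_smul, ← smul_sub, beta_smul_smul, eta_sub, h8]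
    ring
  rw [h1, h2, h3, h4, h5, h6, h7, exp_neg_mul_sub, ← ha, sub_mul, sub_eq_add_neg (eta lam r' * _),
    e_add, ← conj_e, map_mul, Complex.conj_conj, add_sub_cancel, add_sub_cancel, Complex.ofReal_mul]
  ring

/-- The two identities above intertwine the kernel operators through `U_A`, and unitarity solves for
the conjugate. The result integrates only over the diagonal of `ℝ × ℝ`. -/
theorem conj_op {f : Zt n × ℝ → ℂ} {K : Set ℝ} {C : ℝ} (hf : IsKer f K C) :
    star (U n lam) * opTensor 1 ((sys n lam).op f) * U n lam =
      (sysDiag n lam).op (kerDelta lam f) := by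
  obtain ⟨hUq, hU, hUu⟩ := U_spec n lam
  set D := (sys2 n lam).comp (AddMonoidHom.inr ℝ ℝ) continuous_addMonoidHom_inr with hD
  have hU' : IsGivenBy (fun ξ q => Uweight n lam q * ξ (Umap n lam q)) (U n lam) := hU
  have hα' : ∀ s q, D.α s q = (q.1, (sys n lam).α s q.2) := fun s q =>
    Prod.ext ((sys n lam).α_zero q.1) rfl
  have hw' : ∀ s, D.w s = (sys n lam).w s := fun s => by
    have : D.w s = (sys n lam).w 0 * (sys n lam).w s := rfl
    rw [this, (sys n lam).w_zero, one_mul]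
  have h : U n lam * (sysDiag n lam).op (kerDelta lam f) = D.op (kerRight f) * U n lam := by
    refine (sysDiag n lam).flow.isGivenBy_conj hf.compact.measurableSet
      hf.compact.measure_lt_top.ne
      (System.kerBound (D := sysDiag n lam) (isKer_kerDelta (lam := lam) hf)) D.flow
      (System.kerBound (D := D) (isKer_kerRight hf)) hUq hU' (fun p s _ => ?_) (fun p s _ => ?_)
    · rw [hα']
      exact diag_Umap s p
    · rw [hα', hw']
      exact Uweight_mul_kerDelta f s p
  have h2 : U n lam * (sysDiag n lam).op (kerDelta lam f) =
      opTensor 1 ((sys n lam).op f) * U n lam := by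
    rw [opTensor_one_op hf]
    exact h
  rw [mul_assoc, ← h2, ← mul_assoc, Unitary.star_mul_self_of_mem hUu, one_mul]

/-- `b ↦ U_A* (1 ⊗ b) U_A`. -/
noncomputable def comul (n : ℕ) (lam : ℝ) (b : BH n) : BHH n :=
  star (U n lam) * opTensor 1 b * U n lam

theorem continuous_comul : Continuous (comul n lam) := by
  have h : Continuous fun b : BH n => opTensor 1 b := (opTensorL n 1).continuous
  unfold comul
  fun_prop

theorem comul_mul (b b' : BH n) : comul n lam (b * b') = comul n lam b * comul n lam b' := by
  have h := (U_spec n lam).2.2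
  unfold comul
  have h1 : opTensor (1 : BH n) (b * b') = opTensor 1 b * opTensor 1 b' := by
    rw [← opTensor_mul, one_mul]
  have h2 : U n lam * star (U n lam) = 1 := Unitary.mul_star_self_of_mem h
  calc star (U n lam) * opTensor 1 (b * b') * U n lam
      = star (U n lam) * opTensor 1 b * (U n lam * star (U n lam)) * opTensor 1 b' * U n lam := by
        rw [h1, h2, mul_one]; simp only [mul_assoc]
    _ = _ := by simp only [mul_assoc]

theorem comul_star (b : BH n) : comul n lam (star b) = star (comul n lam b) := by
  unfold comul
  rw [star_mul, star_mul, star_star, opTensor_star, star_one, mul_assoc]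

theorem comul_op_mul {f : Zt n × ℝ → ℂ} {K : Set ℝ} {C : ℝ} (hf : IsKer f K C)
    {G : (Zt n × Zt n) × (ℝ × ℝ) → ℂ} (hG : Continuous G) (hGc : HasCompactSupport G) :
    comul n lam ((sys n lam).op f) * (sys2 n lam).op G =
      (sys2 n lam).op ((sys2 n lam).conv diagHom (kerDelta lam f) G) := by
  rw [comul, conj_op hf]
  exact System.op_mul (isKer_kerDelta hf) hG hGc

/-- Twisted convolution with the diagonal kernel preserves `C_c`: the compact set of times `s`
enlarges supports only boundedly, although `kerDelta` itself need not have compact support in `(z,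
z')`. Joint continuity passes to the closures. -/
theorem comul_mul_mem {b : BH n} (hb : b ∈ Ahat n lam) {c : BHH n}
    (hc : c ∈ tensorSq (Ahat n lam)) : comul n lam b * c ∈ tensorSq (Ahat n lam) := by
  rw [← SetLike.mem_coe, tensorSq_eq_closure_core] at hc ⊢
  rw [← SetLike.mem_coe, Ahat_eq_closure_core] at hb
  refine map_mem_closure₂ (f := fun b c => comul n lam b * c)
    ((continuous_comul.comp continuous_fst).mul continuous_snd) hb hc ?_
  rintro _ ⟨f, hf, hfc, rfl⟩ _ ⟨G, hG, hGc, rfl⟩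
  obtain ⟨K, C, hC, hK⟩ := exists_isKer hf hfc
  exact ⟨_, System.continuous_conv continuous_diagHom (isKer_kerDelta hK) hG,
    System.hasCompactSupport_conv continuous_diagHom (isKer_kerDelta hK) hGc,
    comul_op_mul hK hG hGc⟩

theorem comul_mem_multiplierAlg {b : BH n} (hb : b ∈ Ahat n lam) :
    comul n lam b ∈ multiplierAlg (tensorSq (Ahat n lam)) := by
  intro c hc
  refine ⟨comul_mul_mem hb hc, ?_⟩
  -- Multiplication on the other side follows by taking adjoints, as both algebras are closed under
  -- `star`.
  have h := star_mem (comul_mul_mem (star_mem hb) (star_mem hc))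
  rwa [comul_star, star_mul, star_star, star_star] at h

/-- For `f(z, s) = χ(z) θ(s)` the product of the comultiplied `ρ_f` with the operator of `G` has
kernel `∫ θ(s) H(q, s) ds`. Here `H(q, 0) = G(q)`, since the phase is trivial at `s = 0`, so letting
`θ` concentrate at `0` recovers `G`. -/
theorem op_mem_closure_comul {G : (Zt n × Zt n) × (ℝ × ℝ) → ℂ} (hG : Continuous G)
    (hGc : HasCompactSupport G) :
    (sys2 n lam).op G ∈ closure {T : BHH n | ∃ b ∈ Ahat n lam, ∃ c ∈ tensorSq (Ahat n lam),
      T = comul n lam b * c} := by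
  obtain ⟨K, C, hC, hK⟩ := exists_isKer hG hGc
  have h1 := continuous_e
  have h2 := continuous_eta lam
  have h3 := @continuous_beta n
  -- `L` contains the supports of all translates of `G` by times of modulus at most `1`, so the
  -- approximants below share it.
  obtain ⟨L, hL, hL0⟩ := System.translate_support (D := sys2 n lam) continuous_diagHom
    (isCompact_closedBall (0 : ℝ) 1) hGc
  -- `kerDelta` evaluates `f` at `z + z'`, so `χ` must equal `1` on the sums of the pairs occurring
  -- in the support of `G`.
  obtain ⟨χ, hχ, hχc, hχ1, -⟩ := exists_cutoff (X := Zt n)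
    (hGc.isCompact.image (f := fun q => q.1.1 + q.1.2) (by fun_prop))
  set H : ((Zt n × Zt n) × (ℝ × ℝ)) × ℝ → ℂ := fun q => (χ (q.1.1.1 + q.1.1.2) : ℂ) *
    e (eta lam q.2 * beta q.1.1.1.1 q.1.1.2.2) *
    G ((sys2 n lam).γ (diagHom q.2) q.1.1, q.1.2 - diagHom q.2) with hH
  have hHc : Continuous H := by
    have h4 : Continuous fun q : ((Zt n × Zt n) × (ℝ × ℝ)) × ℝ =>
        (sys2 n lam).γ (diagHom q.2) q.1.1 :=
      (sys2 n lam).γ_cont.comp ((continuous_diagHom.comp continuous_snd).prodMk (by fun_prop))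
    have h5 : Continuous fun q : ((Zt n × Zt n) × (ℝ × ℝ)) × ℝ => q.1.2 - diagHom q.2 :=
      (continuous_snd.comp continuous_fst).sub (continuous_diagHom.comp continuous_snd)
    have h6 : Continuous fun q : ((Zt n × Zt n) × (ℝ × ℝ)) × ℝ => beta q.1.1.1.1 q.1.1.2.2 :=
      h3.comp (f := fun q : ((Zt n × Zt n) × (ℝ × ℝ)) × ℝ => (q.1.1.1.1, q.1.1.2.2)) (by fun_prop)
    have h7 : Continuous fun q : ((Zt n × Zt n) × (ℝ × ℝ)) × ℝ =>
        G ((sys2 n lam).γ (diagHom q.2) q.1.1, q.1.2 - diagHom q.2) := hG.comp (h4.prodMk h5)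
    have h8 : Continuous fun q : ((Zt n × Zt n) × (ℝ × ℝ)) × ℝ => (χ (q.1.1.1 + q.1.1.2) : ℂ) := by
      fun_prop
    have h9 : Continuous fun q : ((Zt n × Zt n) × (ℝ × ℝ)) × ℝ =>
        e (eta lam q.2 * beta q.1.1.1.1 q.1.1.2.2) := by
      fun_prop
    exact (h8.mul h9).mul h7
  have hH1 : ∀ q, H (q, 0) = G q := fun q => by
    rw [hH]
    have he : eta lam 0 = 0 := by unfold eta; simp
    have he0 : e 0 = 1 := by unfold e; simp
    simp only [map_zero, (sys2 n lam).γ_zero, sub_zero, he, zero_mul, he0, mul_one, Prod.mk.eta]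
    by_cases hq : q ∈ tsupport G
    · rw [hχ1 _ ⟨q, hq, rfl⟩]; simp
    · rw [image_eq_zero_of_notMem_tsupport hq, mul_zero]
  have hH0 : ∀ q ∉ L, ∀ s : ℝ, ‖s‖ ≤ 1 → H (q, s) = 0 := fun q hq s hs => by
    rw [hH]
    simp only [hL0 q hq s (by simpa using hs), mul_zero]
  have hM : IsCompact (Prod.snd '' L) := hL.image continuous_snd
  have hnot : ∀ z, ∀ s ∉ Prod.snd '' L, (z, s) ∉ L := fun z s hs hm => hs ⟨_, hm, rfl⟩
  have hKG : IsKer G (Prod.snd '' L) C := by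
    refine ⟨hG, hM, fun z s => ?_⟩
    by_cases hs : s ∈ Prod.snd '' L
    · rw [Set.indicator_of_mem hs]
      refine (hK.bound z s).trans ?_
      by_cases hsK : s ∈ K <;> simp [hsK, hC]
    · rw [← hH1, hH0 _ (hnot z s hs) 0 (by simp)]; simp [hs]
  refine System.op_mem_closure hKG fun ε hε => ?_
  obtain ⟨θ, hθ, hθ0, hθε⟩ := exists_bump_approx hHc hL hH0 hε
  have hfc : Continuous fun q : Zt n × ℝ => ((χ q.1 * θ q.2 : ℝ) : ℂ) := by fun_prop
  have hfs : HasCompactSupport fun q : Zt n × ℝ => ((χ q.1 * θ q.2 : ℝ) : ℂ) := by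
    refine HasCompactSupport.intro (hχc.isCompact.prod (isCompact_closedBall (0 : ℝ) 1))
      fun q hq => ?_
    rw [Set.mem_prod, not_and_or] at hq
    rcases hq with hq | hq
    · simp [image_eq_zero_of_notMem_tsupport hq]
    · simp [hθ0 q.2 (by simpa using hq)]
  obtain ⟨Kf, Cf, hCf, hKf⟩ := exists_isKer hfc hfs
  have hconv : ∀ q, (sys2 n lam).conv diagHom (kerDelta lam fun q => ((χ q.1 * θ q.2 : ℝ) : ℂ)) G q =
      ∫ s, (θ s : ℂ) * H (q, s) := fun q => by
    unfold System.conv kerDelta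
    congr 1
    ext s
    rw [hH]
    push_cast
    ring
  refine ⟨_, System.continuous_conv continuous_diagHom (isKer_kerDelta hKf) hG, fun z s hs => ?_,
    ⟨_, op_mem_Ahat hfc hfs, _, ?_, (comul_op_mul hKf hG hGc).symm⟩, fun z s _ => ?_⟩
  · rw [hconv]
    refine integral_eq_zero_of_ae (Eventually.of_forall fun t => ?_)
    by_cases ht : ‖t‖ ≤ 1
    · simp only [hH0 _ (hnot z s hs) t ht, mul_zero, Pi.zero_apply]
    · simp only [hθ0 t (not_le.1 ht), Complex.ofReal_zero, zero_mul, Pi.zero_apply]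
  · exact op_mem_closure_tensor hG hGc
  · rw [hconv, norm_sub_rev, ← hH1]
    exact hθε (z, s)

end Delta

/-! ### The oscillatory integral -/

section Fourier
open scoped FourierTransform

variable {Φ : ℝ × ℝ → ℂ}

theorem integrable_innerIntegrand (hΦ : Continuous Φ) (hc : HasCompactSupport Φ) (z z' : ℝ) :
    Integrable (innerIntegrand Φ z z') := by
  have h1 := continuous_e
  have h2 : Continuous fun q : ℝ × ℝ => conj (e (z * q.1 + z' * q.2)) :=
    Complex.continuous_conj.comp (h1.comp (by fun_prop))
  exact (h2.mul hΦ).integrable_of_hasCompactSupport hc.mul_left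

theorem measurableEmbedding_ofLp : MeasurableEmbedding (@WithLp.ofLp 2 (ℝ × ℝ)) :=
  (MeasurableEquiv.toLp 2 (ℝ × ℝ)).symm.measurableEmbedding

/-- The passage to `WithLp 2` equips the plane with the inner product that the Fourier transform
refers to; the volume is unchanged. -/
theorem integral_innerIntegrand (z z' : ℝ) :
    ∫ q, innerIntegrand Φ z z' q =
      𝓕 (fun v : WithLp 2 (ℝ × ℝ) => Φ v.ofLp) (WithLp.toLp 2 (z, z')) := by
  rw [Real.fourier_eq', ← (WithLp.volume_preserving_ofLp (U := ℝ) (V := ℝ)).integral_comp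
    measurableEmbedding_ofLp]
  congr 1
  ext v
  change conj (e (z * v.ofLp.1 + z' * v.ofLp.2)) * Φ v.ofLp = _
  rw [conj_e, smul_eq_mul]
  congr 1
  unfold e
  congr 1
  simp only [WithLp.prod_inner_apply, RCLike.inner_apply, conj_trivial]
  push_cast
  ring

theorem exists_schwartz (hΦ : ContDiff ℝ ∞ Φ) (hc : HasCompactSupport Φ) :
    ∃ φ : 𝓢(WithLp 2 (ℝ × ℝ), ℂ), ∀ v, φ v = Φ v.ofLp := by
  have h1 : ContDiff ℝ ∞ fun v : WithLp 2 (ℝ × ℝ) => Φ v.ofLp :=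
    hΦ.comp (WithLp.prodContinuousLinearEquiv 2 ℝ ℝ ℝ).contDiff
  have h2 : HasCompactSupport fun v : WithLp 2 (ℝ × ℝ) => Φ v.ofLp :=
    hc.comp_homeomorph (WithLp.prodContinuousLinearEquiv 2 ℝ ℝ ℝ).toHomeomorph
  exact ⟨h2.toSchwartzMap h1, fun v => rfl⟩

theorem integrable_integral_innerIntegrand (hΦ : ContDiff ℝ ∞ Φ) (hc : HasCompactSupport Φ) :
    Integrable fun z : ℝ × ℝ => ∫ q, innerIntegrand Φ z.1 z.2 q := by
  obtain ⟨φ, hφ⟩ := exists_schwartz hΦ hc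
  have hφ' : (φ : WithLp 2 (ℝ × ℝ) → ℂ) = fun v => Φ v.ofLp := funext hφ
  have h1 : Integrable (𝓕 φ : 𝓢(WithLp 2 (ℝ × ℝ), ℂ)) := SchwartzMap.integrable _
  rw [← (WithLp.volume_preserving_ofLp (U := ℝ) (V := ℝ)).integrable_comp_emb
    measurableEmbedding_ofLp]
  refine h1.congr (Eventually.of_forall fun v => ?_)
  simp only [Function.comp_apply, integral_innerIntegrand, Prod.mk.eta, WithLp.toLp_ofLp]
  rw [SchwartzMap.fourier_coe, hφ']

/-- Fourier inversion for the Schwartz function given by `Φ`. -/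
theorem integral_e_mul (hΦ : ContDiff ℝ ∞ Φ) (hc : HasCompactSupport Φ) (s s' : ℝ) :
    ∫ z : ℝ × ℝ, e (s * z.1 + s' * z.2) * ∫ q, innerIntegrand Φ z.1 z.2 q = Φ (s, s') := by
  obtain ⟨φ, hφ⟩ := exists_schwartz hΦ hc
  have hφ' : (φ : WithLp 2 (ℝ × ℝ) → ℂ) = fun v => Φ v.ofLp := funext hφ
  have h1 : Integrable (𝓕 φ : 𝓢(WithLp 2 (ℝ × ℝ), ℂ)) := SchwartzMap.integrable _
  rw [SchwartzMap.fourier_coe] at h1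
  have h2 := congrFun (φ.continuous.fourierInv_fourier_eq φ.integrable h1) (WithLp.toLp 2 (s, s'))
  rw [hφ, Real.fourierInv_eq'] at h2
  rw [← h2, ← (WithLp.volume_preserving_ofLp (U := ℝ) (V := ℝ)).integral_comp
    measurableEmbedding_ofLp]
  congr 1
  ext v
  rw [integral_innerIntegrand, smul_eq_mul, hφ']
  simp only [Prod.mk.eta, WithLp.toLp_ofLp]
  congr 1
  unfold e
  congr 1
  simp only [WithLp.prod_inner_apply, RCLike.inner_apply, conj_trivial]
  push_cast
  ring

variable {n : ℕ} {lam : ℝ} {f : Pt n → ℂ} {K : Set ℝ} {C : ℝ}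

theorem outerIntegrand_eq (x y x' y' : EuclideanSpace ℝ (Fin n)) (w : ℝ × ℝ × ℝ) :
    outerIntegrand lam f x y x' y' Φ w = kerDelta lam (unc f) (((x, y), (x', y')), w.1) *
      (e (w.1 * w.2.1 + w.1 * w.2.2) * ∫ q, innerIntegrand Φ w.2.1 w.2.2 q) := by
  rw [← mul_add, ← mul_assoc]
  rfl

theorem IsKer.integrable_right {Z : Type*} [TopologicalSpace Z] {k : Z × ℝ → ℂ}
    (hk : IsKer k K C) (z : Z) : Integrable fun s => k (z, s) := by
  have := hk.cont
  exact (by fun_prop : Continuous fun s => k (z, s)).integrable_of_hasCompactSupport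
    (HasCompactSupport.intro hk.compact fun s hs => hk.eq_zero z hs)

/-- The integrand is a compactly supported function of `s`, times the Fourier transform of `Φ` in
`(z, z')`, times a factor of modulus one. -/
theorem integrable_outerIntegrand (hf : IsKer (unc f) K C) (hΦ : ContDiff ℝ ∞ Φ)
    (hc : HasCompactSupport Φ) (x y x' y' : EuclideanSpace ℝ (Fin n)) :
    Integrable (outerIntegrand lam f x y x' y' Φ) := by
  have h1 := ((isKer_kerDelta (lam := lam) hf).integrable_right ((x, y), (x', y'))).mul_prod
    (integrable_integral_innerIntegrand hΦ hc)
  have h3 := continuous_e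
  have h2 : Continuous fun w : ℝ × ℝ × ℝ => e (w.1 * w.2.1 + w.1 * w.2.2) := by fun_prop
  refine (h1.bdd_mul (c := 1) h2.aestronglyMeasurable
    (Eventually.of_forall fun w => (norm_e _).le)).congr (Eventually.of_forall fun w => ?_)
  rw [outerIntegrand_eq]
  ring

/-- The integral over `(z, z')` carries the phase `e[s(z + z')]`, so inversion evaluates `Φ` at the
diagonal point `(s, s)`. -/
theorem DeltaHat_eq (hf : IsKer (unc f) K C) (hΦ : ContDiff ℝ ∞ Φ)
    (hc : HasCompactSupport Φ) (x y x' y' : EuclideanSpace ℝ (Fin n)) :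
    DeltaHat lam f x y x' y' Φ =
      ∫ s, kerDelta lam (unc f) (((x, y), (x', y')), s) * Φ (s, s) := by
  have h := integrable_outerIntegrand (lam := lam) hf hΦ hc x y x' y'
  unfold DeltaHat
  rw [Measure.volume_eq_prod] at h ⊢
  rw [integral_prod _ h]
  congr 1
  ext s
  simp_rw [outerIntegrand_eq]
  rw [integral_const_mul, integral_e_mul hΦ hc]

end Fourier

/-! ### The operator `(ρ ⊗ ρ)` of the kernel `Δ̂f`. -/

section RhoRho
variable {n : ℕ} {lam : ℝ} {f : Pt n → ℂ} {K : Set ℝ} {C : ℝ}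

/-- The test function in the formula for `(ρ ⊗ ρ)_F`. -/
noncomputable def testFun (lam : ℝ) (ξ : Pt n × Pt n → ℂ) (q : Pt n × Pt n) : ℝ × ℝ → ℂ :=
  fun s => (sys2 n lam).w s * ξ ((sys2 n lam).α s q)

theorem contDiff_testFun (ξ : 𝓢(Pt n × Pt n, ℂ)) (q : Pt n × Pt n) :
    ContDiff ℝ ∞ (testFun lam ξ q) := by
  have h0 := ξ.smooth ⊤
  have h1 : ContDiff ℝ ∞ fun s : ℝ × ℝ => (sys2 n lam).w s := by
    have h2 : ∀ g : ℝ × ℝ → ℝ, ContDiff ℝ ∞ g →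
        ContDiff ℝ ∞ fun s => ((Real.exp (lam * g s) : ℝ) : ℂ) ^ n := fun g hg =>
      (Complex.ofRealCLM.contDiff.comp (contDiff_const.mul hg).exp).pow n
    exact (h2 Prod.fst contDiff_fst).mul (h2 Prod.snd contDiff_snd)
  have h3 : ContDiff ℝ ∞ fun s : ℝ × ℝ => (sys2 n lam).α s q := by
    have h2 : ∀ (g : ℝ × ℝ → ℝ) (p : Pt n), ContDiff ℝ ∞ g →
        ContDiff ℝ ∞ fun s => (sys n lam).α (g s) p := fun g p hg => by
      have h4 : ContDiff ℝ ∞ fun s => Real.exp (lam * g s) := (contDiff_const.mul hg).exp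
      exact (h4.smul contDiff_const).prodMk ((h4.smul contDiff_const).prodMk
        (contDiff_const.sub hg))
    exact (h2 Prod.fst q.1 contDiff_fst).prodMk (h2 Prod.snd q.2 contDiff_snd)
  exact h1.mul (h0.comp h3)

theorem hasCompactSupport_testFun {ξ : 𝓢(Pt n × Pt n, ℂ)} (hξ : ξ ∈ Core2 n) (q : Pt n × Pt n) :
    HasCompactSupport (testFun lam ξ q) := by
  obtain ⟨R, hR⟩ := hξ
  refine HasCompactSupport.intro ((isCompact_closedBall q.1.2.2 R).prod
    (isCompact_closedBall q.2.2.2 R)) fun s hs => ?_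
  have h : ξ ((sys2 n lam).α s q) = 0 := by
    refine hR _ _ _ _ _ _ ?_
    rw [Set.mem_prod, not_and_or, Metric.mem_closedBall', Metric.mem_closedBall', not_le, not_le] at hs
    exact hs
  unfold testFun
  rw [h, mul_zero]

/-- Restricted to the diagonal, the test function is the weighted orbit of `ξ` under the diagonal
flow. Membership of `ξ` in `Core2` makes the test function admissible at every point `q`. -/
theorem rhoRhoFormula_DeltaHat (hf : IsKer (unc f) K C) {ξ : 𝓢(Pt n × Pt n, ℂ)} (hξ : ξ ∈ Core2 n)
    (q : Pt n × Pt n) :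
    rhoRhoFormula lam (DeltaHat lam f) ξ q =
      kerFormula (sysDiag n lam).w (sysDiag n lam).α
        (fun p s => kerDelta lam (unc f) ((sysDiag n lam).π p, s)) ξ q := by
  have h : rhoRhoFormula lam (DeltaHat lam f) ξ q =
      DeltaHat lam f q.1.1 q.1.2.1 q.2.1 q.2.2.1 (testFun lam ξ q) := rfl
  rw [h, DeltaHat_eq hf (contDiff_testFun ξ q) (hasCompactSupport_testFun hξ q)]
  unfold kerFormula
  congr 1
  ext s
  have h1 : testFun lam ξ q (s, s) = (sysDiag n lam).w s * ξ ((sysDiag n lam).α s q) := rfl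
  have h2 : (sysDiag n lam).π q = ((q.1.1, q.1.2.1), (q.2.1, q.2.2.1)) := rfl
  rw [h1, ← h2]
  ring

theorem isRhoRho_DeltaHat (hf : IsKer (unc f) K C) :
    IsRhoRho lam (DeltaHat lam f) (comul n lam (rho lam f)) := by
  intro ξ hξ
  rw [comul, rho_eq_op, conj_op hf]
  filter_upwards [System.isGivenBy_op (D := sysDiag n lam) (isKer_kerDelta (lam := lam) hf)
    (ξ.toLp 2 volume), (sysDiag n lam).flow.ae_ae (ξ.coeFn_toLp 2 volume)] with q h1 h2
  rw [h1, rhoRhoFormula_DeltaHat hf hξ]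
  unfold kerFormula
  refine integral_congr_ae ?_
  filter_upwards [h2] with s hs
  rw [hs]

theorem dense_Core2 : Dense {ξ : Hilb2 n | ∃ φ ∈ Core2 n, ξ = φ.toLp 2 volume} := by
  refine (Lp.dense_hasCompactSupport_contDiff (E := Pt n × Pt n) (F := ℂ) (μ := volume) (p := 2)
    (by simp)).mono ?_
  rintro ξ ⟨g, hξ, hgc, hg⟩
  refine ⟨hgc.toSchwartzMap hg, ?_, Lp.ext ?_⟩
  · obtain ⟨R, hR⟩ := hgc.isCompact.isBounded.exists_norm_le
    refine ⟨R, fun x y r x' y' r' h => ?_⟩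
    refine image_eq_zero_of_notMem_tsupport fun hm => ?_
    have h1 := hR _ hm
    simp only [Prod.norm_def, sup_le_iff, Real.norm_eq_abs] at h1
    rcases h with h | h <;> linarith
  · filter_upwards [hξ, (hgc.toSchwartzMap hg).coeFn_toLp 2 volume] with q h1 h2
    rw [h1, h2]
    rfl

theorem IsRhoRho.unique {F : Kernel n} {T T' : BHH n} (h : IsRhoRho lam F T)
    (h' : IsRhoRho lam F T') : T = T' := by
  refine DFunLike.coe_injective (Continuous.ext_on dense_Core2 T.continuous T'.continuous ?_)
  rintro _ ⟨φ, hφ, rfl⟩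
  exact Lp.ext ((h φ hφ).trans (h' φ hφ).symm)

theorem isRhoRho_iff (hf : IsKer (unc f) K C) {T : BHH n} :
    IsRhoRho lam (DeltaHat lam f) T ↔ T = comul n lam (rho lam f) :=
  ⟨fun h => h.unique (isRhoRho_DeltaHat hf), fun h => h ▸ isRhoRho_DeltaHat hf⟩

end RhoRho

/-! ### The comultiplication as a non-degenerate star homomorphism, and its uniqueness. -/

section Main
variable {n : ℕ} {lam : ℝ}

/-- The comultiplication. -/
noncomputable def comulHom (n : ℕ) (lam : ℝ) :
    Ahat n lam →⋆ₙₐ[ℂ] multiplierAlg (tensorSq (Ahat n lam)) where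
  toFun b := ⟨comul n lam b, comul_mem_multiplierAlg b.2⟩
  map_smul' c b := Subtype.ext <| by
    change star (U n lam) * opTensorL n 1 (c • (b : BH n)) * U n lam =
      c • (star (U n lam) * opTensorL n 1 (b : BH n) * U n lam)
    rw [map_smul, mul_smul_comm, smul_mul_assoc]
  map_zero' := Subtype.ext <| by
    change star (U n lam) * opTensorL n 1 0 * U n lam = 0
    rw [map_zero, mul_zero, zero_mul]
  map_add' b c := Subtype.ext <| by
    change star (U n lam) * opTensorL n 1 ((b : BH n) + (c : BH n)) * U n lam =
      star (U n lam) * opTensorL n 1 (b : BH n) * U n lam +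
        star (U n lam) * opTensorL n 1 (c : BH n) * U n lam
    rw [map_add, mul_add, add_mul]
  map_mul' b c := Subtype.ext (comul_mul _ _)
  map_star' b := Subtype.ext (comul_star _)

theorem closure_span_comulHom :
    closure (Submodule.span ℂ {T : BHH n | ∃ b : Ahat n lam, ∃ c ∈ tensorSq (Ahat n lam),
      T = (comulHom n lam b : BHH n) * c} : Set (BHH n)) =
      (tensorSq (Ahat n lam) : Set (BHH n)) := by
  refine Set.Subset.antisymm (closure_minimal ?_
    (NonUnitalStarSubalgebra.isClosed_topologicalClosure _)) ?_
  · change Submodule.span ℂ _ ≤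
      (tensorSq (Ahat n lam)).toNonUnitalSubalgebra.toSubmodule
    refine Submodule.span_le.2 ?_
    rintro _ ⟨b, c, hc, rfl⟩
    exact comul_mul_mem b.2 hc
  · rw [tensorSq_eq_closure_core]
    refine closure_minimal ?_ isClosed_closure
    rintro _ ⟨G, hG, hGc, rfl⟩
    refine closure_mono ?_ (op_mem_closure_comul hG hGc)
    rintro _ ⟨b, hb, c, hc, rfl⟩
    exact Submodule.subset_span ⟨⟨b, hb⟩, c, hc, rfl⟩

theorem isGivenBy_rho {f : Pt n → ℂ} {K : Set ℝ} {C : ℝ} (hf : IsKer (unc f) K C) :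
    IsGivenBy (rhoFormula lam f) (rho lam f) := by
  rw [rho_eq_op, ← funext (rhoFormula_eq lam f)]
  exact System.isGivenBy_op (D := sys n lam) hf

theorem rho_mem_Ahat {f : 𝓢(Pt n, ℂ)} (hf : f ∈ AhatFun n) : rho lam f ∈ Ahat n lam := by
  rw [← SetLike.mem_coe, Ahat_eq_closure_rho]
  exact subset_closure ⟨f, hf, rfl⟩

theorem dense_rho : Dense {b : Ahat n lam | ∃ f ∈ AhatFun n, (b : BH n) = rho lam f} := by
  intro b
  rw [closure_subtype]
  have hb : (b : BH n) ∈ closure {b | ∃ f ∈ AhatFun n, b = rho lam f} := by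
    rw [← Ahat_eq_closure_rho]
    exact b.2
  refine closure_mono ?_ hb
  rintro _ ⟨f, hf, rfl⟩
  exact ⟨⟨rho lam f, rho_mem_Ahat hf⟩, ⟨f, hf, rfl⟩, rfl⟩

theorem ext_rho {D D' : Ahat n lam → BHH n} (hD : Continuous D) (hD' : Continuous D')
    (h : ∀ f ∈ AhatFun n, ∀ hf : rho lam f ∈ Ahat n lam,
      D ⟨rho lam f, hf⟩ = D' ⟨rho lam f, hf⟩) : D = D' := by
  refine Continuous.ext_on dense_rho hD hD' ?_
  rintro ⟨b, hb⟩ ⟨f, hf, hbf⟩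
  have hbf' : b = rho lam f := hbf
  subst hbf'
  exact h f hf hb

/-- On the dense set of the `ρ_f` the value is forced, because a bounded operator is determined by
its formula on the dense set `Core2`; continuity of both maps does the rest. -/
theorem eq_comul {D : Ahat n lam → BHH n} (hD : Continuous D)
    (h : ∀ f ∈ AhatFun n, ∀ hf : rho lam f ∈ Ahat n lam,
      IsRhoRho lam (DeltaHat lam f) (D ⟨rho lam f, hf⟩)) (b : Ahat n lam) :
    D b = comul n lam b := by
  refine congrFun (ext_rho (D' := fun b => comul n lam b) hD
    (continuous_comul.comp continuous_subtype_val) fun f hf hb => ?_) b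
  obtain ⟨K, C, -, hK⟩ := isKer_unc hf
  exact (isRhoRho_iff hK).1 (h f hf hb)

end Main
end QHeis

theorem mainTheorem6 (n : ℕ) (lam : ℝ) :
    -- the operators `U_A`, `ρ_f` and `a ⊗ b` are well defined by their formulas, `U_A` is unitary
    IsGivenBy (UFormula lam) (U n lam) ∧
    U n lam ∈ unitary (BHH n) ∧
    (∀ f ∈ AhatFun n, IsGivenBy (rhoFormula lam f) (rho lam f)) ∧
    (∀ a b : BH n, IsOpTensor a b (opTensor a b)) ∧
    -- `Â` is the closure of the right slices, and the `ρ_f` are dense in it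
    (Ahat n lam : Set (BH n)) = closure (rightSlices (U n lam)) ∧
    (Ahat n lam : Set (BH n)) = closure {b | ∃ f ∈ AhatFun n, b = rho lam f} ∧
    -- the oscillatory integral that defines `Δ̂f` makes sense
    (∀ f ∈ AhatFun n, ∀ x y x' y' : EuclideanSpace ℝ (Fin n), ∀ Φ : ℝ × ℝ → ℂ,
      ContDiff ℝ ∞ Φ → HasCompactSupport Φ →
        (∀ z z', Integrable (innerIntegrand Φ z z')) ∧
        Integrable (outerIntegrand lam f x y x' y' Φ)) ∧
    -- `(ρ ⊗ ρ)_{Δ̂f}` is the bounded operator `U_A* (1 ⊗ ρ_f) U_A`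
    (∀ f ∈ AhatFun n, ∀ T : BHH n, IsRhoRho lam (DeltaHat lam f) T ↔
      T = star (U n lam) * opTensor 1 (rho lam f) * U n lam) ∧
    -- `ρ_f ↦ (ρ ⊗ ρ)_{Δ̂f}` extends, uniquely, to the comultiplication
    ∃ D : Ahat n lam →⋆ₙₐ[ℂ] multiplierAlg (tensorSq (Ahat n lam)),
      (∀ b : Ahat n lam, (D b : BHH n) = star (U n lam) * opTensor 1 (b : BH n) * U n lam) ∧
      closure (Submodule.span ℂ
          {T : BHH n | ∃ b : Ahat n lam, ∃ c ∈ tensorSq (Ahat n lam), T = (D b : BHH n) * c} :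
          Set (BHH n)) = (tensorSq (Ahat n lam) : Set (BHH n)) ∧
      (∀ f ∈ AhatFun n, ∃ hf : rho lam f ∈ Ahat n lam,
        IsRhoRho lam (DeltaHat lam f) (D ⟨rho lam f, hf⟩ : BHH n)) ∧
      ∀ D' : Ahat n lam → BHH n, Continuous D' →
        (∀ f ∈ AhatFun n, ∀ hf : rho lam f ∈ Ahat n lam,
          IsRhoRho lam (DeltaHat lam f) (D' ⟨rho lam f, hf⟩)) →
        ∀ b : Ahat n lam, D' b = (D b : BHH n) := by
  obtain ⟨-, hU, hUu⟩ := U_spec n lam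
  refine ⟨hU, hUu, fun f hf => ?_, isOpTensor_opTensor, Ahat_eq_closure_rightSlices,
    Ahat_eq_closure_rho, fun f hf x y x' y' Φ hΦ hc => ?_, fun f hf T => ?_,
    comulHom n lam, fun b => rfl, closure_span_comulHom, fun f hf => ?_, fun D' hD' h b => ?_⟩
  · obtain ⟨K, C, -, hK⟩ := isKer_unc hf
    exact isGivenBy_rho hK
  · obtain ⟨K, C, -, hK⟩ := isKer_unc hf
    exact ⟨integrable_innerIntegrand hΦ.continuous hc,
      integrable_outerIntegrand hK hΦ hc x y x' y'⟩
  · obtain ⟨K, C, -, hK⟩ := isKer_unc hf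
    exact isRhoRho_iff hK
  · obtain ⟨K, C, -, hK⟩ := isKer_unc hf
    exact ⟨rho_mem_Ahat hf, isRhoRho_DeltaHat hK⟩
  · exact eq_comul hD' h b
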